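/- Consider a real random-access machine with exact arithmetic: every constant, memory access, arithmetic operation on reals ($+,-,\times,/,\sqrt{\cdot}$), addition or truncated subtraction of index integers, comparison, assignment and branch costs one operation. There are a program for this machine and a constant $C$ such that the following holds. Let $G=(\{1,\dots,n\},E,c,d)$ be a simple undirected graph with $m=|E|\ge 1$ edges, edge weights $c(i,j)>0$ and vertex weights $d(i)\ge 0$, and let $A\in\mathbb{R}^{n\times n}$ be its weighted Laplacian, $$A_{ii}=d(i)+\sum_{(i,k)\in E}c(i,k),\qquad A_{ij}=-c(i,j)\ \text{ if }(i,j)\in E,\qquad A_{ij}=0\ \text{ otherwise},$$ so that $m$ is the number of nonzeros in the strictly upper triangular part of $A$ (and $A$ has $n+2m$ nonzeros if its diagonal has no zeros). Let $b\in\mathbb{R}^n$ be such that $Ax=b$ is consistent, and let $\varepsilon\ge 0$. Given $n$, the nonzeros of $A$ in compressed-row storage, $b$ and $\varepsilon$, the program halts after at most $C\,(n+m)\sqrt{nm}$ operations and returns a maximum spanning forest $F$ of $G$, a number $t$ and a vector $x$ that are the result of the minimal-residual method preconditioned by the Laplacian $B$ of $(\{1,\dots,n\},F,c|_F,d)$,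 in the following sense. Write $B=LL^T$ (for instance, a Cholesky factorization; the choice of the square factor $L$ does not matter), let $L^+$ be the Moore–Penrose pseudo-inverse of $L$, and put $M=L^+A(L^+)^T$ and $f=L^+b$. For $r=0,1,2,\dots$ let $y^{(r)}$ minimize $\|f-My\|_2$ over the Krylov subspace $\operatorname{span}\{f,Mf,\dots,M^{r-1}f\}$. Then $t$ is the least $r$ with $\|f-My^{(r)}\|_2\le\varepsilon\|f\|_2$, and $L^Tx=y^{(t)}$; hence the preconditioned residual satisfies $\|L^+(b-Ax)\|_2\le\varepsilon\|L^+b\|_2$. For $\varepsilon=0$, in particular, $Ax=b$. The constant $C$ does not depend on $n$, $G$, $b$ or $\varepsilon$. -/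

import Mathlib

/-! ## A real random-access machine

Structured programs over finitely many arrays of natural numbers (used for indices and counters)
and finitely many arrays of real numbers, with exact arithmetic.  Every constant, memory access,
arithmetic operation, comparison, assignment and branch costs one operation. -/

namespace RealRAM

/-- The memory: `nat a i` is cell `i` of the `a`-th integer array, `real a i` is cell `i` of the
`a`-th real array. -/
structure State where
  nat : ℕ → ℕ → ℕ
  real : ℕ → ℕ → ℝ

/-- Integer expressions: constants, array access, sum and truncated difference. -/
inductive NExpr where
  | const (k : ℕ)
  | get (a : ℕ) (i : NExpr)
  | add (e₁ e₂ : NExpr)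
  | sub (e₁ e₂ : NExpr)

/-- Real expressions: rational constants, array access, the four arithmetic operations and the
square root (by convention `x / 0 = 0`, and `√x = 0` for `x < 0`). -/
inductive RExpr where
  | const (q : ℚ)
  | get (a : ℕ) (i : NExpr)
  | add (e₁ e₂ : RExpr)
  | sub (e₁ e₂ : RExpr)
  | mul (e₁ e₂ : RExpr)
  | div (e₁ e₂ : RExpr)
  | sqrt (e : RExpr)

/-- Tests: comparisons of integers and of reals, and their Boolean combinations. -/
inductive Test where
  | natLt (e₁ e₂ : NExpr)
  | natEq (e₁ e₂ : NExpr)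
  | realLt (e₁ e₂ : RExpr)
  | realLe (e₁ e₂ : RExpr)
  | not (c : Test)
  | and (c₁ c₂ : Test)

/-- Programs. -/
inductive Cmd where
  | skip
  | setNat (a : ℕ) (i e : NExpr)
  | setReal (a : ℕ) (i : NExpr) (e : RExpr)
  | seq (p q : Cmd)
  | ite (c : Test) (p q : Cmd)
  | while (c : Test) (p : Cmd)

namespace NExpr

def eval (s : State) : NExpr → ℕ
  | const k => k
  | get a i => s.nat a (i.eval s)
  | add e₁ e₂ => e₁.eval s + e₂.eval s
  | sub e₁ e₂ => e₁.eval s - e₂.eval s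

def cost : NExpr → ℕ
  | const _ => 1
  | get _ i => i.cost + 1
  | add e₁ e₂ => e₁.cost + e₂.cost + 1
  | sub e₁ e₂ => e₁.cost + e₂.cost + 1

end NExpr

namespace RExpr

noncomputable def eval (s : State) : RExpr → ℝ
  | const q => (q : ℝ)
  | get a i => s.real a (i.eval s)
  | add e₁ e₂ => e₁.eval s + e₂.eval s
  | sub e₁ e₂ => e₁.eval s - e₂.eval s
  | mul e₁ e₂ => e₁.eval s * e₂.eval s
  | div e₁ e₂ => e₁.eval s / e₂.eval s
  | sqrt e => Real.sqrt (e.eval s)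

def cost : RExpr → ℕ
  | const _ => 1
  | get _ i => i.cost + 1
  | add e₁ e₂ => e₁.cost + e₂.cost + 1
  | sub e₁ e₂ => e₁.cost + e₂.cost + 1
  | mul e₁ e₂ => e₁.cost + e₂.cost + 1
  | div e₁ e₂ => e₁.cost + e₂.cost + 1
  | sqrt e => e.cost + 1

end RExpr

namespace Test

def holds (s : State) : Test → Prop
  | natLt e₁ e₂ => e₁.eval s < e₂.eval s
  | natEq e₁ e₂ => e₁.eval s = e₂.eval s
  | realLt e₁ e₂ => e₁.eval s < e₂.eval s
  | realLe e₁ e₂ => e₁.eval s ≤ e₂.eval s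
  | not c => ¬ c.holds s
  | and c₁ c₂ => c₁.holds s ∧ c₂.holds s

def cost : Test → ℕ
  | natLt e₁ e₂ => e₁.cost + e₂.cost + 1
  | natEq e₁ e₂ => e₁.cost + e₂.cost + 1
  | realLt e₁ e₂ => e₁.cost + e₂.cost + 1
  | realLe e₁ e₂ => e₁.cost + e₂.cost + 1
  | not c => c.cost + 1
  | and c₁ c₂ => c₁.cost + c₂.cost + 1

end Test

namespace State

/-- Write `v` into cell `i` of the integer array `a`. -/
def setNat (s : State) (a i v : ℕ) : State :=
  { s with nat := Function.update s.nat a (Function.update (s.nat a) i v) }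

/-- Write `v` into cell `i` of the real array `a`. -/
def setReal (s : State) (a i : ℕ) (v : ℝ) : State :=
  { s with real := Function.update s.real a (Function.update (s.real a) i v) }

end State

/-- `Exec p s s' k`: started in memory `s`, the program `p` halts in memory `s'` after exactly `k`
operations. -/
inductive Exec : Cmd → State → State → ℕ → Prop where
  | skip (s : State) : Exec .skip s s 1
  | setNat (a : ℕ) (i e : NExpr) (s : State) :
      Exec (.setNat a i e) s (s.setNat a (i.eval s) (e.eval s)) (i.cost + e.cost + 1)
  | setReal (a : ℕ) (i : NExpr) (e : RExpr) (s : State) :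
      Exec (.setReal a i e) s (s.setReal a (i.eval s) (e.eval s)) (i.cost + e.cost + 1)
  | seq {p q : Cmd} {s₁ s₂ s₃ : State} {k₁ k₂ : ℕ}
      (h₁ : Exec p s₁ s₂ k₁) (h₂ : Exec q s₂ s₃ k₂) : Exec (.seq p q) s₁ s₃ (k₁ + k₂)
  | iteTrue {c : Test} {p q : Cmd} {s s' : State} {k : ℕ}
      (hc : c.holds s) (h : Exec p s s' k) : Exec (.ite c p q) s s' (c.cost + 1 + k)
  | iteFalse {c : Test} {p q : Cmd} {s s' : State} {k : ℕ}
      (hc : ¬ c.holds s) (h : Exec q s s' k) : Exec (.ite c p q) s s' (c.cost + 1 + k)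
  | whileTrue {c : Test} {p : Cmd} {s₁ s₂ s₃ : State} {k₁ k₂ : ℕ}
      (hc : c.holds s₁) (h₁ : Exec p s₁ s₂ k₁) (h₂ : Exec (.while c p) s₂ s₃ k₂) :
      Exec (.while c p) s₁ s₃ (c.cost + 1 + k₁ + k₂)
  | whileFalse {c : Test} {p : Cmd} {s : State}
      (hc : ¬ c.holds s) : Exec (.while c p) s s (c.cost + 1)

end RealRAM

/-! ## Weighted graphs, Laplacians and maximum spanning forests -/

/-- A graph on `{0, …, n-1}` with positive edge weights and nonnegative vertex weights (only the
values of `weight` on edges matter). -/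
structure WeightedGraph (n : ℕ) where
  graph : SimpleGraph (Fin n)
  weight : Sym2 (Fin n) → ℝ
  weight_pos : ∀ e ∈ graph.edgeSet, 0 < weight e
  vertexWeight : Fin n → ℝ
  vertexWeight_nonneg : ∀ i, 0 ≤ vertexWeight i

namespace WeightedGraph

variable {n : ℕ}

/-- The number of edges; this is the number of nonzeros in the strictly upper triangular part of
the Laplacian. -/
noncomputable def numEdges (G : WeightedGraph n) : ℕ := G.graph.edgeSet.ncard

open Classical in
/-- The Laplacian: `-c(i,j)` at the edges, and on the diagonal the vertex weight plus the total
weight of the incident edges. -/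
noncomputable def laplacian (G : WeightedGraph n) : Matrix (Fin n) (Fin n) ℝ :=
  Matrix.of fun i j =>
    if i = j then G.vertexWeight i + ∑ k with G.graph.Adj i k, G.weight s(i, k)
    else if G.graph.Adj i j then -G.weight s(i, j)
    else 0

/-- The weighted graph that keeps only the edges in `F`, with the same edge and vertex weights. Its
Laplacian has the same row sums as that of `G`. -/
def restrict (G : WeightedGraph n) (F : SimpleGraph (Fin n)) (hF : F ≤ G.graph) :
    WeightedGraph n where
  graph := F
  weight := G.weight
  weight_pos e he := G.weight_pos e (SimpleGraph.edgeSet_mono hF he)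
  vertexWeight := G.vertexWeight
  vertexWeight_nonneg := G.vertexWeight_nonneg

/-- A spanning forest: an acyclic subgraph with the same connected components. -/
structure IsSpanningForest (G : WeightedGraph n) (F : SimpleGraph (Fin n)) : Prop where
  le : F ≤ G.graph
  acyclic : F.IsAcyclic
  reachable : ∀ i j, G.graph.Reachable i j → F.Reachable i j

open Classical in
/-- The total weight of the edges of a subgraph. -/
noncomputable def totalWeight (G : WeightedGraph n) (F : SimpleGraph (Fin n)) : ℝ :=
  ∑ e : Sym2 (Fin n) with e ∈ F.edgeSet, G.weight e

/-- A spanning forest of maximum total weight. -/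
structure IsMaxSpanningForest (G : WeightedGraph n) (F : SimpleGraph (Fin n)) : Prop
    extends G.IsSpanningForest F where
  maximal : ∀ F', G.IsSpanningForest F' → G.totalWeight F' ≤ G.totalWeight F

end WeightedGraph

/-! ## The minimal-residual method and preconditioning -/

namespace Minres

open Matrix

variable {n : ℕ}

/-- The Euclidean norm. -/
noncomputable def norm2 (v : Fin n → ℝ) : ℝ := ‖WithLp.toLp 2 v‖

/-- The Krylov subspace spanned by `f, M f, …, M ^ (t - 1) f`. -/
def krylov (M : Matrix (Fin n) (Fin n) ℝ) (f : Fin n → ℝ) (t : ℕ) : Submodule ℝ (Fin n → ℝ) :=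
  Submodule.span ℝ (Set.range fun k : Fin t => (M ^ (k : ℕ)) *ᵥ f)

/-- `y` is the `t`-th iterate of the minimal-residual method for `M y = f`. -/
structure IsIterate (M : Matrix (Fin n) (Fin n) ℝ) (f : Fin n → ℝ) (t : ℕ) (y : Fin n → ℝ) :
    Prop where
  mem : y ∈ krylov M f t
  minimal : ∀ z ∈ krylov M f t, norm2 (f - M *ᵥ y) ≤ norm2 (f - M *ᵥ z)

/-- Run until the relative residual is at most `ε`, the minimal-residual method for `M y = f` stops
at iteration `t` and returns `y`. -/
structure IsResult (M : Matrix (Fin n) (Fin n) ℝ) (f : Fin n → ℝ) (ε : ℝ) (t : ℕ)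
    (y : Fin n → ℝ) : Prop where
  iterate : IsIterate M f t y
  converged : norm2 (f - M *ᵥ y) ≤ ε * norm2 f
  first : ∀ r < t, ∀ z, IsIterate M f r z → ε * norm2 f < norm2 (f - M *ᵥ z)

/-- `P` is the Moore-Penrose pseudo-inverse of `L`. -/
structure IsPseudoInverse (L P : Matrix (Fin n) (Fin n) ℝ) : Prop where
  left : L * P * L = L
  right : P * L * P = P
  symm_left : (L * P)ᵀ = L * P
  symm_right : (P * L)ᵀ = P * L

/-- The result of the minimal-residual method for `A x = b` with preconditioner `B = L Lᵀ`: the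
method is run on the symmetric system `(L⁺ A (L⁺)ᵀ) y = L⁺ b` until its relative residual is at
most `ε`, and `x` solves `Lᵀ x = y`.  A positive semidefinite `B` has such a factor `L` (the
Cholesky factor, in any ordering, or the square root), and all choices of `L` are equivalent: two
factors differ by an orthogonal matrix, which transforms `y` and leaves `x` and `t` unchanged. -/
def IsPreconditionedResult (A B : Matrix (Fin n) (Fin n) ℝ) (b : Fin n → ℝ) (ε : ℝ) (t : ℕ)
    (x : Fin n → ℝ) : Prop :=
  ∀ L P : Matrix (Fin n) (Fin n) ℝ, L * Lᵀ = B → IsPseudoInverse L P →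
    IsResult (P * A * Pᵀ) (P *ᵥ b) ε t (Lᵀ *ᵥ x)

end Minres

/-! ## Input and output of the solver -/

namespace Solver

open RealRAM

variable {n : ℕ}

/-- Compressed-row storage of a sparse matrix: the nonzeros of row `i`, each listed once and in any
order, occupy the positions `ptr i ≤ k < ptr (i + 1)`; `col k` is the column and `val k` the value
of the nonzero at position `k`. -/
structure IsCompressedRows (A : Matrix (Fin n) (Fin n) ℝ) (ptr col : ℕ → ℕ) (val : ℕ → ℝ) :
    Prop where
  start : ptr 0 = 0
  mono : ∀ i < n, ptr i ≤ ptr (i + 1)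
  entry : ∀ i : Fin n, ∀ k ∈ Set.Ico (ptr i) (ptr (i + 1)),
    ∃ j : Fin n, col k = j ∧ val k = A i j ∧ A i j ≠ 0
  listed : ∀ i j : Fin n, A i j ≠ 0 → ∃! k, k ∈ Set.Ico (ptr i) (ptr (i + 1)) ∧ col k = j

/-- The memory holds the order `n`, the sparse matrix `A`, the right-hand side `b` and the tolerance
`ε`.  All other cells are arbitrary. -/
structure IsInput (A : Matrix (Fin n) (Fin n) ℝ) (b : Fin n → ℝ) (ε : ℝ) (s : State) : Prop where
  order : s.nat 0 0 = n
  matrix : IsCompressedRows A (s.nat 1) (s.nat 2) (s.real 0)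
  rhs : ∀ i : Fin n, s.real 1 i = b i
  tolerance : s.real 2 0 = ε

/-- The number of iterations that is returned. -/
def outIterations (s : State) : ℕ := s.nat 3 0

/-- The vector that is returned. -/
def outVector (n : ℕ) (s : State) : Fin n → ℝ := fun i => s.real 3 i

/-- The graph that is returned, as a list of `s.nat 3 1` edges. -/
def outGraph (n : ℕ) (s : State) : SimpleGraph (Fin n) :=
  SimpleGraph.fromRel fun i j => ∃ k < s.nat 3 1, s.nat 4 k = i ∧ s.nat 5 k = j

end Solver

/-! The matrix `M = P * A * Pᵀ` is symmetric positive semidefinite and `P * b` lies in its range, so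
the conjugate residual recurrences produce the minimal-residual iterates until the residual
vanishes. Every vector in them lies in the range of `P`, so they can be run on preimages in the
original coordinates, where one iteration takes a product with `A` and a solution of a system with
`B`, but never a factor `L`. Since the forest has no cycles, a system with `B` is solved in linear
time by elimination from the leaves and back substitution from the roots.

As `A - B` is the Laplacian of the edges outside the forest, `M` differs from an orthogonal
projection by a matrix of rank at most `2 * m`, and the Krylov subspaces are contained in an
invariant subspace of dimension at most `min n (2 * m + 1) = O(√(n * m))`. This bounds the number of
iterations. The forest is grown by Prim's algorithm, one linear-time search for each edge. -/

/-! ### The conjugate residual method -/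

open scoped InnerProductSpace

section KrylovSubspace

variable {R M : Type*} [Semiring R] [AddCommMonoid M] [Module R M] {T : Module.End R M} {f : M}

/-- The Krylov subspace spanned by `f, T f, …, T ^ (k - 1) f`. -/
def krylovSubspace (T : Module.End R M) (f : M) (k : ℕ) : Submodule R M :=
  Submodule.span R ((fun i => (T ^ i) f) '' Set.Iio k)

theorem pow_apply_mem_krylovSubspace {i k : ℕ} (h : i < k) : (T ^ i) f ∈ krylovSubspace T f k :=
  Submodule.subset_span ⟨i, h, rfl⟩

theorem krylovSubspace_mono : Monotone (krylovSubspace T f) := fun _ _ h =>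
  Submodule.span_mono (Set.image_mono (Set.Iio_subset_Iio h))

theorem apply_mem_krylovSubspace {k : ℕ} {v : M} (hv : v ∈ krylovSubspace T f k) :
    T v ∈ krylovSubspace T f (k + 1) := by
  suffices krylovSubspace T f k ≤ (krylovSubspace T f (k + 1)).comap T from this hv
  refine Submodule.span_le.2 ?_
  rintro _ ⟨i, hi, rfl⟩
  rw [SetLike.mem_coe, Submodule.mem_comap, ← Module.End.mul_apply, ← pow_succ']
  exact pow_apply_mem_krylovSubspace (Nat.succ_lt_succ hi)

theorem krylovSubspace_le {W : Submodule R M} (hf : f ∈ W) (hT : W ≤ W.comap T) (k : ℕ) :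
    krylovSubspace T f k ≤ W := by
  have hpow (i : ℕ) : (T ^ i) f ∈ W := by
    induction i with
    | zero => exact hf
    | succ i ih => rw [pow_succ']; exact hT ih
  refine Submodule.span_le.2 ?_
  rintro _ ⟨i, -, rfl⟩
  exact hpow i

theorem krylovSubspace_le_range (hf : f ∈ T.range) (k : ℕ) : krylovSubspace T f k ≤ T.range :=
  krylovSubspace_le hf (fun v _ => ⟨v, rfl⟩) k

end KrylovSubspace

section Projection

variable {E : Type*} [NormedAddCommGroup E] [InnerProductSpace ℝ E]

/-- The coefficient of the orthogonal projection of `v` onto the line spanned by `w`; it is `0` if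
`w = 0`. -/
noncomputable def projCoeff (v w : E) : ℝ := ⟪v, w⟫_ℝ / ⟪w, w⟫_ℝ

theorem inner_sub_projCoeff_smul (v w : E) : ⟪v - projCoeff v w • w, w⟫_ℝ = 0 := by
  rcases eq_or_ne w 0 with rfl | hw
  · simp
  · rw [inner_sub_left, real_inner_smul_left, projCoeff,
      div_mul_cancel₀ _ (inner_self_ne_zero.2 hw), sub_self]

end Projection

namespace ConjugateResidual

variable {E : Type*} [NormedAddCommGroup E] [InnerProductSpace ℝ E] {T : E →ₗ[ℝ] E} {f : E}

/-- The current and the previous search direction of the conjugate residual method for `T y = f`.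
The next direction is `T p` made orthogonal to these two in the semi-inner product
`⟪T ·, T ·⟫`. -/
noncomputable def dirs (T : E →ₗ[ℝ] E) (f : E) : ℕ → E × E
  | 0 => (f, 0)
  | k + 1 =>
    let (p, q) := dirs T f k
    (T p - projCoeff (T (T p)) (T p) • p - projCoeff (T (T p)) (T q) • q, p)

/-- The `k`-th search direction. -/
noncomputable def dir (T : E →ₗ[ℝ] E) (f : E) (k : ℕ) : E := (dirs T f k).1

/-- The search direction before the `k`-th one, which is `0` for `k = 0`. -/
noncomputable def prevDir (T : E →ₗ[ℝ] E) (f : E) (k : ℕ) : E := (dirs T f k).2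

/-- The iterates of the conjugate residual method for `T y = f`. -/
noncomputable def iter (T : E →ₗ[ℝ] E) (f : E) : ℕ → E
  | 0 => 0
  | k + 1 => iter T f k + projCoeff (f - T (iter T f k)) (T (dir T f k)) • dir T f k

/-- The residual of the `k`-th iterate. -/
noncomputable def residual (T : E →ₗ[ℝ] E) (f : E) (k : ℕ) : E := f - T (iter T f k)

@[simp] theorem dir_zero : dir T f 0 = f := rfl

@[simp] theorem prevDir_zero : prevDir T f 0 = 0 := rfl

@[simp] theorem prevDir_succ (k : ℕ) : prevDir T f (k + 1) = dir T f k := rfl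

theorem dir_succ (k : ℕ) : dir T f (k + 1) = T (dir T f k)
    - projCoeff (T (T (dir T f k))) (T (dir T f k)) • dir T f k
    - projCoeff (T (T (dir T f k))) (T (prevDir T f k)) • prevDir T f k := rfl

@[simp] theorem iter_zero : iter T f 0 = 0 := rfl

theorem iter_succ (k : ℕ) : iter T f (k + 1) =
    iter T f k + projCoeff (residual T f k) (T (dir T f k)) • dir T f k := rfl

@[simp] theorem residual_zero : residual T f 0 = f := by simp [residual]

theorem residual_succ (k : ℕ) : residual T f (k + 1) =
    residual T f k - projCoeff (residual T f k) (T (dir T f k)) • T (dir T f k) := by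
  rw [residual, iter_succ, map_add, map_smul, sub_add_eq_sub_sub, residual]

theorem apply_dir (k : ℕ) : T (dir T f k) = dir T f (k + 1)
    + projCoeff (T (T (dir T f k))) (T (dir T f k)) • dir T f k
    + projCoeff (T (T (dir T f k))) (T (prevDir T f k)) • prevDir T f k := by
  rw [dir_succ]; abel

theorem dir_prevDir_mem_krylovSubspace (k : ℕ) :
    dir T f k ∈ krylovSubspace T f (k + 1) ∧ prevDir T f k ∈ krylovSubspace T f (k + 1) := by
  induction k with
  | zero => exact ⟨pow_apply_mem_krylovSubspace Nat.zero_lt_one, zero_mem _⟩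
  | succ k ih =>
    have hmono := krylovSubspace_mono (T := T) (f := f) (Nat.le_succ (k + 1))
    exact ⟨sub_mem (sub_mem (apply_mem_krylovSubspace ih.1) (Submodule.smul_mem _ _ (hmono ih.1)))
      (Submodule.smul_mem _ _ (hmono ih.2)), hmono ih.1⟩

theorem dir_mem_krylovSubspace {i k : ℕ} (h : i < k) : dir T f i ∈ krylovSubspace T f k :=
  krylovSubspace_mono h (dir_prevDir_mem_krylovSubspace i).1

theorem iter_mem_krylovSubspace (k : ℕ) : iter T f k ∈ krylovSubspace T f k := by
  induction k with
  | zero => exact zero_mem _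
  | succ k ih =>
    exact add_mem (krylovSubspace_mono k.le_succ ih)
      (Submodule.smul_mem _ _ (dir_mem_krylovSubspace k.lt_succ_self))

theorem residual_mem_krylovSubspace (k : ℕ) : residual T f k ∈ krylovSubspace T f (k + 1) :=
  sub_mem (dir_mem_krylovSubspace k.succ_pos) (apply_mem_krylovSubspace (iter_mem_krylovSubspace k))

theorem krylovSubspace_le_of_dir_mem {k : ℕ} {W : Submodule ℝ E} (h : ∀ i < k, dir T f i ∈ W) :
    krylovSubspace T f k ≤ W := by
  have hpow (i : ℕ) : (T ^ i) f ∈ Submodule.span ℝ (dir T f '' Set.Iic i) := by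
    induction i with
    | zero => exact Submodule.subset_span ⟨0, Set.self_mem_Iic, rfl⟩
    | succ i ih =>
      rw [pow_succ']
      suffices Submodule.span ℝ (dir T f '' Set.Iic i) ≤
          (Submodule.span ℝ (dir T f '' Set.Iic (i + 1))).comap T from this ih
      have hdir {l : ℕ} (hl : l ≤ i + 1) :
          dir T f l ∈ Submodule.span ℝ (dir T f '' Set.Iic (i + 1)) :=
        Submodule.subset_span ⟨l, hl, rfl⟩
      refine Submodule.span_le.2 ?_
      rintro _ ⟨l, hl : l ≤ i, rfl⟩
      rw [SetLike.mem_coe, Submodule.mem_comap, apply_dir]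
      refine add_mem (add_mem (hdir (by lia)) (Submodule.smul_mem _ _ (hdir (by lia))))
        (Submodule.smul_mem _ _ ?_)
      cases l with
      | zero => exact zero_mem _
      | succ l => exact hdir (by lia)
  refine Submodule.span_le.2 ?_
  rintro _ ⟨i, hi, rfl⟩
  refine Submodule.span_le.2 ?_ (hpow i)
  rintro _ ⟨l, hl, rfl⟩
  exact h l (hl.trans_lt hi)

section Symmetric

variable (hT : T.IsSymmetric)
include hT

theorem inner_apply_dir_of_lt {i k : ℕ} (hik : i < k) :
    ⟪T (dir T f k), T (dir T f i)⟫_ℝ = 0 := by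
  induction k using Nat.strong_induction_on generalizing i with
  | _ k ih =>
  obtain ⟨k, rfl⟩ := Nat.exists_eq_add_one_of_ne_zero (Nat.ne_zero_of_lt hik)
  have ih_prev {l j : ℕ} (hlj : l ≤ j) (hj : j ≤ k) :
      ⟪T (dir T f j), T (prevDir T f l)⟫_ℝ = 0 := by
    cases l with
    | zero => simp
    | succ l => exact ih j (by lia) hlj
  rw [dir_succ, map_sub, map_sub, map_smul, map_smul]
  rcases Nat.lt_succ_iff_lt_or_eq.1 hik with hik | rfl
  · obtain ⟨k, rfl⟩ := Nat.exists_eq_add_one_of_ne_zero (Nat.ne_zero_of_lt hik)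
    have hTk : ⟪T (dir T f (k + 1)), T (dir T f i)⟫_ℝ = 0 := ih _ (by lia) hik
    rcases Nat.lt_succ_iff_lt_or_eq.1 hik with hik' | rfl
    · -- By symmetry `T` moves to `dir i`, where the recurrence leaves only directions before `k`.
      have hTT : ⟪T (T (dir T f (k + 1))), T (dir T f i)⟫_ℝ = 0 := by
        rw [hT, apply_dir i, map_add, map_add, map_smul, map_smul, inner_add_right, inner_add_right,
          real_inner_smul_right, real_inner_smul_right, hTk, ih_prev (by lia) le_rfl,
          ih (k + 1) (by lia) (by lia)]
        simp
      rw [inner_sub_left, inner_sub_left, hTT, real_inner_smul_left, real_inner_smul_left, hTk,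
        prevDir_succ, ih k (by lia) hik']
      simp
    · rw [sub_right_comm, inner_sub_left, prevDir_succ, inner_sub_projCoeff_smul,
        real_inner_smul_left, hTk, mul_zero, sub_zero]
  · rw [inner_sub_left, inner_sub_projCoeff_smul, real_inner_smul_left, real_inner_comm,
      ih_prev le_rfl le_rfl, mul_zero, sub_zero]

theorem inner_apply_dir_of_ne {i j : ℕ} (hij : i ≠ j) :
    ⟪T (dir T f i), T (dir T f j)⟫_ℝ = 0 := by
  rcases hij.lt_or_gt with h | h
  · rw [real_inner_comm, inner_apply_dir_of_lt hT h]
  · exact inner_apply_dir_of_lt hT h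

theorem inner_residual_apply_dir {i k : ℕ} (hik : i < k) :
    ⟪residual T f k, T (dir T f i)⟫_ℝ = 0 := by
  induction k with
  | zero => lia
  | succ k ih =>
    rw [residual_succ]
    rcases Nat.lt_succ_iff_lt_or_eq.1 hik with h | rfl
    · rw [inner_sub_left, ih h, real_inner_smul_left, inner_apply_dir_of_lt hT h, mul_zero,
        sub_zero]
    · exact inner_sub_projCoeff_smul _ _

theorem inner_residual_apply {k : ℕ} {v : E} (hv : v ∈ krylovSubspace T f k) :
    ⟪residual T f k, T v⟫_ℝ = 0 :=
  krylovSubspace_le_of_dir_mem (W := ((innerₗ E (residual T f k)).comp T).ker)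
    (fun _ hi => inner_residual_apply_dir hT hi) hv

theorem norm_residual_le {k : ℕ} {v : E} (hv : v ∈ krylovSubspace T f k) :
    ‖residual T f k‖ ≤ ‖f - T v‖ := by
  have horth := inner_residual_apply hT (sub_mem (iter_mem_krylovSubspace k) hv)
  have hsplit : f - T v = residual T f k + T (iter T f k - v) := by
    rw [map_sub, residual]; abel
  refine le_of_sq_le_sq ?_ (norm_nonneg _)
  rw [hsplit, sq, sq, norm_add_sq_eq_norm_sq_add_norm_sq_of_inner_eq_zero _ _ horth]
  exact le_add_of_nonneg_right (mul_self_nonneg _)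

theorem norm_residual_antitone : Antitone fun k => ‖residual T f k‖ := fun _ _ h =>
  norm_residual_le hT (krylovSubspace_mono h (iter_mem_krylovSubspace _))

theorem eq_zero_of_mem_range_of_apply_eq_zero {v : E} (hv : v ∈ T.range) (h : T v = 0) :
    v = 0 := by
  have hker : v ∈ (T.range)ᗮ := hT.orthogonal_range ▸ h
  exact inner_self_eq_zero.1 (hker v hv)

variable (hf : f ∈ T.range)
include hf

theorem residual_eq_zero_of_apply_dir_eq_zero {k : ℕ} (h : T (dir T f k) = 0) :
    residual T f k = 0 := by
  have hrange {j : ℕ} {v : E} (hv : v ∈ krylovSubspace T f j) := krylovSubspace_le_range hf j hv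
  have hdir : dir T f k = 0 :=
    eq_zero_of_mem_range_of_apply_eq_zero hT (hrange (dir_mem_krylovSubspace k.lt_succ_self)) h
  have hstable : krylovSubspace T f (k + 1) ≤ krylovSubspace T f k := by
    refine krylovSubspace_le_of_dir_mem fun i hi => ?_
    rcases Nat.lt_succ_iff_lt_or_eq.1 hi with hi | rfl
    · exact dir_mem_krylovSubspace hi
    · rw [hdir]; exact zero_mem _
  have hres := residual_mem_krylovSubspace (T := T) (f := f) k
  have happly : T (residual T f k) = 0 := by
    rw [← inner_self_eq_zero (𝕜 := ℝ), hT]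
    exact inner_residual_apply hT (hstable (apply_mem_krylovSubspace (hstable hres)))
  exact eq_zero_of_mem_range_of_apply_eq_zero hT (hrange hres) happly

theorem apply_dir_ne_zero {j k : ℕ} (hjk : j ≤ k) (h : residual T f k ≠ 0) :
    T (dir T f j) ≠ 0 := by
  intro hj
  have hres := norm_residual_antitone (f := f) hT hjk
  simp only [residual_eq_zero_of_apply_dir_eq_zero hT hf hj, norm_zero, norm_le_zero_iff] at hres
  exact h hres

theorem lt_finrank_of_residual_ne_zero {k : ℕ} (h : residual T f k ≠ 0) (W : Submodule ℝ E)
    [FiniteDimensional ℝ W] (hfW : f ∈ W) (hTW : W ≤ W.comap T) : k < Module.finrank ℝ W := by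
  have hmem (i : Fin (k + 1)) : T (dir T f i) ∈ W :=
    hTW (krylovSubspace_le hfW hTW _ (dir_mem_krylovSubspace i.2))
  have hindep : LinearIndependent ℝ fun i : Fin (k + 1) => T (dir T f i) :=
    linearIndependent_of_ne_zero_of_inner_eq_zero
      (fun i => apply_dir_ne_zero hT hf (Nat.lt_succ_iff.1 i.2) h)
      fun i j hij => inner_apply_dir_of_ne hT (Fin.val_ne_of_ne hij)
  have hindepW : LinearIndependent ℝ fun i => (⟨_, hmem i⟩ : W) :=
    LinearIndependent.of_comp W.subtype hindep
  simpa using hindepW.fintype_card_le_finrank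

end Symmetric

end ConjugateResidual

namespace Minres

open Matrix

variable {n : ℕ} {A B L P : Matrix (Fin n) (Fin n) ℝ}

theorem IsPseudoInverse.mulVec_eq (hP : IsPseudoInverse L P) {w q : Fin n → ℝ}
    (h : (L * Lᵀ) *ᵥ w = q) : P *ᵥ q = Lᵀ *ᵥ w := by
  rw [← h, mulVec_mulVec, ← Matrix.mul_assoc, ← hP.symm_right, ← transpose_mul, ← Matrix.mul_assoc,
    hP.left]

theorem dotProduct_transpose_mulVec {w w' q : Fin n → ℝ} (h : (L * Lᵀ) *ᵥ w = q) :
    (Lᵀ *ᵥ w) ⬝ᵥ (Lᵀ *ᵥ w') = q ⬝ᵥ w' := by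
  rw [dotProduct_mulVec, ← mulVec_transpose, transpose_transpose, mulVec_mulVec, h]

theorem IsPseudoInverse.transpose_mul_mul (hP : IsPseudoInverse L P) : Lᵀ * (L * P) = Lᵀ := by
  rw [← hP.symm_left, ← transpose_mul, hP.left]

theorem IsPseudoInverse.mul_mul_eq_of_ker_le (hP : IsPseudoInverse L P)
    (hker : ∀ v, (L * Lᵀ) *ᵥ v = 0 → A *ᵥ v = 0) : A * (L * P) = A := by
  refine ext_of_mulVec_single fun i => ?_
  rw [← sub_eq_zero, ← sub_mulVec, ← Matrix.mul_one A, Matrix.mul_assoc, ← Matrix.mul_sub,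
    Matrix.one_mul, ← mulVec_mulVec]
  apply hker
  rw [mulVec_mulVec, Matrix.mul_assoc, Matrix.mul_sub, hP.transpose_mul_mul, Matrix.mul_one,
    sub_self, Matrix.mul_zero, zero_mulVec]

theorem IsPseudoInverse.mul_transpose_mul_transpose_mul (hP : IsPseudoInverse L P) :
    L * Lᵀ * (Pᵀ * P) = L * P := by
  calc L * Lᵀ * (Pᵀ * P) = L * (P * L)ᵀ * P := by rw [transpose_mul]; simp only [Matrix.mul_assoc]
    _ = L * P := by rw [hP.symm_right, ← Matrix.mul_assoc, hP.left]

theorem IsPseudoInverse.mul_factor_mul_transpose (hP : IsPseudoInverse L P) :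
    P * (L * Lᵀ) * Pᵀ = P * L := by
  calc P * (L * Lᵀ) * Pᵀ = P * L * (P * L)ᵀ := by
        rw [transpose_mul]; simp only [Matrix.mul_assoc]
    _ = P * L := by rw [hP.symm_right, ← Matrix.mul_assoc, hP.right]

theorem IsPseudoInverse.mul_mul_cancel_of_ker_le (hP : IsPseudoInverse L P) (hA : Aᵀ = A)
    (hker : ∀ v, (L * Lᵀ) *ᵥ v = 0 → A *ᵥ v = 0) : L * P * A = A := by
  simpa only [transpose_mul, hP.symm_left, hA] using
    congrArg transpose (hP.mul_mul_eq_of_ker_le hker)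

theorem IsPseudoInverse.exists_mulVec_eq (hP : IsPseudoInverse L P) (hA : Aᵀ = A)
    (hker : ∀ v, (L * Lᵀ) *ᵥ v = 0 → A *ᵥ v = 0) (u : Fin n → ℝ) :
    ∃ w, (L * Lᵀ) *ᵥ w = A *ᵥ u := by
  refine ⟨(Pᵀ * P) *ᵥ (A *ᵥ u), ?_⟩
  rw [mulVec_mulVec, hP.mul_transpose_mul_transpose_mul, mulVec_mulVec,
    hP.mul_mul_cancel_of_ker_le hA hker]

theorem IsPseudoInverse.preconditioned_mulVec (hP : IsPseudoInverse L P)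
    (hker : ∀ v, (L * Lᵀ) *ᵥ v = 0 → A *ᵥ v = 0) (u : Fin n → ℝ) :
    (P * A * Pᵀ) *ᵥ (Lᵀ *ᵥ u) = P *ᵥ (A *ᵥ u) := by
  rw [mulVec_mulVec, mulVec_mulVec, Matrix.mul_assoc, Matrix.mul_assoc, ← transpose_mul,
    hP.symm_left, hP.mul_mul_eq_of_ker_le hker]

theorem IsPreconditionedResult.mulVec_eq {b x : Fin n → ℝ} {t : ℕ}
    (h : IsPreconditionedResult A (L * Lᵀ) b 0 t x) (hP : IsPseudoInverse L P) (hA : Aᵀ = A)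
    (hker : ∀ v, (L * Lᵀ) *ᵥ v = 0 → A *ᵥ v = 0) (hb : ∃ x₀, A *ᵥ x₀ = b) : A *ᵥ x = b := by
  obtain ⟨x₀, rfl⟩ := hb
  have hres : P *ᵥ (A *ᵥ x₀ - A *ᵥ x) = 0 := by
    simpa [norm2, hP.preconditioned_mulVec hker, ← mulVec_sub] using (h L P rfl hP).converged
  rw [← mulVec_sub] at hres
  rw [eq_comm, ← sub_eq_zero, ← mulVec_sub, ← hP.mul_mul_cancel_of_ker_le hA hker, ← mulVec_mulVec,
    ← mulVec_mulVec, hres, mulVec_zero]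

open scoped MatrixOrder in
theorem exists_factor_of_posSemidef (hB : B.PosSemidef) :
    ∃ L P : Matrix (Fin n) (Fin n) ℝ, L * Lᵀ = B ∧ IsPseudoInverse L P := by
  have hcont (g : ℝ → ℝ) : ContinuousOn g (spectrum ℝ B) := B.finite_real_spectrum.continuousOn g
  have htr (g : ℝ → ℝ) : (cfc g B)ᵀ = cfc g B := by
    rw [← conjTranspose_eq_transpose_of_trivial]; exact cfc_predicate g B
  have hmul (g h : ℝ → ℝ) : cfc g B * cfc h B = cfc (g * h) B :=
    (cfc_mul g h B (hcont g) (hcont h)).symm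
  have hsqrt : cfc (Real.sqrt * Real.sqrt) B = B := by
    conv_rhs => rw [← cfc_id ℝ B hB.1]
    exact cfc_congr fun x hx => Real.mul_self_sqrt (spectrum_nonneg_of_nonneg hB.nonneg hx)
  refine ⟨cfc Real.sqrt B, cfc (Real.sqrt)⁻¹ B, ?_, ?_, ?_, ?_, ?_⟩
  · rw [htr, hmul, hsqrt]
  · rw [hmul, hmul]
    exact congrArg (cfc · B) (funext fun x => mul_inv_mul_cancel √x)
  · rw [hmul, hmul]
    exact congrArg (cfc · B) (funext fun x => by simpa using mul_inv_mul_cancel (√x)⁻¹)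
  · rw [hmul, htr]
  · rw [hmul, htr]

section Iteration

open WithLp ConjugateResidual

variable {M : Matrix (Fin n) (Fin n) ℝ} {f : Fin n → ℝ}

theorem toEuclideanLin_pow_toLp (i : ℕ) :
    (M.toEuclideanLin ^ i) (toLp 2 f) = toLp 2 ((M ^ i) *ᵥ f) := by
  induction i with
  | zero => simp
  | succ i ih =>
    rw [pow_succ', Module.End.mul_apply, ih, toLpLin_toLp, toLin'_apply, mulVec_mulVec,
      ← pow_succ']

theorem mem_krylov {k : ℕ} {y : Fin n → ℝ} :
    y ∈ krylov M f k ↔ toLp 2 y ∈ krylovSubspace M.toEuclideanLin (toLp 2 f) k := by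
  have himage : (fun i => (M.toEuclideanLin ^ i) (toLp 2 f)) '' Set.Iio k =
      (WithLp.linearEquiv 2 ℝ (Fin n → ℝ)).symm ''
        Set.range fun i : Fin k => (M ^ (i : ℕ)) *ᵥ f := by
    ext v
    simp only [toEuclideanLin_pow_toLp, Set.mem_image, Set.mem_Iio, Set.mem_range,
      Fin.exists_iff]
    simp
  rw [krylovSubspace, himage, ← LinearEquiv.coe_coe, Submodule.span_image]
  exact (Submodule.mem_map_equiv (e := (WithLp.linearEquiv 2 ℝ (Fin n → ℝ)).symm) _).symm

theorem norm2_sub_mulVec (y : Fin n → ℝ) :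
    norm2 (f - M *ᵥ y) = ‖toLp 2 f - M.toEuclideanLin (toLp 2 y)‖ := rfl

theorem isResult_of_toLp_eq_iter (hM : M.IsHermitian) {ε : ℝ} {t : ℕ} {y : Fin n → ℝ}
    (hy : toLp 2 y = iter M.toEuclideanLin (toLp 2 f) t)
    (hconv : ‖residual M.toEuclideanLin (toLp 2 f) t‖ ≤ ε * ‖toLp 2 f‖)
    (hfirst : ∀ r < t, ε * ‖toLp 2 f‖ < ‖residual M.toEuclideanLin (toLp 2 f) r‖) :
    IsResult M f ε t y := by
  have hT := isSymmetric_toEuclideanLin_iff.2 hM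
  have hnorm : norm2 (f - M *ᵥ y) = ‖residual M.toEuclideanLin (toLp 2 f) t‖ := by
    rw [norm2_sub_mulVec, hy]; rfl
  refine ⟨⟨mem_krylov.2 (hy ▸ iter_mem_krylovSubspace t), fun z hz => ?_⟩, hnorm.trans_le hconv,
    fun r hr z hz => (hfirst r hr).trans_le (norm_residual_le hT (mem_krylov.1 hz.mem))⟩
  rw [hnorm]
  exact norm_residual_le hT (mem_krylov.1 hz)

end Iteration

section IterationBound

open WithLp ConjugateResidual

variable (hP : IsPseudoInverse L P) (hA : A.IsHermitian)
  (hker : ∀ v, (L * Lᵀ) *ᵥ v = 0 → A *ᵥ v = 0) {x : Fin n → ℝ} {k : ℕ}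
  (h : residual (P * A * Pᵀ).toEuclideanLin (toLp 2 (P *ᵥ (A *ᵥ x))) k ≠ 0)

include hP hker in
theorem IsPseudoInverse.preconditioned_mem_range (x : Fin n → ℝ) :
    toLp 2 (P *ᵥ (A *ᵥ x)) ∈ (P * A * Pᵀ).toEuclideanLin.range :=
  ⟨toLp 2 (Lᵀ *ᵥ x), by
    rw [toLpLin_toLp, toLin'_apply, hP.preconditioned_mulVec hker]⟩

include hA in
theorem isHermitian_preconditioned : (P * A * Pᵀ).IsHermitian := by
  simpa using isHermitian_mul_mul_conjTranspose P hA

include hP hA hker h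

theorem IsPseudoInverse.lt_of_residual_ne_zero : k < n := by
  simpa using lt_finrank_of_residual_ne_zero
    (isSymmetric_toEuclideanLin_iff.2 (isHermitian_preconditioned hA))
    (hP.preconditioned_mem_range hker x) h ⊤ trivial le_top

/-- The preconditioned matrix differs from the projection `P * L` by `P * (A - L * Lᵀ) * Pᵀ`, so the
span of `P * A * x` and the range of `P * (A - L * Lᵀ)` is invariant. -/
theorem IsPseudoInverse.lt_rank_add_one_of_residual_ne_zero :
    k < (A - L * Lᵀ).rank + 1 := by
  let φ := (WithLp.linearEquiv 2 ℝ (Fin n → ℝ)).symm.toLinearMap ∘ₗ P.mulVecLin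
  let D := (A - L * Lᵀ).mulVecLin.range
  let W := Submodule.span ℝ {φ (A *ᵥ x)} ⊔ D.map φ
  have hW : W ≤ W.comap (P * A * Pᵀ).toEuclideanLin := by
    have hfix (q : Fin n → ℝ) :
        (P * A * Pᵀ).toEuclideanLin (φ q) = φ q + φ ((A - L * Lᵀ) *ᵥ (Pᵀ *ᵥ (P *ᵥ q))) := by
      have hproj : (P * (L * Lᵀ) * Pᵀ) *ᵥ (P *ᵥ q) = P *ᵥ q := by
        rw [hP.mul_factor_mul_transpose, mulVec_mulVec, hP.right]
      calc (P * A * Pᵀ).toEuclideanLin (φ q)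
          = toLp 2 ((P * (L * Lᵀ) * Pᵀ + P * (A - L * Lᵀ) * Pᵀ) *ᵥ (P *ᵥ q)) := by
            rw [← Matrix.add_mul, ← Matrix.mul_add, add_sub_cancel]; rfl
        _ = φ q + φ ((A - L * Lᵀ) *ᵥ (Pᵀ *ᵥ (P *ᵥ q))) := by
            rw [add_mulVec, hproj, ← mulVec_mulVec, ← mulVec_mulVec]; rfl
    have hrange : W ≤ φ.range :=
      sup_le (Submodule.span_le.2 (Set.singleton_subset_iff.2 ⟨_, rfl⟩)) LinearMap.map_le_range
    intro v hv
    obtain ⟨q, rfl⟩ := hrange hv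
    rw [Submodule.mem_comap, hfix]
    exact add_mem hv (Submodule.mem_sup_right ⟨_, ⟨_, rfl⟩, rfl⟩)
  calc k < Module.finrank ℝ W := lt_finrank_of_residual_ne_zero
        (isSymmetric_toEuclideanLin_iff.2 (isHermitian_preconditioned hA))
        (hP.preconditioned_mem_range hker x) h W
        (Submodule.mem_sup_left (Submodule.mem_span_singleton_self _)) hW
    _ ≤ 1 + (A - L * Lᵀ).rank := (Submodule.finrank_add_le_finrank_add_finrank _ _).trans
        (add_le_add ((finrank_span_le_card _).trans_eq (by simp)) (Submodule.finrank_map_le φ D))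
    _ = (A - L * Lᵀ).rank + 1 := add_comm _ _

end IterationBound

end Minres

/-! ### Spanning forests -/

namespace WeightedGraph

open Matrix Minres

variable {n : ℕ} (G : WeightedGraph n) {F : SimpleGraph (Fin n)}

section Entries

variable {G} {i j : Fin n}

theorem laplacian_apply_of_adj (h : G.graph.Adj i j) : G.laplacian i j = -G.weight s(i, j) := by
  simp [laplacian, h.ne, h]

theorem laplacian_apply_ne_zero_of_adj (h : G.graph.Adj i j) : G.laplacian i j ≠ 0 := by
  rw [laplacian_apply_of_adj h]
  exact neg_ne_zero.2 (G.weight_pos s(i, j) h).ne'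

theorem adj_of_laplacian_apply_ne_zero (hij : i ≠ j) (h : G.laplacian i j ≠ 0) :
    G.graph.Adj i j := by
  by_contra hn
  exact h (by simp [laplacian, hij, hn])

end Entries

theorem isHermitian_laplacian : G.laplacian.IsHermitian := by
  classical
  refine IsHermitian.ext fun i j => ?_
  rcases eq_or_ne i j with rfl | h
  · rfl
  · simp only [laplacian, of_apply, star_trivial, h, h.symm, G.graph.adj_comm, Sym2.eq_swap,
      if_false]

open Classical in
theorem laplacian_mulVec (v : Fin n → ℝ) (i : Fin n) : (G.laplacian *ᵥ v) i =
    G.vertexWeight i * v i + ∑ k with G.graph.Adj i k, G.weight s(i, k) * (v i - v k) := by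
  have hterm (j : Fin n) : G.laplacian i j * v j =
      (if i = j then (G.vertexWeight i + ∑ k with G.graph.Adj i k, G.weight s(i, k)) * v i else 0)
        - if G.graph.Adj i j then G.weight s(i, j) * v j else 0 := by
    rcases eq_or_ne i j with rfl | hij
    · simp [laplacian]
    · by_cases hadj : G.graph.Adj i j <;> simp [laplacian, hij, hadj]
  simp only [mulVec, dotProduct, hterm, Finset.sum_sub_distrib, Finset.sum_ite_eq, Finset.mem_univ,
    if_true, ← Finset.sum_filter, mul_sub]
  rw [add_mul, Finset.sum_mul, add_sub_assoc]

theorem laplacian_mulVec_one : G.laplacian *ᵥ (fun _ => 1) = G.vertexWeight := by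
  ext i
  simp [laplacian_mulVec]

open Classical in
theorem dotProduct_laplacian_mulVec (v : Fin n → ℝ) : v ⬝ᵥ (G.laplacian *ᵥ v) =
    ∑ i, G.vertexWeight i * v i ^ 2 +
      (∑ i, ∑ k with G.graph.Adj i k, G.weight s(i, k) * (v i - v k) ^ 2) / 2 := by
  have hswap : ∑ i, ∑ k with G.graph.Adj i k, v i * (G.weight s(i, k) * (v i - v k)) =
      ∑ i, ∑ k with G.graph.Adj i k, v k * (G.weight s(i, k) * (v k - v i)) := by
    simp only [Finset.sum_filter]
    rw [Finset.sum_comm]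
    refine Finset.sum_congr rfl fun i _ => Finset.sum_congr rfl fun k _ => ?_
    rw [G.graph.adj_comm, Sym2.eq_swap]
  have hsq : ∑ i, ∑ k with G.graph.Adj i k, G.weight s(i, k) * (v i - v k) ^ 2 =
      2 * ∑ i, ∑ k with G.graph.Adj i k, v i * (G.weight s(i, k) * (v i - v k)) := by
    rw [two_mul]
    conv_rhs => rw [hswap, ← hswap]
    nth_rewrite 2 [hswap]
    simp only [← Finset.sum_add_distrib]
    exact Finset.sum_congr rfl fun i _ => Finset.sum_congr rfl fun k _ => by ring
  rw [hsq, mul_div_cancel_left₀ _ two_ne_zero]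
  simp only [dotProduct, laplacian_mulVec, mul_add, Finset.sum_add_distrib, Finset.mul_sum]
  congr 1
  exact Finset.sum_congr rfl fun i _ => by ring

section QuadraticForm

variable (v : Fin n → ℝ)

theorem vertexWeight_mul_sq_nonneg (i : Fin n) : 0 ≤ G.vertexWeight i * v i ^ 2 :=
  mul_nonneg (G.vertexWeight_nonneg i) (sq_nonneg _)

theorem weight_mul_sq_nonneg {i k : Fin n} (h : G.graph.Adj i k) :
    0 ≤ G.weight s(i, k) * (v i - v k) ^ 2 :=
  mul_nonneg (G.weight_pos s(i, k) h).le (sq_nonneg _)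

open Classical in
theorem sum_weight_mul_sq_nonneg (i : Fin n) :
    0 ≤ ∑ k with G.graph.Adj i k, G.weight s(i, k) * (v i - v k) ^ 2 :=
  Finset.sum_nonneg fun _ hk => G.weight_mul_sq_nonneg v (Finset.mem_filter.1 hk).2

end QuadraticForm

theorem posSemidef_laplacian : G.laplacian.PosSemidef := by
  refine .of_dotProduct_mulVec_nonneg G.isHermitian_laplacian fun v => ?_
  rw [star_trivial, dotProduct_laplacian_mulVec]
  exact add_nonneg (Finset.sum_nonneg fun i _ => G.vertexWeight_mul_sq_nonneg v i)
    (div_nonneg (Finset.sum_nonneg fun i _ => G.sum_weight_mul_sq_nonneg v i) zero_le_two)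

theorem laplacian_mulVec_eq_zero_iff (v : Fin n → ℝ) : G.laplacian *ᵥ v = 0 ↔
    (∀ i, G.vertexWeight i * v i = 0) ∧ ∀ i k, G.graph.Adj i k → v i = v k := by
  classical
  have hV (i : Fin n) := G.vertexWeight_mul_sq_nonneg v i
  have hE (i : Fin n) := G.sum_weight_mul_sq_nonneg v i
  rw [← G.posSemidef_laplacian.dotProduct_mulVec_zero_iff, star_trivial,
    dotProduct_laplacian_mulVec, add_eq_zero_iff_of_nonneg (Finset.sum_nonneg fun i _ => hV i)
      (div_nonneg (Finset.sum_nonneg fun i _ => hE i) zero_le_two),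
    Finset.sum_eq_zero_iff_of_nonneg fun i _ => hV i, div_eq_zero_iff,
    or_iff_left (two_ne_zero' ℝ), Finset.sum_eq_zero_iff_of_nonneg fun i _ => hE i]
  refine and_congr (by simp) (forall_congr' fun i => ?_)
  rw [Finset.sum_eq_zero_iff_of_nonneg fun k hk =>
    G.weight_mul_sq_nonneg v (Finset.mem_filter.1 hk).2]
  simp only [Finset.mem_univ, Finset.mem_filter, true_and, true_imp_iff]
  refine forall₂_congr fun k hik => ?_
  simp [(G.weight_pos s(i, k) hik).ne', sub_eq_zero]

theorem eq_of_reachable {V α : Type*} {H : SimpleGraph V} {v : V → α}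
    (h : ∀ i k, H.Adj i k → v i = v k) {i k : V} (hr : H.Reachable i k) : v i = v k := by
  obtain ⟨p⟩ := hr
  induction p with
  | nil => rfl
  | cons ha _ ih => exact (h _ _ ha).trans ih

theorem card_support_le {V : Type*} [Finite V] (H : SimpleGraph V) :
    H.support.ncard ≤ 2 * H.edgeSet.ncard := by
  classical
  have := Fintype.ofFinite V
  rw [← SimpleGraph.coe_edgeFinset, Set.ncard_coe_finset, ← H.sum_degrees_eq_twice_card_edges,
    Set.ncard_eq_toFinset_card']
  calc H.support.toFinset.card ≤ ∑ i ∈ H.support.toFinset, H.degree i := by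
        rw [Finset.card_eq_sum_ones]
        exact Finset.sum_le_sum fun i hi =>
          (H.degree_pos_iff_exists_adj i).2 (H.mem_support.1 (Set.mem_toFinset.1 hi))
    _ ≤ ∑ i, H.degree i := Finset.sum_le_univ_sum_of_nonneg fun _ => Nat.zero_le _

theorem rank_laplacian_sub_restrict_le (hF : F ≤ G.graph) :
    (G.laplacian - (G.restrict F hF).laplacian).rank ≤ 2 * G.numEdges := by
  classical
  refine (rank_le_card_of_support_subset _ G.graph.support.toFinset ?_).trans
    ((Set.ncard_eq_toFinset_card' _).symm.trans_le (card_support_le G.graph))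
  refine Function.support_subset_iff'.2 fun i hi => funext fun j => ?_
  have hG (k : Fin n) : ¬ G.graph.Adj i k := fun h => hi (by simpa using ⟨k, h⟩)
  have hFi (k : Fin n) : ¬ F.Adj i k := fun h => hG k (hF h)
  simp [laplacian, restrict, hG, hFi]

namespace IsSpanningForest

variable {G} (hF : G.IsSpanningForest F)
include hF

theorem laplacian_mulVec_eq_zero {v : Fin n → ℝ} (h : (G.restrict F hF.le).laplacian *ᵥ v = 0) :
    G.laplacian *ᵥ v = 0 := by
  rw [laplacian_mulVec_eq_zero_iff] at h ⊢
  exact ⟨h.1, fun i k hik => eq_of_reachable h.2 (hF.reachable i k hik.reachable)⟩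

theorem exists_mulVec_eq (u : Fin n → ℝ) :
    ∃ w, (G.restrict F hF.le).laplacian *ᵥ w = G.laplacian *ᵥ u := by
  obtain ⟨L, P, hL, hP⟩ := exists_factor_of_posSemidef (G.restrict F hF.le).posSemidef_laplacian
  rw [← hL]
  exact hP.exists_mulVec_eq (G.isHermitian_laplacian) (fun v hv =>
    hF.laplacian_mulVec_eq_zero (hL ▸ hv)) u

theorem lt_of_residual_ne_zero {L P : Matrix (Fin n) (Fin n) ℝ}
    (hL : L * Lᵀ = (G.restrict F hF.le).laplacian) (hP : IsPseudoInverse L P) {x : Fin n → ℝ}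
    {k : ℕ} (h : ConjugateResidual.residual (P * G.laplacian * Pᵀ).toEuclideanLin
      (WithLp.toLp 2 (P *ᵥ (G.laplacian *ᵥ x))) k ≠ 0) :
    k < n ∧ k < 2 * G.numEdges + 1 := by
  have hker (v : Fin n → ℝ) (hv : (L * Lᵀ) *ᵥ v = 0) : G.laplacian *ᵥ v = 0 :=
    hF.laplacian_mulVec_eq_zero (hL ▸ hv)
  refine ⟨hP.lt_of_residual_ne_zero G.isHermitian_laplacian hker h,
    (hP.lt_rank_add_one_of_residual_ne_zero G.isHermitian_laplacian hker h).trans_le ?_⟩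
  rw [hL]
  exact Nat.succ_le_succ (G.rank_laplacian_sub_restrict_le hF.le)

end IsSpanningForest

theorem ncard_laplacian_ne_zero_le :
    {p : Fin n × Fin n | G.laplacian p.1 p.2 ≠ 0}.ncard ≤ n + 2 * G.numEdges := by
  classical
  have hsub : {p : Fin n × Fin n | G.laplacian p.1 p.2 ≠ 0} ⊆
      Set.range (fun i => (i, i)) ∪ Set.range (SimpleGraph.Dart.toProd (G := G.graph)) := by
    rintro ⟨i, j⟩ hij
    rcases eq_or_ne i j with rfl | hne
    · exact .inl ⟨i, rfl⟩
    · exact .inr ⟨⟨(i, j), adj_of_laplacian_apply_ne_zero hne hij⟩, rfl⟩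
  have hdart : Nat.card G.graph.Dart = 2 * G.numEdges := by
    rw [Nat.card_eq_fintype_card, SimpleGraph.dart_card_eq_twice_card_edges, numEdges,
      ← SimpleGraph.coe_edgeFinset, Set.ncard_coe_finset]
  calc _ ≤ _ := Set.ncard_le_ncard hsub
    _ ≤ _ := Set.ncard_union_le _ _
    _ ≤ _ := add_le_add (Finite.card_range_le _) (Finite.card_range_le _)
    _ = _ := by rw [Nat.card_fin, hdart]

end WeightedGraph

section Reachable

variable {V : Type*} {F : SimpleGraph V} {a b i j u v : V}

theorem reachable_deleteEdges_or (h : F.Reachable u v) :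
    (F.deleteEdges {s(a, b)}).Reachable u v ∨
      (F.deleteEdges {s(a, b)}).Reachable u a ∧ (F.deleteEdges {s(a, b)}).Reachable b v ∨
      (F.deleteEdges {s(a, b)}).Reachable u b ∧ (F.deleteEdges {s(a, b)}).Reachable a v := by
  obtain ⟨p⟩ := h
  induction p with
  | nil => exact Or.inl (.refl _)
  | @cons x y z hxy _ ih =>
    by_cases he : s(x, y) = s(a, b)
    · rcases Sym2.eq_iff.1 he with ⟨rfl, rfl⟩ | ⟨rfl, rfl⟩
      · rcases ih with h | h | h
        exacts [.inr (.inl ⟨.refl _, h⟩), .inr (.inl ⟨.refl _, h.2⟩), .inl h.2]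
      · rcases ih with h | h | h
        exacts [.inr (.inr ⟨.refl _, h⟩), .inl h.2, .inr (.inr ⟨.refl _, h.2⟩)]
    · have hadj : (F.deleteEdges {s(a, b)}).Reachable x y :=
        SimpleGraph.Adj.reachable (SimpleGraph.deleteEdges_adj.2 ⟨hxy, he⟩)
      exact ih.imp hadj.trans (.imp (.imp_left hadj.trans) (.imp_left hadj.trans))

theorem not_reachable_deleteEdges_of_mem_edges (hF : F.IsAcyclic) {p : F.Walk u v}
    (hp : p.IsPath) {e : Sym2 V} (he : e ∈ p.edges) : ¬ (F.deleteEdges {e}).Reachable u v := by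
  intro h
  obtain ⟨q, hq⟩ := h.exists_isPath
  have hpq : p = q.mapLe (F.deleteEdges_le _) :=
    congrArg Subtype.val ((hF.subsingleton_path u v).elim ⟨p, hp⟩
      ⟨_, hq.mapLe (F.deleteEdges_le _)⟩)
  rw [hpq, SimpleGraph.Walk.edges_mapLe_eq_edges] at he
  simpa using q.edges_subset_edgeSet he

theorem reachable_deleteEdges_sup_edge (hij : i ≠ j)
    (hF : F.Reachable i j) (hD : ¬ (F.deleteEdges {s(a, b)}).Reachable i j)
    (h : F.Reachable u v) :
    (F.deleteEdges {s(a, b)} ⊔ SimpleGraph.edge i j).Reachable u v := by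
  set D := F.deleteEdges {s(a, b)}
  have hle : D ≤ D ⊔ SimpleGraph.edge i j := le_sup_left
  have hnew : (D ⊔ SimpleGraph.edge i j).Reachable i j :=
    SimpleGraph.Adj.reachable (Or.inr ((SimpleGraph.adj_edge _ _).2 ⟨rfl, hij⟩))
  have hab : (D ⊔ SimpleGraph.edge i j).Reachable a b := by
    rcases reachable_deleteEdges_or hF with h | ⟨hia, hbj⟩ | ⟨hib, haj⟩
    · exact absurd h hD
    · exact (hia.mono hle).symm.trans (hnew.trans (hbj.mono hle).symm)
    · exact (haj.mono hle).trans (hnew.symm.trans (hib.mono hle))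
  rcases reachable_deleteEdges_or (a := a) (b := b) h with h | ⟨hua, hbv⟩ | ⟨hub, hav⟩
  · exact h.mono hle
  · exact (hua.mono hle).trans (hab.trans (hbv.mono hle))
  · exact (hub.mono hle).trans (hab.symm.trans (hav.mono hle))

end Reachable

namespace WeightedGraph

variable {n : ℕ} {G : WeightedGraph n} {F H : SimpleGraph (Fin n)} {a b i j : Fin n}

variable (G) in
theorem exists_isMaxSpanningForest : ∃ F, G.IsMaxSpanningForest F := by
  obtain ⟨F₀, hle, hacyclic, hreach⟩ := G.graph.exists_isAcyclic_reachable_eq_le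
  obtain ⟨F, hF, hmax⟩ := Set.exists_max_image {F | G.IsSpanningForest F} G.totalWeight
    (Set.toFinite _) ⟨F₀, hle, hacyclic, fun i j h => by rw [hreach]; exact h⟩
  exact ⟨F, hF, hmax⟩

theorem totalWeight_deleteEdges (hab : F.Adj a b) :
    G.totalWeight (F.deleteEdges {s(a, b)}) = G.totalWeight F - G.weight s(a, b) := by
  classical
  have hmem : s(a, b) ∈ Finset.univ.filter (· ∈ F.edgeSet) := by simpa using hab
  rw [eq_sub_iff_add_eq, totalWeight, totalWeight, ← Finset.sum_erase_add _ _ hmem]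
  congr 2
  ext e
  simp [SimpleGraph.edgeSet_deleteEdges, and_comm]

theorem totalWeight_sup_edge (hij : ¬ F.Adj i j) (hne : i ≠ j) :
    G.totalWeight (F ⊔ SimpleGraph.edge i j) = G.totalWeight F + G.weight s(i, j) := by
  classical
  rw [add_comm, totalWeight, totalWeight, ← Finset.sum_insert (by simpa using hij)]
  congr 1
  ext e
  simp [SimpleGraph.edgeSet_edge_of_ne hne]

theorem IsSpanningForest.deleteEdges_sup_edge (hF : G.IsSpanningForest F) (hij : G.graph.Adj i j)
    (hD : ¬ (F.deleteEdges {s(a, b)}).Reachable i j) :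
    G.IsSpanningForest (F.deleteEdges {s(a, b)} ⊔ SimpleGraph.edge i j) where
  le := sup_le ((F.deleteEdges_le _).trans hF.le) ((SimpleGraph.edge_le_iff _).2 (.inr hij))
  acyclic := (hF.acyclic.anti (F.deleteEdges_le _)).sup_edge_of_not_reachable hD
  reachable u v h := reachable_deleteEdges_sup_edge hij.ne (hF.reachable i j hij.reachable) hD
    (hF.reachable u v h)

namespace IsMaxSpanningForest

/-- The path of `F` between the ends of the new edge leaves `S` through an edge that is at most as
heavy; the two edges are exchanged. -/
theorem exists_sup_edge_le (hF : G.IsMaxSpanningForest F) (hHF : H ≤ F) (S : Set (Fin n))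
    (hH : ∀ a b, H.Adj a b → a ∈ S → b ∈ S) (hij : G.graph.Adj i j) (hi : i ∈ S) (hj : j ∉ S)
    (hmax : ∀ a b, G.graph.Adj a b → a ∈ S → b ∉ S → G.weight s(a, b) ≤ G.weight s(i, j)) :
    ∃ F', G.IsMaxSpanningForest F' ∧ H ⊔ SimpleGraph.edge i j ≤ F' := by
  by_cases hFij : F.Adj i j
  · exact ⟨F, hF, sup_le hHF ((SimpleGraph.edge_le_iff _).2 (.inr hFij))⟩
  obtain ⟨p, hp⟩ := (hF.reachable i j hij.reachable).exists_isPath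
  obtain ⟨⟨⟨a, b⟩, hab : F.Adj a b⟩, hd, ha : a ∈ S, hb : b ∉ S⟩ := p.exists_boundary_dart S hi hj
  have hD : ¬ (F.deleteEdges {s(a, b)}).Reachable i j :=
    not_reachable_deleteEdges_of_mem_edges hF.acyclic hp (List.mem_map_of_mem hd)
  have hweight : G.totalWeight F ≤
      G.totalWeight (F.deleteEdges {s(a, b)} ⊔ SimpleGraph.edge i j) := by
    rw [totalWeight_sup_edge (fun h => hFij (F.deleteEdges_le _ h)) hij.ne,
      totalWeight_deleteEdges hab]
    linarith [hmax a b (hF.le hab) ha hb]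
  refine ⟨_, ⟨hF.deleteEdges_sup_edge hij hD, fun F' hF' => (hF.maximal F' hF').trans hweight⟩,
    sup_le_sup_right (fun x y hxy => SimpleGraph.deleteEdges_adj.2 ⟨hHF hxy, fun he => ?_⟩) _⟩
  rcases Sym2.eq_iff.1 he with ⟨rfl, rfl⟩ | ⟨rfl, rfl⟩
  · exact hb (hH _ _ hxy ha)
  · exact hb (hH _ _ hxy.symm ha)

theorem of_le (hF : G.IsMaxSpanningForest F) (hHF : H ≤ F)
    (hH : ∀ u v, G.graph.Adj u v → H.Reachable u v) : G.IsMaxSpanningForest H := by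
  suffices H = F by rwa [this]
  refine le_antisymm hHF fun a b hab => ?_
  by_contra hn
  have hbridge := SimpleGraph.isAcyclic_iff_forall_adj_isBridge.1 hF.acyclic hab
  refine SimpleGraph.isBridge_iff.1 hbridge ((hH a b (hF.le hab)).mono fun x y hxy => ?_)
  refine SimpleGraph.deleteEdges_adj.2 ⟨hHF hxy, fun he => hn ?_⟩
  rcases Sym2.eq_iff.1 he with ⟨rfl, rfl⟩ | ⟨rfl, rfl⟩
  exacts [hxy, hxy.symm]

end IsMaxSpanningForest

/-- The graph whose edges join each vertex `v` with `c v > 0` to its parent. -/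
def parentGraph {V : Type*} (par : V → V) (c : V → ℝ) : SimpleGraph V :=
  SimpleGraph.fromRel fun u v => 0 < c v ∧ par v = u

theorem parentGraph_update {V : Type*} [DecidableEq V] {par : V → V} {c : V → ℝ} {i j : V}
    (hij : i ≠ j) (hcj : c j = 0) {w : ℝ} (hw : 0 < w) :
    parentGraph (Function.update par j i) (Function.update c j w) =
      parentGraph par c ⊔ SimpleGraph.edge i j := by
  have hparent (u v : V) : (0 < Function.update c j w v ∧ Function.update par j i v = u) ↔
      (0 < c v ∧ par v = u) ∨ (v = j ∧ u = i) := by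
    rcases eq_or_ne v j with rfl | hv
    · simp [hw, hcj, eq_comm]
    · simp [hv]
  ext u v
  simp only [parentGraph, SimpleGraph.fromRel_adj, hparent, SimpleGraph.sup_adj,
    SimpleGraph.adj_edge, Sym2.eq_iff]
  grind

/-- An enumeration of `cnt` vertices: `pos v < cnt` is the position of `v`, and `pos v = n` if `v`
is not listed. -/
structure IsListing (pos : Fin n → ℕ) (cnt : ℕ) : Prop where
  pos_lt : ∀ v, pos v < cnt ∨ pos v = n
  surj : ∀ i < cnt, ∃ v, pos v = i
  inj : ∀ u v, pos u < n → pos u = pos v → u = v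

namespace IsListing

variable {pos : Fin n → ℕ} {cnt : ℕ}

theorem empty : IsListing (fun _ : Fin n => n) 0 :=
  ⟨fun _ => Or.inr rfl, fun _ h => absurd h (Nat.not_lt_zero _),
    fun _ _ h => absurd h (lt_irrefl _)⟩

variable (h : IsListing pos cnt)
include h

theorem cnt_le_card {T : Finset (Fin n)} (hT : ∀ v, pos v < cnt → v ∈ T) : cnt ≤ T.card := by
  have hsub : Finset.range cnt ⊆ T.image pos := fun i hi => by
    obtain ⟨v, rfl⟩ := h.surj i (Finset.mem_range.1 hi)
    exact Finset.mem_image_of_mem _ (hT v (Finset.mem_range.1 hi))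
  simpa using (Finset.card_le_card hsub).trans Finset.card_image_le

theorem cnt_le : cnt ≤ n := by
  simpa using h.cnt_le_card fun v _ => Finset.mem_univ v

theorem cnt_lt {j : Fin n} (hj : pos j = n) : cnt < n := by
  have hcard := h.cnt_le_card (T := Finset.univ.erase j) fun v hv =>
    Finset.mem_erase.2 ⟨fun e => by rw [e, hj] at hv; exact hv.not_ge h.cnt_le, Finset.mem_univ _⟩
  rw [Finset.card_erase_of_mem (Finset.mem_univ _), Finset.card_univ, Fintype.card_fin] at hcard
  have := j.pos
  lia

theorem update_lt_iff {j : Fin n} (hj : pos j = n) {v : Fin n} :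
    Function.update pos j cnt v < n ↔ v = j ∨ pos v < n := by
  rcases eq_or_ne v j with rfl | hv
  · simpa using h.cnt_lt hj
  · simp [hv]

theorem update_eq_iff {j : Fin n} (hj : pos j = n) {v : Fin n} :
    Function.update pos j cnt v = n ↔ v ≠ j ∧ pos v = n := by
  rcases eq_or_ne v j with rfl | hv
  · simpa using (h.cnt_lt hj).ne
  · simp [hv]

theorem append {j : Fin n} (hj : pos j = n) :
    IsListing (Function.update pos j cnt) (cnt + 1) where
  pos_lt v := by
    have := h.pos_lt v
    rcases eq_or_ne v j with rfl | hv
    · simp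
    · rw [Function.update_of_ne hv]; lia
  surj i hi := by
    rcases Nat.lt_succ_iff_lt_or_eq.1 hi with hi | rfl
    · obtain ⟨v, rfl⟩ := h.surj i hi
      refine ⟨v, Function.update_of_ne ?_ _ _⟩
      rintro rfl
      exact (hi.trans (h.cnt_lt hj)).ne hj
    · exact ⟨j, Function.update_self _ _ _⟩
  inj u v hu huv := by
    have hu' := h.pos_lt u
    have hv' := h.pos_lt v
    have hlt := h.cnt_lt hj
    by_cases huj : u = j <;> by_cases hvj : v = j
    · exact huj.trans hvj.symm
    · rw [huj, Function.update_self, Function.update_of_ne hvj] at huv; lia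
    · rw [hvj, Function.update_self, Function.update_of_ne huj] at huv; lia
    · rw [Function.update_of_ne huj] at hu
      rw [Function.update_of_ne huj, Function.update_of_ne hvj] at huv
      exact h.inj u v hu huv

end IsListing

/-- A partial enumeration of the vertices in which parents precede their children. The vertices with
`c v = 0` have no parent. -/
structure ParentOrder (par : Fin n → Fin n) (c : Fin n → ℝ) (pos : Fin n → ℕ) (cnt : ℕ) : Prop
    extends IsListing pos cnt where
  nonneg : ∀ v, 0 ≤ c v
  par_lt : ∀ v, 0 < c v → pos (par v) < pos v
  unlisted : ∀ v, pos v = n → c v = 0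

namespace ParentOrder

variable {par : Fin n → Fin n} {c : Fin n → ℝ} {pos : Fin n → ℕ} {cnt : ℕ}

theorem empty (par : Fin n → Fin n) : ParentOrder par (fun _ => 0) (fun _ => n) 0 :=
  ⟨.empty, fun _ => le_rfl, fun _ h => absurd h (lt_irrefl _), fun _ _ => rfl⟩

variable (h : ParentOrder par c pos cnt)
include h

theorem pos_lt_of_pos {v : Fin n} (hv : 0 < c v) : pos v < n :=
  (h.pos_lt v).elim (fun hlt => hlt.trans_le h.cnt_le)
    fun e => absurd (h.unlisted v e) hv.ne'

theorem append {j : Fin n} (hj : pos j = n) {i : Fin n} {w : ℝ} (hw : 0 ≤ w)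
    (hi : 0 < w → pos i < n) :
    ParentOrder (Function.update par j i) (Function.update c j w) (Function.update pos j cnt)
      (cnt + 1) where
  toIsListing := h.toIsListing.append hj
  nonneg v := by
    rcases eq_or_ne v j with rfl | hv
    · simpa using hw
    · simpa [hv] using h.nonneg v
  par_lt v hv := by
    rcases eq_or_ne v j with rfl | hvj
    · rw [Function.update_self] at hv
      rw [Function.update_self, Function.update_self]
      have hilt := hi hv
      rw [Function.update_of_ne (by rintro rfl; lia)]
      exact (h.pos_lt i).resolve_right hilt.ne
    · rw [Function.update_of_ne hvj] at hv ⊢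
      have hlt := h.par_lt v hv
      have hvn := h.pos_lt_of_pos hv
      rwa [Function.update_of_ne hvj, Function.update_of_ne]
      intro e
      rw [e, hj] at hlt
      lia
  unlisted v hv := by
    obtain ⟨hvj, hvn⟩ := (h.update_eq_iff hj).1 hv
    rw [Function.update_of_ne hvj]
    exact h.unlisted v hvn

theorem append_root {j : Fin n} (hj : pos j = n) :
    ParentOrder par c (Function.update pos j cnt) (cnt + 1) := by
  simpa using h.append (i := par j) hj (h.nonneg j) fun hpos => absurd (h.unlisted j hj) hpos.ne'

theorem lt_of_parentGraph_adj {a b : Fin n} (hab : (parentGraph par c).Adj a b) : pos b < n := by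
  rcases (SimpleGraph.fromRel_adj _ _ _).1 hab |>.2 with ⟨hb, -⟩ | ⟨ha, rfl⟩
  · exact h.pos_lt_of_pos hb
  · exact (h.par_lt a ha).trans (h.pos_lt_of_pos ha)

end ParentOrder

/-- The state of Prim's algorithm, run on one connected component after the other: the forest grown
so far is given by parents `par` and weights `c` (`0` at the roots), and lies in a maximum spanning
forest. Isolated vertices are not listed. -/
structure IsPrimState (G : WeightedGraph n) (par : Fin n → Fin n) (c : Fin n → ℝ) (pos : Fin n → ℕ)
    (cnt : ℕ) : Prop extends ParentOrder par c pos cnt where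
  weight : ∀ v, 0 < c v → G.graph.Adj (par v) v ∧ c v = G.weight s(par v, v)
  mem_support : ∀ v, pos v < n → v ∈ G.graph.support
  forest : ∃ F, G.IsMaxSpanningForest F ∧ parentGraph par c ≤ F
  joined : ∀ u v, pos u < n → pos v < n → G.graph.Adj u v → (parentGraph par c).Reachable u v
  root : ∃ r, ∀ u v, pos u < n → pos v = n → G.graph.Adj u v → (parentGraph par c).Reachable r u

namespace IsPrimState

variable {par : Fin n → Fin n} {c : Fin n → ℝ} {pos : Fin n → ℕ} {cnt : ℕ}

theorem empty (hn : 0 < n) (par : Fin n → Fin n) :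
    G.IsPrimState par (fun _ => 0) (fun _ => n) 0 where
  toParentOrder := ParentOrder.empty par
  weight _ h := absurd h (lt_irrefl _)
  mem_support _ h := absurd h (lt_irrefl _)
  forest := by
    obtain ⟨F, hF⟩ := G.exists_isMaxSpanningForest
    refine ⟨F, hF, fun a b hab => ?_⟩
    rcases ((SimpleGraph.fromRel_adj _ _ _).1 hab).2 with h | h <;> exact absurd h.1 (lt_irrefl _)
  joined _ _ h := absurd h (lt_irrefl _)
  root := ⟨⟨0, hn⟩, fun _ _ h => absurd h (lt_irrefl _)⟩

variable (h : G.IsPrimState par c pos cnt)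
include h

theorem cnt_le_numEdges : cnt ≤ 2 * G.numEdges := by
  classical
  refine (h.cnt_le_card (T := G.graph.support.toFinset) fun v hv => ?_).trans ?_
  · simpa using h.mem_support v (hv.trans_le h.cnt_le)
  · rw [← Set.ncard_eq_toFinset_card']
    exact card_support_le G.graph

theorem visit (hi : pos i < n) (hj : pos j = n) (hij : G.graph.Adj i j)
    (hmax : ∀ a b, G.graph.Adj a b → pos a < n → pos b = n →
      G.weight s(a, b) ≤ G.weight s(i, j)) :
    G.IsPrimState (Function.update par j i) (Function.update c j (G.weight s(i, j)))
      (Function.update pos j cnt) (cnt + 1) := by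
  have hw := G.weight_pos s(i, j) hij
  have hP := parentGraph_update (par := par) hij.ne (h.unlisted j hj) hw
  have hle : parentGraph par c ≤ parentGraph par c ⊔ SimpleGraph.edge i j := le_sup_left
  have hadj : (parentGraph par c ⊔ SimpleGraph.edge i j).Reachable i j :=
    SimpleGraph.Adj.reachable (Or.inr ((SimpleGraph.adj_edge _ _).2 ⟨rfl, hij.ne⟩))
  obtain ⟨r, hr⟩ := h.root
  have hrj := ((hr i j hi hj hij).mono hle).trans hadj
  have hnew (v : Fin n) (hv : pos v < n) (hvj : G.graph.Adj v j) :
      (parentGraph par c ⊔ SimpleGraph.edge i j).Reachable v j :=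
    ((hr v j hv hj hvj).mono hle).symm.trans hrj
  refine ⟨h.toParentOrder.append hj hw.le fun _ => hi, fun v hv => ?_, fun v hv => ?_, ?_,
    fun u v hu' hv' huv => ?_, r, fun u v hu' hv' huv => ?_⟩
  · rcases eq_or_ne v j with rfl | hvj
    · simpa using hij
    · simp only [Function.update_of_ne hvj] at hv ⊢
      exact h.weight v hv
  · rcases (h.update_lt_iff hj).1 hv with rfl | hv
    exacts [⟨i, hij.symm⟩, h.mem_support v hv]
  · obtain ⟨F, hF, hPF⟩ := h.forest
    rw [hP]
    exact hF.exists_sup_edge_le hPF {v | pos v < n} (fun a b hab _ => h.lt_of_parentGraph_adj hab)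
      hij hi hj.not_lt fun a b hab ha hb =>
        hmax a b hab ha ((h.pos_lt b).resolve_left fun hlt => hb (hlt.trans_le h.cnt_le))
  · rw [hP]
    rcases (h.update_lt_iff hj).1 hu' with rfl | hu <;>
      rcases (h.update_lt_iff hj).1 hv' with rfl | hv
    exacts [.refl _, (hnew v hv huv.symm).symm, hnew u hu huv, (h.joined u v hu hv huv).mono hle]
  · rw [hP]
    have hv := ((h.update_eq_iff hj).1 hv').2
    rcases (h.update_lt_iff hj).1 hu' with rfl | hu
    exacts [hrj, (hr u v hu hv huv).mono hle]

theorem visit_root (hj : pos j = n) (hsupp : j ∈ G.graph.support)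
    (hno : ∀ a b, G.graph.Adj a b → pos a < n → pos b ≠ n) :
    G.IsPrimState par c (Function.update pos j cnt) (cnt + 1) := by
  refine ⟨h.toParentOrder.append_root hj, h.weight, fun v hv => ?_, h.forest,
    fun u v hu' hv' huv => ?_, j, fun u v hu' hv' huv => ?_⟩
  · rcases (h.update_lt_iff hj).1 hv with rfl | hv
    exacts [hsupp, h.mem_support v hv]
  · rcases (h.update_lt_iff hj).1 hu' with rfl | hu <;>
      rcases (h.update_lt_iff hj).1 hv' with rfl | hv
    exacts [.refl _, absurd hj (hno v u huv.symm hv), absurd hj (hno u v huv hu),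
      h.joined u v hu hv huv]
  · have hv := ((h.update_eq_iff hj).1 hv').2
    rcases (h.update_lt_iff hj).1 hu' with rfl | hu
    exacts [.refl _, absurd hv (hno u v huv hu)]

theorem isMaxSpanningForest (hall : ∀ v ∈ G.graph.support, pos v < n) :
    G.IsMaxSpanningForest (parentGraph par c) := by
  obtain ⟨F, hF, hle⟩ := h.forest
  exact hF.of_le hle fun u v huv => h.joined u v (hall u ⟨v, huv⟩) (hall v ⟨u, huv.symm⟩) huv

end IsPrimState
end WeightedGraph

namespace WeightedGraph

open Matrix

variable {n : ℕ} {G : WeightedGraph n} {par : Fin n → Fin n} {c : Fin n → ℝ} {pos : Fin n → ℕ}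
  {cnt k : ℕ} {D g g' q w : Fin n → ℝ}

/-- The right-hand side `g` left of `q` after the vertices at the positions `k` and above have been
eliminated with the pivots `D u + c u`: each of them passes the fraction `c u / (D u + c u)` of its
own entry on to its parent. For the vertex weights `q`, the entries `D` themselves arise in this
way. -/
def IsEliminated (par : Fin n → Fin n) (c : Fin n → ℝ) (pos : Fin n → ℕ) (k : ℕ)
    (D q g : Fin n → ℝ) : Prop :=
  ∀ x, g x = q x + ∑ u with par u = x ∧ k ≤ pos u, c u / (D u + c u) * g u

/-- One step of the elimination: `v` passes the fraction `c v / (D v + c v)` of its entry on to its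
parent. -/
noncomputable def passToParent (par : Fin n → Fin n) (c D : Fin n → ℝ) (v : Fin n)
    (g : Fin n → ℝ) : Fin n → ℝ :=
  Function.update g (par v) (g (par v) + c v / (D v + c v) * g v)

namespace ParentOrder

variable (h : ParentOrder par c pos cnt)
include h

theorem isEliminated_cnt (D q : Fin n → ℝ) : IsEliminated par c pos cnt D q q := fun x => by
  rw [Finset.sum_eq_zero, add_zero]
  intro u hu
  have hpos := (h.pos_lt u).resolve_left (Finset.mem_filter.1 hu).2.2.not_gt
  simp [h.unlisted u hpos]

theorem passToParent_apply_of_pos_le {v u : Fin n} (hu : pos v ≤ pos u) :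
    passToParent par c D v g u = g u := by
  rcases eq_or_ne u (par v) with rfl | hne
  · have hcv : c v = 0 := le_antisymm (not_lt.1 fun hc => (h.par_lt v hc).not_ge hu) (h.nonneg v)
    simp [passToParent, hcv]
  · exact Function.update_of_ne hne _ _

theorem isEliminated_passToParent {v : Fin n} (hv : pos v < n)
    (hg : IsEliminated par c pos (pos v + 1) D q g) :
    IsEliminated par c pos (pos v) (passToParent par c D v D) q (passToParent par c D v g) := by
  intro x
  rw [Finset.sum_congr rfl fun u hu => by
    have hu := (Finset.mem_filter.1 hu).2.2
    rw [h.passToParent_apply_of_pos_le hu, h.passToParent_apply_of_pos_le hu]]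
  have hmem (u : Fin n) : pos v ≤ pos u ↔ u = v ∨ pos v + 1 ≤ pos u := by
    have := h.inj v u hv
    grind
  simp only [hmem]
  rcases eq_or_ne x (par v) with rfl | hx
  · have hinsert : Finset.univ.filter (fun u => par u = par v ∧ (u = v ∨ pos v + 1 ≤ pos u)) =
        insert v (Finset.univ.filter fun u => par u = par v ∧ pos v + 1 ≤ pos u) := by
      ext u
      simp
      grind
    rw [passToParent, Function.update_self, hinsert, Finset.sum_insert (by simp), hg (par v)]
    ring
  · rw [passToParent, Function.update_of_ne hx, hg x]
    congr 2
    ext u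
    simp
    grind

theorem backSubstitution_step {v : Fin n} (hv : pos v < n)
    (hw : ∀ u, pos u < pos v → w u = (g u + c u * w (par u)) / (D u + c u)) {w' : Fin n → ℝ}
    (hw' : w' = Function.update w v ((g v + c v * w (par v)) / (D v + c v))) {u : Fin n}
    (hu : pos u ≤ pos v) : w' u = (g u + c u * w' (par u)) / (D u + c u) := by
  have hpar : c u * w' (par u) = c u * w (par u) := by
    rcases (h.nonneg u).eq_or_lt with hc | hc
    · rw [← hc, zero_mul, zero_mul]
    · have hne : par u ≠ v := by
        rintro rfl
        exact ((h.par_lt u hc).trans_le hu).false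
      rw [hw', Function.update_of_ne hne]
  rw [hpar, hw']
  rcases eq_or_ne u v with rfl | huv
  · rw [Function.update_self]
  · rw [Function.update_of_ne huv]
    exact hw u (hu.lt_of_ne fun he => huv (h.inj v u hv he.symm).symm)

theorem leaf_induction {p : Fin n → Prop} (hp : ∀ x, (∀ u, 0 < c u → par u = x → p u) → p x)
    (x : Fin n) : p x := by
  induction hd : n - pos x using Nat.strong_induction_on generalizing x with
  | _ d ih =>
    refine hp x fun u hu hux => ih _ ?_ u rfl
    have hlt := h.par_lt u hu
    have hun := h.pos_lt_of_pos hu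
    rw [hux] at hlt
    lia

theorem isEliminated_nonneg (hq : ∀ v, 0 ≤ q v) (hD : IsEliminated par c pos k D q D)
    (x : Fin n) : 0 ≤ D x := by
  induction x using h.leaf_induction with
  | _ x ih =>
    rw [hD x]
    refine add_nonneg (hq x) (Finset.sum_nonneg fun u hu => ?_)
    rcases (h.nonneg u).eq_or_lt with hc | hc
    · simp [← hc]
    · have := ih u hc (Finset.mem_filter.1 hu).2.1
      positivity

theorem isEliminated_unique (hg : IsEliminated par c pos k D q g)
    (hg' : IsEliminated par c pos k D q g') : g = g' := by
  ext x
  induction x using h.leaf_induction with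
  | _ x ih =>
    rw [hg x, hg' x]
    congr 1
    refine Finset.sum_congr rfl fun u hu => ?_
    rcases (h.nonneg u).eq_or_lt with hc | hc
    · simp [← hc]
    · rw [ih u hc (Finset.mem_filter.1 hu).2.1]

variable (hw : ∀ v, 0 < c v → c v = G.weight s(par v, v)) (hle : parentGraph par c ≤ G.graph)
include hw

theorem restrict_laplacian_mulVec (w : Fin n → ℝ) (x : Fin n) :
    ((G.restrict (parentGraph par c) hle).laplacian *ᵥ w) x =
      G.vertexWeight x * w x + c x * (w x - w (par x)) +
        ∑ u with par u = x, c u * (w x - w u) := by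
  classical
  have hadj (k : Fin n) : (parentGraph par c).Adj x k ↔
      (0 < c x ∧ par x = k) ∨ (0 < c k ∧ par k = x) := by
    rw [parentGraph, SimpleGraph.fromRel_adj, or_comm, and_iff_right_of_imp]
    rintro (⟨hc, hk⟩ | ⟨hc, hk⟩) rfl <;> exact (h.par_lt _ hc).ne (congrArg pos hk)
  have hdisj : Disjoint (Finset.univ.filter fun k => 0 < c x ∧ par x = k)
      (Finset.univ.filter fun k => 0 < c k ∧ par k = x) := by
    refine Finset.disjoint_filter.2 fun k _ => ?_
    rintro ⟨hx, rfl⟩ ⟨hk, hkx⟩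
    have := h.par_lt _ hk
    rw [hkx] at this
    exact (h.par_lt x hx).not_gt this
  have hparent : ∑ k with 0 < c x ∧ par x = k, G.weight s(x, k) * (w x - w k) =
      c x * (w x - w (par x)) := by
    rcases (h.nonneg x).eq_or_lt with hx | hx
    · simp [← hx]
    · simp [hx, Finset.filter_eq, ← hw x hx, Sym2.eq_swap (a := x)]
  have hchildren : ∑ u with 0 < c u ∧ par u = x, G.weight s(x, u) * (w x - w u) =
      ∑ u with par u = x, c u * (w x - w u) := by
    rw [Finset.sum_filter, Finset.sum_filter]
    refine Finset.sum_congr rfl fun u _ => ?_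
    rcases (h.nonneg u).eq_or_lt with hu | hu
    · simp [← hu]
    · by_cases hux : par u = x
      · rw [if_pos ⟨hu, hux⟩, if_pos hux, hw u hu, hux]
      · simp [hux]
  rw [laplacian_mulVec, add_assoc, ← hparent, ← hchildren, ← Finset.sum_union hdisj,
    ← Finset.filter_or]
  congr 2
  exact Finset.filter_congr fun k _ => hadj k

theorem isEliminated_restrict_laplacian_mulVec
    (hD : IsEliminated par c pos 0 D G.vertexWeight D) (w : Fin n → ℝ) :
    IsEliminated par c pos 0 D ((G.restrict (parentGraph par c) hle).laplacian *ᵥ w)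
      fun x => D x * w x + c x * (w x - w (par x)) := by
  intro x
  have hchild (u : Fin n) (hu : par u = x) :
      c u * (w x - w u) + c u / (D u + c u) * (D u * w u + c u * (w u - w (par u))) =
        c u / (D u + c u) * D u * w x := by
    rcases (h.nonneg u).eq_or_lt with hc | hc
    · simp [← hc]
    · have := h.isEliminated_nonneg G.vertexWeight_nonneg hD u
      have : D u + c u ≠ 0 := by positivity
      rw [hu]
      field_simp
      ring
  have hDx := hD x
  simp only [zero_le, and_true] at hDx ⊢
  rw [h.restrict_laplacian_mulVec hw hle, add_assoc, ← Finset.sum_add_distrib,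
    Finset.sum_congr rfl fun u hu => hchild u (Finset.mem_filter.1 hu).2, ← Finset.sum_mul]
  linear_combination w x * hDx

/-- At the roots, where `c` vanishes, consistency is what makes `g` vanish along with the pivot
`D`, so that the junk value of the division is harmless. -/
theorem restrict_laplacian_mulVec_eq (hD : IsEliminated par c pos 0 D G.vertexWeight D)
    (hg : IsEliminated par c pos 0 D q g)
    (hwv : ∀ v, w v = (g v + c v * w (par v)) / (D v + c v))
    (hq : ∃ z, (G.restrict (parentGraph par c) hle).laplacian *ᵥ z = q) :
    (G.restrict (parentGraph par c) hle).laplacian *ᵥ w = q := by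
  obtain ⟨z, rfl⟩ := hq
  have hgz : ∀ x, g x = D x * z x + c x * (z x - z (par x)) :=
    congrFun (h.isEliminated_unique hg (h.isEliminated_restrict_laplacian_mulVec hw hle hD z))
  have hgw (x : Fin n) : g x = D x * w x + c x * (w x - w (par x)) := by
    have hDx := h.isEliminated_nonneg G.vertexWeight_nonneg hD x
    have hcx := h.nonneg x
    rcases (add_nonneg hDx hcx).eq_or_lt with h0 | hpos
    · have hD0 : D x = 0 := by linarith
      have hc0 : c x = 0 := by linarith
      rw [hgz x, hD0, hc0]
      ring
    · have := hwv x
      rw [eq_div_iff hpos.ne'] at this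
      linear_combination -this
  ext x
  have hBw := h.isEliminated_restrict_laplacian_mulVec hw hle hD w x
  simp only [← hgw] at hBw
  linarith [hg x]

end ParentOrder
end WeightedGraph

/-! ### Running times of programs -/

namespace RealRAM

attribute [simp] NExpr.eval RExpr.eval Test.holds

notation:60 p:61 ";;" q:60 => RealRAM.Cmd.seq p q

namespace State

@[simp] theorem setNat_nat (s : State) (a i v a' j : ℕ) :
    (s.setNat a i v).nat a' j = if a' = a ∧ j = i then v else s.nat a' j := by
  unfold setNat
  by_cases ha : a' = a <;> by_cases hj : j = i <;> simp [ha, hj]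

@[simp] theorem setNat_real (s : State) (a i v : ℕ) : (s.setNat a i v).real = s.real := rfl

@[simp] theorem setReal_real (s : State) (a i : ℕ) (v : ℝ) (a' j : ℕ) :
    (s.setReal a i v).real a' j = if a' = a ∧ j = i then v else s.real a' j := by
  unfold setReal
  by_cases ha : a' = a <;> by_cases hj : j = i <;> simp [ha, hj]

@[simp] theorem setReal_nat (s : State) (a i : ℕ) (v : ℝ) : (s.setReal a i v).nat = s.nat := rfl

end State

namespace Cmd

/-- The cost of one pass through the text of a program, both branches of every `ite` included. -/
def size : Cmd → ℕ
  | skip => 1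
  | setNat _ i e => i.cost + e.cost + 1
  | setReal _ i e => i.cost + e.cost + 1
  | seq p q => p.size + q.size
  | ite c p q => c.cost + 1 + p.size + q.size
  | .while c p => c.cost + 1 + p.size

/-- Whether the text of the program contains an assignment to the integer array `a`. -/
@[simp] def writesNat (a : ℕ) : Cmd → Bool
  | skip => false
  | setNat a' _ _ => a == a'
  | setReal _ _ _ => false
  | seq p q => p.writesNat a || q.writesNat a
  | ite _ p q => p.writesNat a || q.writesNat a
  | .while _ p => p.writesNat a

/-- Whether the text of the program contains an assignment to the real array `a`. -/
@[simp] def writesReal (a : ℕ) : Cmd → Bool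
  | skip => false
  | setNat _ _ _ => false
  | setReal a' _ _ => a == a'
  | seq p q => p.writesReal a || q.writesReal a
  | ite _ p q => p.writesReal a || q.writesReal a
  | .while _ p => p.writesReal a

end Cmd

/-- The states `s` and `s'` agree on all arrays that `p` does not assign to. -/
structure Frame (p : Cmd) (s s' : State) : Prop where
  nat : ∀ a, p.writesNat a = false → s'.nat a = s.nat a
  real : ∀ a, p.writesReal a = false → s'.real a = s.real a

section Frame

variable {p q : Cmd} {s s₁ s₂ s₃ s' : State}

theorem Frame.refl (p : Cmd) (s : State) : Frame p s s := ⟨fun _ _ => rfl, fun _ _ => rfl⟩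

theorem Frame.trans (h₁ : Frame p s₁ s₂) (h₂ : Frame p s₂ s₃) : Frame p s₁ s₃ :=
  ⟨fun a h => (h₂.nat a h).trans (h₁.nat a h), fun a h => (h₂.real a h).trans (h₁.real a h)⟩

theorem Frame.mono (h : Frame p s s') (hnat : ∀ a, q.writesNat a = false → p.writesNat a = false)
    (hreal : ∀ a, q.writesReal a = false → p.writesReal a = false) : Frame q s s' :=
  ⟨fun a ha => h.nat a (hnat a ha), fun a ha => h.real a (hreal a ha)⟩

theorem Frame.of_setNat {a i v : ℕ} (h : p.writesNat a = true) : Frame p s (s.setNat a i v) := by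
  refine ⟨fun a' ha' => ?_, fun _ _ => rfl⟩
  have : a' ≠ a := by rintro rfl; simp [h] at ha'
  simp [State.setNat, this]

theorem Exec.frame {k : ℕ} (h : Exec p s s' k) : Frame p s s' := by
  induction h with
  | skip s => exact .refl _ s
  | setNat a i e s => exact .of_setNat (by simp)
  | setReal a i e s =>
    refine ⟨fun _ _ => rfl, fun a' h => ?_⟩
    have : a' ≠ a := by simpa using h
    simp [State.setReal, this]
  | seq _ _ ih₁ ih₂ =>
    exact (ih₁.mono (by simp +contextual) (by simp +contextual)).trans
      (ih₂.mono (by simp +contextual) (by simp +contextual))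
  | iteTrue _ _ ih => exact ih.mono (by simp +contextual) (by simp +contextual)
  | iteFalse _ _ ih => exact ih.mono (by simp +contextual) (by simp +contextual)
  | whileTrue _ _ _ ih₁ ih₂ => exact (ih₁.mono (by simp) (by simp)).trans ih₂
  | whileFalse _ => exact .refl _ _

end Frame

/-- Total correctness with a bound on the running time: started in `s`, the program `p` halts within
`p.size * B` operations in a state that satisfies `Q`. Bounds of this form are stable under
sequencing and branching, so that only loops have to be counted. -/
def Runs (B : ℕ) (p : Cmd) (s : State) (Q : State → Prop) : Prop :=
  ∃ s₁ k, Exec p s s₁ k ∧ k ≤ p.size * B ∧ Q s₁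

/-- The weakest precondition of a loop-free program. -/
@[simp] def wp : Cmd → (State → Prop) → State → Prop
  | .skip, Q, s => Q s
  | .setNat a i e, Q, s => Q (s.setNat a (i.eval s) (e.eval s))
  | .setReal a i e, Q, s => Q (s.setReal a (i.eval s) (e.eval s))
  | .seq p q, Q, s => wp p (wp q Q) s
  | .ite c p q, Q, s => (c.holds s → wp p Q s) ∧ (¬ c.holds s → wp q Q s)
  | .while _ _, _, _ => False

theorem wp.imp {p : Cmd} {s : State} {Q Q' : State → Prop} (h : wp p Q s)
    (hQ : ∀ s', Q s' → Q' s') : wp p Q' s := by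
  induction p generalizing s Q Q' with
  | seq p q ihp ihq => exact ihp h fun _ hq => ihq hq hQ
  | ite c p q ihp ihq => exact ⟨fun hc => ihp (h.1 hc) hQ, fun hc => ihq (h.2 hc) hQ⟩
  | skip | setNat | setReal => exact hQ _ h
  | _ => exact h.elim

namespace Runs

variable {B B' : ℕ} {p q : Cmd} {s : State} {Q Q' : State → Prop} {c : Test}

theorem mono (h : Runs B p s Q) (hB : B ≤ B') : Runs B' p s Q :=
  let ⟨s', k, he, hk, hq⟩ := h
  ⟨s', k, he, hk.trans (Nat.mul_le_mul_left _ hB), hq⟩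

theorem imp (h : Runs B p s Q) (hQ : ∀ s', Frame p s s' → Q s' → Q' s') : Runs B p s Q' :=
  let ⟨s', k, he, hk, hq⟩ := h
  ⟨s', k, he, hk, hQ _ he.frame hq⟩

theorem seq (hp : Runs B p s Q') (hq : ∀ s', Frame p s s' → Q' s' → Runs B q s' Q) :
    Runs B (p ;; q) s Q := by
  obtain ⟨s', k, he, hk, h'⟩ := hp
  obtain ⟨s'', k', he', hk', h''⟩ := hq s' he.frame h'
  refine ⟨s'', _, he.seq he', ?_, h''⟩
  rw [Cmd.size, add_mul]
  exact add_le_add hk hk'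

theorem ite (hB : 1 ≤ B) (hp : c.holds s → Runs B p s Q) (hq : ¬ c.holds s → Runs B q s Q) :
    Runs B (.ite c p q) s Q := by
  have hc : c.cost + 1 ≤ (c.cost + 1) * B := Nat.le_mul_of_pos_right _ hB
  by_cases h : c.holds s
  · obtain ⟨s', k, he, hk, h'⟩ := hp h
    refine ⟨s', _, .iteTrue h he, ?_, h'⟩
    simp only [Cmd.size, add_mul] at *
    omega
  · obtain ⟨s', k, he, hk, h'⟩ := hq h
    refine ⟨s', _, .iteFalse h he, ?_, h'⟩
    simp only [Cmd.size, add_mul] at *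
    omega

theorem of_wp (hB : 1 ≤ B) (h : wp p Q s) : Runs B p s Q := by
  induction p generalizing s Q with
  | skip => exact ⟨_, _, .skip s, Nat.le_mul_of_pos_right _ hB, h⟩
  | setNat a i e => exact ⟨_, _, .setNat a i e s, Nat.le_mul_of_pos_right _ hB, h⟩
  | setReal a i e => exact ⟨_, _, .setReal a i e s, Nat.le_mul_of_pos_right _ hB, h⟩
  | seq p q ihp ihq => exact (ihp h).seq fun _ _ => ihq
  | ite c p q ihp ihq => exact .ite hB (fun hc => ihp (h.1 hc)) (fun hc => ihq (h.2 hc))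
  | _ => exact h.elim

theorem setNat_seq {a : ℕ} {i e : NExpr} (hB : 1 ≤ B)
    (h : Runs B q (s.setNat a (i.eval s) (e.eval s)) Q) : Runs B (.setNat a i e ;; q) s Q :=
  (of_wp (p := .setNat a i e) (Q := (· = s.setNat a (i.eval s) (e.eval s))) hB rfl).seq
    fun _ _ hs => hs ▸ h

theorem setReal_seq {a : ℕ} {i : NExpr} {e : RExpr} (hB : 1 ≤ B)
    (h : Runs B q (s.setReal a (i.eval s) (e.eval s)) Q) : Runs B (.setReal a i e ;; q) s Q :=
  (of_wp (p := .setReal a i e) (Q := (· = s.setReal a (i.eval s) (e.eval s))) hB rfl).seq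
    fun _ _ hs => hs ▸ h

end Runs

section While

variable {B N : ℕ} {p : Cmd} {s : State} {c : Test} {Inv : ℕ → State → Prop}

theorem exists_exec_while (hbody : ∀ j s', Inv j s' → c.holds s' →
    j < N ∧ Runs B p s' (Inv (j + 1))) {j M : ℕ} (hjM : j + M = N) (hinv : Inv j s) :
    ∃ s' k, Exec (.while c p) s s' k ∧ k ≤ M * (c.cost + 1 + p.size * B) + (c.cost + 1) ∧
      ∃ j ≤ N, Inv j s' ∧ ¬ c.holds s' := by
  induction M generalizing j s with
  | zero =>
    refine ⟨s, _, .whileFalse fun hc => ?_, by omega, j, by omega, hinv, fun hc => ?_⟩ <;>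
      exact absurd (hbody j s hinv hc).1 (by omega)
  | succ M ih =>
    by_cases hc : c.holds s
    · obtain ⟨-, s₁, k₁, he, hk, hinv'⟩ := hbody j s hinv hc
      obtain ⟨s₂, k₂, he₂, hk₂, h₂⟩ := ih (by omega) hinv'
      refine ⟨s₂, _, .whileTrue hc he he₂, ?_, h₂⟩
      rw [add_mul]
      omega
    · exact ⟨s, _, .whileFalse hc, by omega, j, by omega, hinv, hc⟩

theorem Runs.whileLoop (hB : 1 ≤ B) (N : ℕ) (Inv : ℕ → State → Prop) (h0 : Inv 0 s)
    (hbody : ∀ j s', Frame (.while c p) s s' → Inv j s' → c.holds s' →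
      j < N ∧ Runs B p s' (Inv (j + 1))) :
    Runs ((N + 1) * B) (.while c p) s (fun s' => ∃ j ≤ N, Inv j s' ∧ ¬ c.holds s') := by
  obtain ⟨s', k, he, hk, j, hj, ⟨-, hinv⟩, hc⟩ :=
    exists_exec_while (Inv := fun j s' => Frame (.while c p) s s' ∧ Inv j s') (B := B)
      (fun j s' ⟨hf, hinv⟩ hc => (hbody j s' hf hinv hc).imp_right fun h =>
        h.imp fun s'' hf' hinv' => ⟨hf.trans (hf'.mono (by simp) (by simp)), hinv'⟩)
      (zero_add N) ⟨.refl _ s, h0⟩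
  refine ⟨s', k, he, hk.trans ?_, j, hj, hinv, hc⟩
  have : c.cost + 1 ≤ (c.cost + 1) * B := Nat.le_mul_of_pos_right _ hB
  rw [Cmd.size]
  nlinarith [Nat.zero_le N, Nat.zero_le (p.size * B)]

end While

/-- The integer variable stored in cell `0` of the array `a`. -/
abbrev natVar (a : ℕ) : NExpr := .get a (.const 0)

/-- The real variable stored in cell `0` of the array `a`. -/
abbrev realVar (a : ℕ) : RExpr := .get a (.const 0)

/-- The program `for i < bound do body`, with `i` an integer variable. -/
def forLoop (i : ℕ) (bound : NExpr) (body : Cmd) : Cmd :=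
  .setNat i (.const 0) (.const 0);;
  .while (.natLt (natVar i) bound) (body;; .setNat i (.const 0) (.add (natVar i) (.const 1)))

section ForLoop

variable {N i : ℕ} {bound : NExpr} {body : Cmd} {s : State}

@[simp] theorem writesNat_forLoop (a : ℕ) :
    (forLoop i bound body).writesNat a = (a == i || body.writesNat a) := by
  simp only [forLoop, Cmd.writesNat]
  cases (a == i) <;> simp

@[simp] theorem writesReal_forLoop (a : ℕ) :
    (forLoop i bound body).writesReal a = body.writesReal a := by
  simp [forLoop]

theorem Runs.forLoop (Inv : ℕ → State → Prop) (hi : body.writesNat i = false)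
    (hbound : ∀ s', Frame (forLoop i bound body) s s' → bound.eval s' = N)
    (h0 : Inv 0 (s.setNat i 0 0))
    (hbody : ∀ j s', j < N → Frame (RealRAM.forLoop i bound body) s s' → s'.nat i 0 = j →
      Inv j s' → wp body (fun s'' => Inv (j + 1) (s''.setNat i 0 (j + 1))) s') :
    Runs (N + 1) (RealRAM.forLoop i bound body) s (Inv N) := by
  have hframe s' (hf : Frame (.while (.natLt (natVar i) bound)
      (body;; .setNat i (.const 0) (.add (natVar i) (.const 1)))) (s.setNat i 0 0) s') :
      Frame (RealRAM.forLoop i bound body) s s' :=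
    (Frame.of_setNat (by simp)).trans (hf.mono (by simp +contextual) (by simp))
  have htest j s' (hf : Frame (RealRAM.forLoop i bound body) s s') (hj : s'.nat i 0 = j) :
      Test.holds s' (.natLt (natVar i) bound) ↔ j < N := by
    simp [hj, hbound s' hf]
  refine Runs.setNat_seq (by omega) ?_
  have h := Runs.whileLoop (p := body;; .setNat i (.const 0) (.add (natVar i) (.const 1)))
    (c := .natLt (natVar i) bound) (s := s.setNat i 0 0) le_rfl N
    (fun j s' => j ≤ N ∧ s'.nat i 0 = j ∧ Inv j s') ⟨Nat.zero_le _, by simp, h0⟩ ?_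
  · rw [mul_one] at h
    refine h.imp fun s' hf => ?_
    rintro ⟨j, hjN, ⟨-, hj, hinv⟩, hc⟩
    rw [htest j s' (hframe s' hf) hj, not_lt] at hc
    exact hjN.antisymm hc ▸ hinv
  · rintro j s' hf ⟨-, hj, hinv⟩ hc
    have hjN := (htest j s' (hframe s' hf) hj).1 hc
    refine ⟨hjN, (Runs.of_wp le_rfl (hbody j s' hjN (hframe s' hf) hj hinv)).seq
      fun s'' hf' hinv' => Runs.of_wp le_rfl ?_⟩
    simpa [hf'.nat i hi, hj] using And.intro (Nat.succ_le_of_lt hjN) hinv'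

end ForLoop
end RealRAM

/-! ### Programs for sparse matrices and rooted forests -/

namespace Solver

open RealRAM Matrix

/- The memory layout: every number below names an array, and scalars occupy cell `0` of an array of
their own. The arrays `order`, …, `edgeHead` and `entries`, …, `solution` are prescribed by
`IsInput`, `outIterations`, `outVector` and `outGraph`; all others are working memory. -/
namespace NatArray

@[simp] abbrev order : ℕ := 0
@[simp] abbrev rowPtr : ℕ := 1
@[simp] abbrev colOf : ℕ := 2
@[simp] abbrev output : ℕ := 3
@[simp] abbrev edgeTail : ℕ := 4
@[simp] abbrev edgeHead : ℕ := 5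
@[simp] abbrev entry : ℕ := 6
@[simp] abbrev vertex : ℕ := 7
@[simp] abbrev rowOf : ℕ := 8
@[simp] abbrev position : ℕ := 9
@[simp] abbrev parent : ℕ := 10
@[simp] abbrev vertexAt : ℕ := 11
@[simp] abbrev count : ℕ := 12
@[simp] abbrev finished : ℕ := 13
@[simp] abbrev current : ℕ := 14
@[simp] abbrev currentParent : ℕ := 15
@[simp] abbrev step : ℕ := 16
@[simp] abbrev iteration : ℕ := 17

end NatArray

namespace RealArray

@[simp] abbrev entries : ℕ := 0
@[simp] abbrev rhs : ℕ := 1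
@[simp] abbrev tolerance : ℕ := 2
@[simp] abbrev solution : ℕ := 3
@[simp] abbrev vertexWeight : ℕ := 4
@[simp] abbrev parentWeight : ℕ := 5
@[simp] abbrev bestWeight : ℕ := 6
@[simp] abbrev pivot : ℕ := 7
@[simp] abbrev eliminated : ℕ := 8
@[simp] abbrev ratio : ℕ := 9
@[simp] abbrev ones : ℕ := 10
@[simp] abbrev residual : ℕ := 11
@[simp] abbrev precResidual : ℕ := 12
@[simp] abbrev direction : ℕ := 13
@[simp] abbrev image : ℕ := 14
@[simp] abbrev precImage : ℕ := 15
@[simp] abbrev secondImage : ℕ := 16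
@[simp] abbrev prevDirection : ℕ := 17
@[simp] abbrev prevPrecImage : ℕ := 18
@[simp] abbrev threshold : ℕ := 19
@[simp] abbrev residualSq : ℕ := 20
@[simp] abbrev imageSq : ℕ := 21
@[simp] abbrev prevImageSq : ℕ := 22
@[simp] abbrev residualDot : ℕ := 23
@[simp] abbrev secondDot : ℕ := 24
@[simp] abbrev secondPrevDot : ℕ := 25
@[simp] abbrev newDirection : ℕ := 26

end RealArray

open NatArray RealArray

variable {n dst src a b : ℕ} {e : RExpr} {A : Matrix (Fin n) (Fin n) ℝ} {s s' : State}

/-- The vector stored in the real array `a`. -/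
def vec (n : ℕ) (s : State) (a : ℕ) : Fin n → ℝ := fun i => s.real a i

theorem vec_congr (h : s'.real a = s.real a) : vec n s' a = vec n s a :=
  funext fun i => congrFun h i

@[simp] theorem vec_setNat (a' i v : ℕ) : vec n (s.setNat a' i v) a = vec n s a := rfl

/-- The program that sets every coordinate of the vector `dst` to the value of `e`, which refers to
the coordinate as `vertex`. -/
def setVec (dst : ℕ) (e : RExpr) : Cmd :=
  forLoop vertex (natVar order) (.setReal dst (natVar vertex) e)

@[simp] theorem writesNat_setVec : (setVec dst e).writesNat a = (a == vertex) := by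
  simp [setVec]

@[simp] theorem writesReal_setVec : (setVec dst e).writesReal a = (a == dst) := by
  simp [setVec]

theorem runs_setVec (hn : s.nat order 0 = n) (f : Fin n → ℝ)
    (he : ∀ (i : Fin n) s', Frame (setVec dst e) s s' → s'.nat vertex 0 = i →
      s'.real dst i = s.real dst i → e.eval s' = f i) :
    Runs (n + 1) (setVec dst e) s (fun s' => vec n s' dst = f) := by
  refine (Runs.forLoop (N := n) (fun j s' => ∀ i : Fin n, s'.real dst i =
    if (i : ℕ) < j then f i else s.real dst i) rfl (fun s' hf => ?_) (by simp) ?_).imp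
    fun s' _ h' => funext fun i => by rw [vec, h' i, if_pos i.2]
  · simp [hf.nat order, hn]
  · intro j s' hj hf hs' hinv i
    have hej := he ⟨j, hj⟩ s' hf hs' (by simpa using hinv ⟨j, hj⟩)
    rcases eq_or_ne (i : ℕ) j with rfl | hij
    · simp [hs', hej]
    · simp [hs', hinv, hij, Nat.le_iff_lt_or_eq]

/-- The program that stores the dot product of the vectors `a` and `b` in the real variable
`dst`. -/
def setDotProduct (dst a b : ℕ) : Cmd :=
  .setReal dst (.const 0) (.const 0);;
  forLoop vertex (natVar order) (.setReal dst (.const 0)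
    (.add (realVar dst) (.mul (.get a (natVar vertex)) (.get b (natVar vertex)))))

@[simp] theorem writesReal_setDotProduct (a' : ℕ) :
    (setDotProduct dst a b).writesReal a' = (a' == dst) := by
  simp [setDotProduct]

theorem runs_setDotProduct (hn : s.nat order 0 = n) (ha : a ≠ dst) (hb : b ≠ dst) :
    Runs (n + 1) (setDotProduct dst a b) s
      (fun s' => s'.real dst 0 = vec n s a ⬝ᵥ vec n s b) := by
  refine Runs.setReal_seq (by omega) ((Runs.forLoop (N := n) (fun j s' => s'.real dst 0 =
    ∑ k ∈ Finset.range j, s.real a k * s.real b k) rfl (fun s' hf => ?_) (by simp) ?_).imp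
    fun s' _ h' => by rw [h', Finset.sum_range]; rfl)
  · simp [hf.nat order, hn]
  · intro j s' _ hf hs' hinv
    simp [hs', hinv, hf.real a, hf.real b, ha, hb, Finset.sum_range_succ]

/-- Coordinate storage of a sparse matrix: the `k`-th nonzero is `val k`, in row `row k` and column
`col k`. -/
structure IsCoordinates (A : Matrix (Fin n) (Fin n) ℝ) (nnz : ℕ) (row col : ℕ → ℕ) (val : ℕ → ℝ) :
    Prop where
  entry : ∀ k < nnz, ∃ i j : Fin n, row k = i ∧ col k = j ∧ val k = A i j ∧ A i j ≠ 0
  listed : ∀ i j : Fin n, A i j ≠ 0 → ∃ k < nnz, row k = i ∧ col k = j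
  unique : ∀ k < nnz, ∀ k' < nnz, row k = row k' → col k = col k' → k = k'

theorem IsCoordinates.sum_eq {nnz : ℕ} {row col : ℕ → ℕ} {val : ℕ → ℝ}
    (h : IsCoordinates A nnz row col val) (g : ℕ → ℝ) (i : Fin n) :
    ∑ k ∈ Finset.range nnz, (if row k = i then val k * g (col k) else 0) =
      ∑ j : Fin n, A i j * g j := by
  have split_entry : ∀ k ∈ Finset.range nnz, (if row k = i then val k * g (col k) else 0) =
      ∑ j : Fin n, if row k = i ∧ col k = j then A i j * g j else 0 := by
    intro k hk
    obtain ⟨i', j', hi', hj', hval, -⟩ := h.entry k (Finset.mem_range.1 hk)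
    rcases eq_or_ne i' i with rfl | hne
    · simp [hi', hj', hval, Fin.val_inj]
    · simp [hi', Fin.val_inj, hne]
  rw [Finset.sum_congr rfl split_entry, Finset.sum_comm]
  refine Finset.sum_congr rfl fun j _ => ?_
  rcases eq_or_ne (A i j) 0 with hA | hA
  · simp [hA]
  · obtain ⟨k, hk, hrow, hcol⟩ := h.listed i j hA
    rw [Finset.sum_eq_single_of_mem k (Finset.mem_range.2 hk), if_pos ⟨hrow, hcol⟩]
    intro k' hk' hne
    exact if_neg fun hk'' => hne (h.unique k' (Finset.mem_range.1 hk') k hk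
      (hk''.1.trans hrow.symm) (hk''.2.trans hcol.symm))

theorem IsCoordinates.nnz_le {nnz : ℕ} {row col : ℕ → ℕ} {val : ℕ → ℝ}
    (h : IsCoordinates A nnz row col val) :
    nnz ≤ {p : Fin n × Fin n | A p.1 p.2 ≠ 0}.ncard := by
  choose i j hrow hcol _ hne using fun k : Fin nnz => h.entry k k.2
  have hinj : Function.Injective fun k =>
      (⟨(i k, j k), hne k⟩ : {p : Fin n × Fin n | A p.1 p.2 ≠ 0}) := by
    intro k k' hk
    simp only [Subtype.mk.injEq, Prod.mk.injEq] at hk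
    exact Fin.ext (h.unique k k.2 k' k'.2 (by rw [hrow, hrow, hk.1]) (by rw [hcol, hcol, hk.2]))
  rw [← Nat.card_coe_set_eq]
  exact (Nat.card_fin nnz).symm.trans_le (Nat.card_le_card_of_injective _ hinj)

/-- The memory holds the order and the coordinates of `A`. -/
structure IsLoaded (A : Matrix (Fin n) (Fin n) ℝ) (s : State) : Prop where
  order : s.nat order 0 = n
  coordinates : IsCoordinates A (s.nat rowPtr n) (s.nat rowOf) (s.nat colOf) (s.real entries)

theorem IsLoaded.of_frame {p : Cmd} (h : IsLoaded A s) (hf : Frame p s s')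
    (hnat : ∀ a ∈ [NatArray.order, rowPtr, colOf, rowOf], p.writesNat a = false)
    (hreal : p.writesReal entries = false) : IsLoaded A s' := by
  simp only [List.forall_mem_cons] at hnat
  obtain ⟨hn, hp, hc, hr, -⟩ := hnat
  constructor
  · rw [hf.nat _ hn, h.order]
  · rw [hf.nat _ hp, hf.nat _ hc, hf.nat _ hr, hf.real _ hreal]
    exact h.coordinates

/-- The program that sets the vector `dst` to the product of the matrix in memory and the vector
`src`. -/
def setMulVec (dst src : ℕ) : Cmd :=
  setVec dst (.const 0);;
  forLoop entry (.get rowPtr (natVar order)) (.setReal dst (.get rowOf (natVar entry))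
    (.add (.get dst (.get rowOf (natVar entry)))
      (.mul (.get entries (natVar entry)) (.get src (.get colOf (natVar entry))))))

@[simp] theorem writesNat_setMulVec :
    (setMulVec dst src).writesNat a = (a == vertex || a == entry) := by
  simp [setMulVec]

@[simp] theorem writesReal_setMulVec : (setMulVec dst src).writesReal a = (a == dst) := by
  simp [setMulVec]

theorem runs_setMulVec (hA : IsLoaded A s) (hdst : dst ≠ entries) (hsrc : src ≠ dst) :
    Runs (n + s.nat rowPtr n + 1) (setMulVec dst src) s
      (fun s' => vec n s' dst = A *ᵥ vec n s src) := by
  refine ((runs_setVec hA.order (fun _ => 0) (by simp)).mono (by omega)).seq fun s₁ hf₁ h₁ => ?_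
  have hA₁ : IsLoaded A s₁ := hA.of_frame hf₁ (by simp) (by simp [hdst.symm])
  have hsrc₁ : s₁.real src = s.real src := hf₁.real src (by simp [hsrc])
  rw [← hf₁.nat rowPtr (by simp)]
  refine ((Runs.forLoop (N := s₁.nat rowPtr n) (fun j s' => ∀ i : Fin n, s'.real dst i =
    ∑ k ∈ Finset.range j, if s₁.nat rowOf k = i then
      s₁.real entries k * s₁.real src (s₁.nat colOf k) else 0)
    rfl (fun s' hf => ?_) (fun i => by simpa [vec] using congrFun h₁ i) ?_).imp
    fun s' _ h' => funext fun i => ?_).mono (by omega)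
  · simp [hf.nat order, hf.nat rowPtr, hA₁.order]
  · intro j s' hj hf hs' hinv i
    obtain ⟨i', _, hi', -⟩ := hA₁.coordinates.entry j hj
    rcases eq_or_ne i i' with rfl | hii
    · simp [hs', hinv, hf.nat rowOf, hf.nat colOf, hf.real entries, hf.real src, hdst.symm, hsrc,
        hi', Finset.sum_range_succ]
    · simp [hs', hinv, hf.nat rowOf, hi', Finset.sum_range_succ, Fin.val_inj, hii, hii.symm]
  · rw [vec, h' i, hA₁.coordinates.sum_eq, hsrc₁]
    rfl

namespace IsCompressedRows

variable {ptr col row : ℕ → ℕ} {val : ℕ → ℝ}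

theorem ptr_le (h : IsCompressedRows A ptr col val) {i j : ℕ} (hij : i ≤ j) (hj : j ≤ n) :
    ptr i ≤ ptr j := by
  induction j, hij using Nat.le_induction with
  | base => exact le_rfl
  | succ j _ ih => exact (ih (by omega)).trans (h.mono j (by omega))

theorem row_eq (h : IsCompressedRows A ptr col val)
    (hrow : ∀ k < ptr n, row k < n ∧ k ∈ Set.Ico (ptr (row k)) (ptr (row k + 1))) (i : Fin n)
    {k : ℕ} (hk : k ∈ Set.Ico (ptr i) (ptr (i + 1))) : k < ptr n ∧ row k = i := by
  have hkn : k < ptr n := hk.2.trans_le (h.ptr_le i.2 le_rfl)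
  obtain ⟨hrn, hlo, hhi⟩ := hrow k hkn
  obtain ⟨hlo', hhi'⟩ := hk
  refine ⟨hkn, ?_⟩
  rcases lt_trichotomy (row k) i with hlt | heq | hlt
  · have := h.ptr_le (show row k + 1 ≤ i from hlt) i.2.le
    omega
  · exact heq
  · have := h.ptr_le (show i + 1 ≤ row k from hlt) hrn.le
    omega

theorem isCoordinates (h : IsCompressedRows A ptr col val)
    (hrow : ∀ k < ptr n, row k < n ∧ k ∈ Set.Ico (ptr (row k)) (ptr (row k + 1))) :
    IsCoordinates A (ptr n) row col val := by
  refine ⟨fun k hk => ?_, fun i j hij => ?_, fun k hk k' hk' hr hc => ?_⟩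
  · obtain ⟨hlt, hmem⟩ := hrow k hk
    obtain ⟨j, hj⟩ := h.entry ⟨row k, hlt⟩ k hmem
    exact ⟨⟨row k, hlt⟩, j, rfl, hj⟩
  · obtain ⟨k, ⟨hmem, hcol⟩, -⟩ := h.listed i j hij
    obtain ⟨hk, hki⟩ := h.row_eq hrow i hmem
    exact ⟨k, hk, hki, hcol⟩
  · obtain ⟨hlt, hmem⟩ := hrow k hk
    obtain ⟨j, hj, -, hA⟩ := h.entry ⟨row k, hlt⟩ k hmem
    exact (h.listed ⟨row k, hlt⟩ j hA).unique ⟨hmem, hj⟩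
      ⟨by simpa only [hr] using (hrow k' hk').2, hc ▸ hj⟩

end IsCompressedRows

/-- Progress of a simultaneous scan of the rows and the entries of a matrix in compressed-row
storage: the rows of the first `k` entries are known, and entry `k` is not in a row before `i`. -/
structure IsRowScan (n : ℕ) (ptr : ℕ → ℕ) (i k : ℕ) (row : ℕ → ℕ) : Prop where
  le_order : i ≤ n
  ptr_le : ptr i ≤ k
  le_ptr : k ≤ ptr n
  mem_row : ∀ l < k, row l < n ∧ l ∈ Set.Ico (ptr (row l)) (ptr (row l + 1))

namespace IsRowScan

variable {ptr row : ℕ → ℕ} {i k : ℕ}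

theorem next_entry (h : IsRowScan n ptr i k row) (hi : i < n) (hk : k < ptr (i + 1))
    (hn : ptr (i + 1) ≤ ptr n) : IsRowScan n ptr i (k + 1) (Function.update row k i) := by
  refine ⟨h.le_order, h.ptr_le.trans k.le_succ, hk.trans_le hn, fun l hl => ?_⟩
  rcases Nat.lt_succ_iff_lt_or_eq.1 hl with hlt | rfl
  · rw [Function.update_of_ne hlt.ne]
    exact h.mem_row l hlt
  · simpa using ⟨hi, h.ptr_le, hk⟩

theorem next_row (h : IsRowScan n ptr i k row) (hi : i < n) (hk : ptr (i + 1) ≤ k) :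
    IsRowScan n ptr (i + 1) k row :=
  ⟨hi, hk, h.le_ptr, h.mem_row⟩

end IsRowScan

/-- The program that recovers the row indices from the compressed-row storage. -/
def setRowIndices : Cmd :=
  .setNat entry (.const 0) (.const 0);;
  .setNat vertex (.const 0) (.const 0);;
  .while (.natLt (natVar vertex) (natVar order))
    (.ite (.natLt (natVar entry) (.get rowPtr (.add (natVar vertex) (.const 1))))
      (.setNat rowOf (natVar entry) (natVar vertex);;
        .setNat entry (.const 0) (.add (natVar entry) (.const 1)))
      (.setNat vertex (.const 0) (.add (natVar vertex) (.const 1))))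

theorem runs_setRowIndices (hn : s.nat order 0 = n)
    (hA : IsCompressedRows A (s.nat rowPtr) (s.nat colOf) (s.real entries)) :
    Runs (n + s.nat rowPtr n + 1) setRowIndices s (IsLoaded A) := by
  refine Runs.setNat_seq (by omega) (Runs.setNat_seq (by omega) ?_)
  refine mul_one (n + s.nat rowPtr n + 1) ▸ (Runs.whileLoop le_rfl (n + s.nat rowPtr n)
    (fun t s' => ∃ i k, i + k = t ∧ s'.nat vertex 0 = i ∧ s'.nat entry 0 = k ∧
      IsRowScan n (s.nat rowPtr) i k (s'.nat rowOf))
    ⟨0, 0, rfl, by simp, by simp, by simp, by simp [hA.start], by simp, by simp⟩ ?_).imp ?_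
  · rintro t s' hf ⟨i, k, ht, hi, hk, hscan⟩ hlt
    have hin : i < n := by simpa [hf.nat order, hn, hi] using hlt
    have hptr : s.nat rowPtr (i + 1) ≤ s.nat rowPtr n := hA.ptr_le hin le_rfl
    have hle := hscan.le_ptr
    refine ⟨by omega, Runs.of_wp le_rfl ⟨fun hlt' => ?_, fun hlt' => ?_⟩⟩
    · have hnext := hscan.next_entry hin (by simpa [hf.nat rowPtr, hi, hk] using hlt') hptr
      refine ⟨i, k + 1, by omega, by simp [hi], by simp [hk], ?_⟩
      convert hnext using 1
      ext l
      simp [hi, hk, Function.update_apply]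
    · have hnext := hscan.next_row hin (by simpa [hf.nat rowPtr, hi, hk] using hlt')
      exact ⟨i + 1, k, by omega, by simp [hi], by simp [hk], hnext⟩
  · rintro s' hf ⟨t, -, ⟨i, k, -, hi, -, hscan⟩, hnot⟩
    obtain rfl : i = n := hscan.le_order.antisymm (by simpa [hf.nat order, hn, hi] using hnot)
    obtain rfl : k = s.nat rowPtr i := hscan.le_ptr.antisymm hscan.ptr_le
    refine ⟨by simp [hf.nat order, hn], ?_⟩
    rw [hf.nat rowPtr rfl, hf.nat colOf rfl, hf.real entries rfl]
    exact hA.isCoordinates hscan.mem_row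

end Solver

namespace Solver

open RealRAM Matrix WeightedGraph NatArray RealArray

variable {n : ℕ} {G : WeightedGraph n} {par : Fin n → Fin n} {c : Fin n → ℝ} {pos : Fin n → ℕ}
  {cnt : ℕ} {dst src : ℕ} {s s' : State}

/-- The memory holds a rooted forest as in `ParentOrder`, with the enumeration `vertexAt` of its
vertices that inverts `pos`, and the vertex weights of `G`. -/
structure IsRooted (G : WeightedGraph n) (par : Fin n → Fin n) (c : Fin n → ℝ) (pos : Fin n → ℕ)
    (cnt : ℕ) (s : State) : Prop where
  order : s.nat order 0 = n
  parents : ∀ v : Fin n, s.nat parent v = par v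
  vertices : ∀ v : Fin n, s.nat vertexAt (pos v) = v
  listed : s.nat count 0 = cnt
  parentWeights : ∀ v : Fin n, s.real parentWeight v = c v
  vertexWeights : ∀ v : Fin n, s.real RealArray.vertexWeight v = G.vertexWeight v

theorem IsRooted.of_frame {p : Cmd} (h : IsRooted G par c pos cnt s) (hf : Frame p s s')
    (hnat : ∀ a ∈ [NatArray.order, parent, vertexAt, count], p.writesNat a = false)
    (hreal : ∀ a ∈ [RealArray.vertexWeight, parentWeight], p.writesReal a = false) :
    IsRooted G par c pos cnt s' := by
  simp only [List.forall_mem_cons] at hnat hreal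
  constructor
  · exact hf.nat _ hnat.1 ▸ h.order
  · exact hf.nat _ hnat.2.1 ▸ h.parents
  · exact hf.nat _ hnat.2.2.1 ▸ h.vertices
  · exact hf.nat _ hnat.2.2.2.1 ▸ h.listed
  · exact hf.real _ hreal.2.1 ▸ h.parentWeights
  · exact hf.real _ hreal.1 ▸ h.vertexWeights

/-- One step of the leaf elimination, which takes the vertices in reverse order. -/
def eliminateVertex : Cmd :=
  .setNat current (.const 0)
    (.get vertexAt (.sub (.sub (natVar count) (natVar step)) (.const 1)));;
  .setNat currentParent (.const 0) (.get parent (natVar current));;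
  .setReal ratio (.const 0) (.div (.get parentWeight (natVar current))
    (.add (.get pivot (natVar current)) (.get parentWeight (natVar current))));;
  .setReal pivot (natVar currentParent) (.add (.get pivot (natVar currentParent))
    (.mul (realVar ratio) (.get pivot (natVar current))));;
  .setReal eliminated (natVar currentParent) (.add (.get eliminated (natVar currentParent))
    (.mul (realVar ratio) (.get eliminated (natVar current))))

/-- One step of the back substitution. -/
def substituteVertex (dst : ℕ) : Cmd :=
  .setNat current (.const 0) (.get vertexAt (natVar step));;
  .setReal dst (natVar current)
    (.div (.add (.get eliminated (natVar current))
        (.mul (.get parentWeight (natVar current)) (.get dst (.get parent (natVar current)))))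
      (.add (.get pivot (natVar current)) (.get parentWeight (natVar current))))

/-- The program that solves the linear system given by the Laplacian of the rooted forest in memory,
with right-hand side `src`, by elimination of leaves and back substitution. -/
def solveForest (dst src : ℕ) : Cmd :=
  setVec pivot (.get RealArray.vertexWeight (natVar vertex));;
  setVec eliminated (.get src (natVar vertex));;
  forLoop step (natVar count) eliminateVertex;;
  forLoop step (natVar count) (substituteVertex dst)

theorem wp_eliminateVertex (hs : IsRooted G par c pos cnt s) {v : Fin n} {j : ℕ}
    (hj : s.nat step 0 = j) (hv : cnt - j - 1 = pos v) :
    wp eliminateVertex (fun s' =>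
      vec n s' pivot = passToParent par c (vec n s pivot) v (vec n s pivot) ∧
      vec n s' eliminated = passToParent par c (vec n s pivot) v (vec n s eliminated)) s := by
  have hvert := hs.vertices v
  have hpar := hs.parents v
  have hc := hs.parentWeights v
  have hcnt := hs.listed
  constructor <;> ext u <;>
    simp [vec, passToParent, Function.update_apply, Fin.ext_iff, hj, hcnt, hv, hvert, hpar, hc]

theorem runs_elimination (hs : IsRooted G par c pos cnt s) (hpo : ParentOrder par c pos cnt)
    (hpivot : vec n s pivot = G.vertexWeight) :
    Runs (n + 1) (forLoop step (natVar count) eliminateVertex) s (fun s' =>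
      IsEliminated par c pos 0 (vec n s' pivot) G.vertexWeight (vec n s' pivot) ∧
      IsEliminated par c pos 0 (vec n s' pivot) (vec n s eliminated) (vec n s' eliminated)) := by
  refine ((Runs.forLoop (N := cnt) (fun j s' =>
    IsEliminated par c pos (cnt - j) (vec n s' pivot) G.vertexWeight (vec n s' pivot) ∧
    IsEliminated par c pos (cnt - j) (vec n s' pivot) (vec n s eliminated) (vec n s' eliminated))
    rfl (fun s' hf => ?_) ?_ ?_).imp fun s' _ h' => ?_).mono (Nat.succ_le_succ hpo.cnt_le)
  · simp [hf.nat count, eliminateVertex, hs.listed]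
  · simp only [vec_setNat, hpivot]
    exact ⟨hpo.isEliminated_cnt _ _, hpo.isEliminated_cnt _ _⟩
  · intro j s' hj hf hs' hinv
    obtain ⟨v, hv⟩ := hpo.surj (cnt - j - 1) (by omega)
    have hsucc : cnt - j = pos v + 1 := by omega
    have hpos : cnt - (j + 1) = pos v := by omega
    have hvn : pos v < n := by have := hpo.cnt_le; omega
    refine (wp_eliminateVertex (hs.of_frame hf (by decide) (by decide)) hs' hv.symm).imp
      fun s'' hs'' => ?_
    rw [hsucc] at hinv
    simp only [vec_setNat, hs'', hpos]
    exact ⟨hpo.isEliminated_passToParent hvn hinv.1, hpo.isEliminated_passToParent hvn hinv.2⟩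
  · rwa [Nat.sub_self] at h'

theorem wp_substituteVertex (hs : IsRooted G par c pos cnt s) {v : Fin n}
    (hv : s.nat step 0 = pos v) :
    wp (substituteVertex dst) (fun s' => vec n s' dst = Function.update (vec n s dst) v
      ((vec n s eliminated v + c v * vec n s dst (par v)) / (vec n s pivot v + c v))) s := by
  have hvert := hs.vertices v
  have hpar := hs.parents v
  have hc := hs.parentWeights v
  ext u
  simp [vec, Function.update_apply, Fin.ext_iff, hv, hvert, hpar, hc]

theorem runs_backSubstitution (hs : IsRooted G par c pos cnt s) (hpo : ParentOrder par c pos cnt)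
    (hall : ∀ v, pos v < cnt)
    (hdst : dst ∉ [RealArray.vertexWeight, parentWeight, pivot, eliminated]) :
    Runs (n + 1) (forLoop step (natVar count) (substituteVertex dst)) s (fun s' => ∀ v,
      vec n s' dst v = (vec n s eliminated v + c v * vec n s' dst (par v)) /
        (vec n s pivot v + c v)) := by
  simp only [List.mem_cons, not_or, ← ne_eq, List.not_mem_nil, not_false_eq_true,
    and_true] at hdst
  obtain ⟨hvw, hpw, hp, he⟩ := hdst
  refine ((Runs.forLoop (N := cnt) (fun j s' => ∀ v, pos v < j → vec n s' dst v =
    (vec n s eliminated v + c v * vec n s' dst (par v)) / (vec n s pivot v + c v))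
    rfl (fun s' hf => ?_) (fun v hv => absurd hv (Nat.not_lt_zero _)) ?_).imp
    fun s' _ h' v => h' v (hall v)).mono (Nat.succ_le_succ hpo.cnt_le)
  · simp [hf.nat count, substituteVertex, hs.listed]
  · intro j s' hj hf hs' hinv
    obtain ⟨v, rfl⟩ := hpo.surj j hj
    have hrooted := hs.of_frame hf (by simp [substituteVertex])
      (by simp [substituteVertex, hvw.symm, hpw.symm])
    refine (wp_substituteVertex hrooted hs').imp fun s'' hs'' u hu => ?_
    rw [vec_congr (hf.real pivot (by simp [substituteVertex, hp.symm])),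
      vec_congr (hf.real eliminated (by simp [substituteVertex, he.symm]))] at hs''
    exact hpo.backSubstitution_step ((hall v).trans_le hpo.cnt_le) hinv hs'' (Nat.lt_succ_iff.1 hu)

theorem runs_solveForest (hs : IsRooted G par c pos cnt s) (hpo : ParentOrder par c pos cnt)
    (hall : ∀ v, pos v < cnt) (hw : ∀ v, 0 < c v → c v = G.weight s(par v, v))
    (hle : parentGraph par c ≤ G.graph) (hsrc : src ∉ [pivot, eliminated])
    (hdst : dst ∉ [RealArray.vertexWeight, parentWeight, pivot, eliminated])
    (hq : ∃ z, (G.restrict (parentGraph par c) hle).laplacian *ᵥ z = vec n s src) :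
    Runs (n + 1) (solveForest dst src) s (fun s' =>
      (G.restrict (parentGraph par c) hle).laplacian *ᵥ vec n s' dst = vec n s src) := by
  simp only [List.mem_cons, not_or, List.not_mem_nil, not_false_eq_true, and_true] at hsrc
  refine (runs_setVec hs.order G.vertexWeight fun i s' hf hi _ => ?_).seq fun s₁ hf₁ h₁ => ?_
  · simpa [hi] using (hs.of_frame hf (by simp) (by simp)).vertexWeights i
  have hs₁ := hs.of_frame hf₁ (by simp) (by simp)
  refine (runs_setVec hs₁.order (vec n s src) fun i s' hf hi _ => ?_).seq fun s₂ hf₂ h₂ => ?_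
  · simp [vec, hi, hf.real src, hf₁.real src, hsrc]
  have hs₂ := hs₁.of_frame hf₂ (by simp) (by simp)
  have hpivot : vec n s₂ pivot = G.vertexWeight := by
    rw [vec_congr (hf₂.real pivot (by simp)), h₁]
  refine (runs_elimination hs₂ hpo hpivot).seq fun s₃ hf₃ ⟨hD, hg⟩ => ?_
  rw [h₂] at hg
  exact (runs_backSubstitution (hs₂.of_frame hf₃ (by decide) (by decide)) hpo hall hdst).imp
    fun s₄ _ hw₄ => hpo.restrict_laplacian_mulVec_eq hw hle hD hg hw₄ hq

end Solver

namespace Solver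

open RealRAM Matrix WeightedGraph NatArray RealArray

variable {n : ℕ} {G : WeightedGraph n} {par : Fin n → Fin n} {c : Fin n → ℝ} {pos : Fin n → ℕ}
  {cnt : ℕ} {s s' : State}

/-- The memory holds a rooted forest on the vertices at the positions below `n`, with the
enumeration `vertexAt` of these vertices that inverts `pos`. -/
structure IsPartialForest (par : Fin n → Fin n) (c : Fin n → ℝ) (pos : Fin n → ℕ) (cnt : ℕ)
    (s : State) : Prop where
  parents : ∀ v : Fin n, s.nat parent v = par v
  parentWeights : ∀ v : Fin n, s.real parentWeight v = c v
  positions : ∀ v : Fin n, s.nat position v = pos v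
  vertices : ∀ v : Fin n, pos v < n → s.nat vertexAt (pos v) = v
  listed : s.nat count 0 = cnt

theorem IsPartialForest.of_frame {p : Cmd} (h : IsPartialForest par c pos cnt s)
    (hf : Frame p s s')
    (hnat : ∀ a ∈ [parent, position, vertexAt, count], p.writesNat a = false)
    (hreal : p.writesReal parentWeight = false) : IsPartialForest par c pos cnt s' := by
  simp only [List.forall_mem_cons] at hnat
  constructor
  · exact hf.nat _ hnat.1 ▸ h.parents
  · exact hf.real _ hreal ▸ h.parentWeights
  · exact hf.nat _ hnat.2.1 ▸ h.positions
  · exact hf.nat _ hnat.2.2.1 ▸ h.vertices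
  · exact hf.nat _ hnat.2.2.2.1 ▸ h.listed

theorem IsPartialForest.setNat {a i v : ℕ} (h : IsPartialForest par c pos cnt s)
    (ha : a ∉ [parent, position, vertexAt, count]) :
    IsPartialForest par c pos cnt (s.setNat a i v) :=
  h.of_frame (p := .setNat a (.const i) (.const v)) (.of_setNat (by simp))
    (fun _ ha' => by simpa using fun e : _ = a => ha (e ▸ ha')) rfl

/-- Append the vertex `current` to the enumeration. -/
def enlist : Cmd :=
  .setNat position (natVar current) (natVar count);;
  .setNat vertexAt (natVar count) (natVar current);;
  .setNat count (.const 0) (.add (natVar count) (.const 1))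

theorem wp_enlist (hs : IsPartialForest par c pos cnt s) (hpos : IsListing pos cnt) {j : Fin n}
    (hj : pos j = n) (hcur : s.nat current 0 = j) :
    wp enlist (IsPartialForest par c (Function.update pos j cnt) (cnt + 1)) s := by
  have hcnt := hs.listed
  refine ⟨fun v => ?_, fun v => ?_, fun v => ?_, fun v hv => ?_, ?_⟩
  · simpa using hs.parents v
  · simpa using hs.parentWeights v
  · simp [hcur, hcnt, hs.positions v, Function.update_apply, Fin.ext_iff]
  · rcases eq_or_ne v j with rfl | hvj
    · simp [hcur, hcnt]
    · rw [Function.update_of_ne hvj] at hv ⊢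
      have hlt := (hpos.pos_lt v).resolve_right hv.ne
      simp [hcur, hcnt, hlt.ne, hs.vertices v hv]
  · simp [hcnt]

/-- The program that makes all vertices unlisted. -/
def clearForest : Cmd :=
  .setNat count (.const 0) (.const 0);;
  forLoop vertex (natVar order)
    (.setReal parentWeight (natVar vertex) (.const 0);;
      .setNat position (natVar vertex) (natVar order);;
      .setNat parent (natVar vertex) (natVar vertex))

theorem runs_clearForest (hn : s.nat order 0 = n) :
    Runs (n + 1) clearForest s
      (IsPartialForest (id : Fin n → Fin n) (fun _ => 0) (fun _ => n) 0) := by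
  refine Runs.setNat_seq (by omega) ((Runs.forLoop (N := n) (fun j s' => ∀ v : Fin n, v < j →
    s'.nat parent v = v ∧ s'.real parentWeight v = 0 ∧ s'.nat position v = n) rfl
    (fun s' hf => by simp [hf.nat order, hn]) (by simp) ?_).imp fun s' hf h' => ?_)
  · intro j s' _ hf hs' hinv v hv
    rcases eq_or_ne (v : ℕ) j with hvj | hvj
    · simp [hf.nat order, hn, hs', hvj]
    · simpa [hs', hvj] using hinv v (by omega)
  · exact ⟨fun v => (h' v v.2).1, fun v => (h' v v.2).2.1, fun v => (h' v v.2).2.2,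
      fun _ hv => absurd hv (lt_irrefl _), by simp [hf.nat count]⟩

/-- Among the first `k` nonzeros, `(u, v)` is a heaviest edge from a listed to an unlisted vertex,
and `w` is its weight. If there is no such edge, then `w ≤ 0` and `(u, v)` is arbitrary. -/
structure IsHeaviestCrossing (G : WeightedGraph n) (pos : Fin n → ℕ) (row col : ℕ → ℕ) (k u v : ℕ)
    (w : ℝ) : Prop where
  le : ∀ l < k, ∀ i j : Fin n, row l = i → col l = j → G.graph.Adj i j → pos i < n → pos j = n →
    G.weight s(i, j) ≤ w
  edge : 0 < w → ∃ i j : Fin n, G.graph.Adj i j ∧ pos i < n ∧ pos j = n ∧ u = i ∧ v = j ∧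
    w = G.weight s(i, j)

namespace IsHeaviestCrossing

variable {row col : ℕ → ℕ} {val : ℕ → ℝ} {nnz k u v : ℕ} {w : ℝ} {i j : Fin n}

theorem le_of_adj (h : IsHeaviestCrossing G pos row col nnz u v w)
    (hA : IsCoordinates G.laplacian nnz row col val) (hij : G.graph.Adj i j) (hi : pos i < n)
    (hj : pos j = n) : G.weight s(i, j) ≤ w := by
  obtain ⟨l, hl, hrow, hcol⟩ := hA.listed i j (laplacian_apply_ne_zero_of_adj hij)
  exact h.le l hl i j hrow hcol hij hi hj

theorem replace (h : IsHeaviestCrossing G pos row col k u v w) (hrow : row k = i) (hcol : col k = j)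
    (hij : G.graph.Adj i j) (hi : pos i < n) (hj : pos j = n) (hw : w < G.weight s(i, j)) :
    IsHeaviestCrossing G pos row col (k + 1) i j (G.weight s(i, j)) := by
  refine ⟨Nat.forall_lt_succ_right.2 ⟨fun l hl a b ha hb hab ha' hb' =>
    (h.le l hl a b ha hb hab ha' hb').trans hw.le, fun a b ha hb _ _ _ => ?_⟩,
    fun _ => ⟨i, j, hij, hi, hj, rfl, rfl, rfl⟩⟩
  rw [Fin.ext (ha.symm.trans hrow), Fin.ext (hb.symm.trans hcol)]

theorem keep (h : IsHeaviestCrossing G pos row col k u v w) (hrow : row k = i) (hcol : col k = j)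
    (hw : G.graph.Adj i j → pos i < n → pos j = n → G.weight s(i, j) ≤ w) :
    IsHeaviestCrossing G pos row col (k + 1) u v w := by
  refine ⟨Nat.forall_lt_succ_right.2 ⟨h.le, fun a b ha hb => ?_⟩, h.edge⟩
  rwa [Fin.ext (ha.symm.trans hrow), Fin.ext (hb.symm.trans hcol)]

end IsHeaviestCrossing

/-- The program that searches for a heaviest edge from a listed to an unlisted vertex. -/
def findEdge : Cmd :=
  .setReal bestWeight (.const 0) (.const 0);;
  forLoop entry (.get rowPtr (natVar order))
    (.ite (.and (.natLt (.get position (.get rowOf (natVar entry))) (natVar order))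
        (.and (.natEq (.get position (.get colOf (natVar entry))) (natVar order))
          (.realLt (realVar bestWeight) (.sub (.const 0) (.get entries (natVar entry))))))
      (.setReal bestWeight (.const 0) (.sub (.const 0) (.get entries (natVar entry)));;
        .setNat current (.const 0) (.get colOf (natVar entry));;
        .setNat currentParent (.const 0) (.get rowOf (natVar entry)))
      .skip)

theorem runs_findEdge (hA : IsLoaded G.laplacian s) (hs : IsPartialForest par c pos cnt s) :
    Runs (n + s.nat rowPtr n + 1) findEdge s (fun s' =>
      IsHeaviestCrossing G pos (s.nat rowOf) (s.nat colOf) (s.nat rowPtr n)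
        (s'.nat currentParent 0) (s'.nat current 0) (s'.real bestWeight 0)) := by
  refine Runs.setReal_seq (by omega) ((Runs.forLoop (N := s.nat rowPtr n) (fun k s' =>
    IsHeaviestCrossing G pos (s.nat rowOf) (s.nat colOf) k (s'.nat currentParent 0)
      (s'.nat current 0) (s'.real bestWeight 0)) rfl
    (fun s' hf => by simp [hf.nat order, hf.nat rowPtr, hA.order])
    ⟨by simp, by simp⟩ ?_).mono (by omega))
  intro k s' hk hf hs' hbest
  obtain ⟨i, j, hi, hj, hval, hne⟩ := hA.coordinates.entry k hk
  have hposi : s'.nat position i = pos i := by simpa [hf.nat position] using hs.positions i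
  have hposj : s'.nat position j = pos j := by simpa [hf.nat position] using hs.positions j
  refine ⟨fun hc => ?_, fun hc => hbest.keep hi hj fun hij hi' hj' => ?_⟩
  · obtain ⟨hi', hj', hw⟩ : pos i < n ∧ pos j = n ∧ s'.real bestWeight 0 < -G.laplacian i j := by
      simpa [hs', hf.nat rowOf, hf.nat colOf, hf.nat order, hf.real entries, hA.order, hi, hj, hval,
        hposi, hposj] using hc
    have hij : G.graph.Adj i j := adj_of_laplacian_apply_ne_zero (by rintro rfl; omega) hne
    rw [laplacian_apply_of_adj hij] at hval hw
    simpa [hs', hf.nat rowOf, hf.nat colOf, hf.real entries, hi, hj, hval] using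
      hbest.replace hi hj hij hi' hj' (by simpa using hw)
  · by_contra! hw
    rw [laplacian_apply_of_adj hij] at hval
    refine hc ?_
    simpa [hs', hf.nat rowOf, hf.nat colOf, hf.nat order, hf.real entries, hA.order, hi, hj, hval,
      hposi, hposj] using ⟨hi', hj', hw⟩

/-- The program that appends the vertex `current` as a child of `currentParent`. -/
def attach : Cmd :=
  .setNat parent (natVar current) (natVar currentParent);;
  .setReal parentWeight (natVar current) (realVar bestWeight);;
  enlist

theorem wp_attach (hs : IsPartialForest par c pos cnt s) (hpos : IsListing pos cnt) {i j : Fin n}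
    (hj : pos j = n) (hcur : s.nat current 0 = j) (hpar : s.nat currentParent 0 = i) :
    wp attach (IsPartialForest (Function.update par j i)
      (Function.update c j (s.real bestWeight 0)) (Function.update pos j cnt) (cnt + 1)) s := by
  refine wp_enlist ⟨fun v => ?_, fun v => ?_, fun v => ?_, fun v hv => ?_, ?_⟩ hpos hj
    (by simp [hcur])
  · simp [hcur, hpar, hs.parents v, Function.update_apply, Fin.ext_iff, apply_ite Fin.val]
  · simp [hcur, hs.parentWeights v, Function.update_apply, Fin.ext_iff]
  · simpa using hs.positions v
  · simpa using hs.vertices v hv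
  · simpa using hs.listed

/-- The program that searches for an unlisted vertex that has a neighbor; it sets the flag
`finished` if there is none. -/
def findRoot : Cmd :=
  .setNat finished (.const 0) (.const 1);;
  forLoop entry (.get rowPtr (natVar order))
    (.ite (.and (.not (.natEq (.get rowOf (natVar entry)) (.get colOf (natVar entry))))
        (.natEq (.get position (.get rowOf (natVar entry))) (natVar order)))
      (.setNat finished (.const 0) (.const 0);;
        .setNat current (.const 0) (.get rowOf (natVar entry)))
      .skip)

theorem runs_findRoot (hA : IsLoaded G.laplacian s) (hs : IsPartialForest par c pos cnt s) :
    Runs (n + s.nat rowPtr n + 1) findRoot s (fun s' =>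
      (s'.nat finished 0 = 0 ∧ ∃ i ∈ G.graph.support, pos i = n ∧ s'.nat current 0 = i) ∨
      (s'.nat finished 0 ≠ 0 ∧ ∀ i ∈ G.graph.support, pos i ≠ n)) := by
  refine Runs.setNat_seq (by omega) (((Runs.forLoop (N := s.nat rowPtr n) (fun k s' =>
    (s'.nat finished 0 = 0 ∧ ∃ i ∈ G.graph.support, pos i = n ∧ s'.nat current 0 = i) ∨
    (s'.nat finished 0 ≠ 0 ∧ ∀ l < k, ∀ i j : Fin n, s.nat rowOf l = i → s.nat colOf l = j →
      i ≠ j → pos i ≠ n)) rfl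
    (fun s' hf => by simp [hf.nat order, hf.nat rowPtr, hA.order]) (by simp) ?_).imp
    fun s' _ h' => h'.imp_right fun h' => ⟨h'.1, fun i hi => ?_⟩).mono (by omega))
  · intro k s' hk hf hs' hinv
    obtain ⟨i, j, hi, hj, -, hne⟩ := hA.coordinates.entry k hk
    have hposi : s'.nat position i = pos i := by simpa [hf.nat position] using hs.positions i
    refine ⟨fun hc => Or.inl ?_, fun hc => hinv.imp (by simp) fun h => ⟨by simpa using h.1,
      Nat.forall_lt_succ_right.2 ⟨h.2, fun a b ha hb hab hpos => hc ?_⟩⟩⟩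
    · obtain ⟨hij, hi'⟩ : i ≠ j ∧ pos i = n := by
        simpa [hs', hf.nat rowOf, hf.nat colOf, hf.nat order, hA.order, hi, hj, hposi,
          Fin.val_inj] using hc
      have hadj := adj_of_laplacian_apply_ne_zero hij hne
      simpa [hs', hf.nat rowOf, hi, Fin.val_inj] using ⟨⟨j, hadj⟩, hi'⟩
    · obtain rfl : a = i := Fin.ext (ha.symm.trans hi)
      obtain rfl : b = j := Fin.ext (hb.symm.trans hj)
      simpa [hs', hf.nat rowOf, hf.nat colOf, hf.nat order, hA.order, hi, hj, hposi,
        Fin.val_inj] using ⟨hab, hpos⟩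
  · obtain ⟨j, hij⟩ := hi
    obtain ⟨l, hl, hrow, hcol⟩ := hA.coordinates.listed i j (laplacian_apply_ne_zero_of_adj hij)
    exact h'.2 l hl i j hrow hcol hij.ne

/-- One round of Prim's algorithm: attach a vertex by a heaviest edge, or else start a new tree. -/
def growRound : Cmd :=
  findEdge;;
  .ite (.realLt (.const 0) (realVar bestWeight)) attach
    (findRoot;; .ite (.natEq (natVar finished) (.const 0)) enlist .skip)

theorem runs_growRound (hA : IsLoaded G.laplacian s) (hs : IsPartialForest par c pos cnt s)
    (hp : G.IsPrimState par c pos cnt) (hfin : s.nat finished 0 = 0) :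
    Runs (n + s.nat rowPtr n + 1) growRound s (fun s' =>
      (s'.nat finished 0 = 0 ∧ ∃ par' c' pos', IsPartialForest par' c' pos' (cnt + 1) s' ∧
        G.IsPrimState par' c' pos' (cnt + 1)) ∨
      (s'.nat finished 0 ≠ 0 ∧ IsPartialForest par c pos cnt s' ∧
        ∀ v ∈ G.graph.support, pos v < n)) := by
  refine (runs_findEdge hA hs).seq fun s₁ hf₁ hbest => ?_
  have hA₁ := hA.of_frame hf₁ (by decide) (by decide)
  have hs₁ := hs.of_frame hf₁ (by decide) (by decide)
  refine Runs.ite (by omega) (fun hc => ?_) (fun hc => ?_)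
  · obtain ⟨i, j, hij, hi, hj, hpar, hcur, hw⟩ := hbest.edge (by simpa using hc)
    have hvisit := hp.visit hi hj hij fun a b hab ha hb =>
      hw ▸ hbest.le_of_adj hA.coordinates hab ha hb
    refine (Runs.of_wp (by omega) (wp_attach hs₁ hp.toIsListing hj hcur hpar)).imp
      fun s' hf' h' => Or.inl ⟨?_, _, _, _, h', hw ▸ hvisit⟩
    rw [hf'.nat finished rfl, hf₁.nat finished rfl, hfin]
  · have hno : ∀ a b, G.graph.Adj a b → pos a < n → pos b ≠ n := fun a b hab ha hb => hc <| by
      simpa using (G.weight_pos s(a, b) hab).trans_le (hbest.le_of_adj hA.coordinates hab ha hb)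
    rw [← hf₁.nat rowPtr rfl]
    refine (runs_findRoot hA₁ hs₁).seq fun s₂ hf₂ h₂ => ?_
    have hs₂ := hs₁.of_frame hf₂ (by decide) (by decide)
    rcases h₂ with ⟨hfin₂, i, hi, hposi, hcur⟩ | ⟨hfin₂, hnone⟩
    · refine Runs.ite (by omega) (fun _ => ?_) fun h => absurd hfin₂ h
      refine (Runs.of_wp (by omega) (wp_enlist hs₂ hp.toIsListing hposi hcur)).imp
        fun s' hf' h' => Or.inl ⟨?_, _, _, _, h', hp.visit_root hposi hi hno⟩
      rw [hf'.nat finished rfl, hfin₂]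
    · refine Runs.of_wp (by omega) ⟨fun h => absurd h hfin₂,
        fun _ => Or.inr ⟨hfin₂, hs₂, fun v hv => ?_⟩⟩
      exact ((hp.pos_lt v).resolve_right (hnone v hv)).trans_le hp.cnt_le

/-- The program that grows a maximum spanning forest on the vertices that have neighbors. -/
def growForest : Cmd :=
  clearForest;;
  .setNat finished (.const 0) (.const 0);;
  .while (.natEq (natVar finished) (.const 0)) growRound

theorem runs_growForest (hn : 0 < n) (hA : IsLoaded G.laplacian s) :
    Runs ((min n (2 * G.numEdges) + 2) * (n + s.nat rowPtr n + 1)) growForest s (fun s' =>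
      ∃ par c pos cnt, IsPartialForest par c pos cnt s' ∧ G.IsPrimState par c pos cnt ∧
        ∀ v ∈ G.graph.support, pos v < n) := by
  have hB : n + s.nat rowPtr n + 1 ≤ (min n (2 * G.numEdges) + 2) * (n + s.nat rowPtr n + 1) :=
    Nat.le_mul_of_pos_left _ (by omega)
  refine ((runs_clearForest hA.order).mono (by omega)).seq fun s₁ hf₁ hs₁ =>
    Runs.setNat_seq (by omega) ?_
  have hA₁ := hA.of_frame hf₁ (by decide) (by decide)
  refine (Runs.whileLoop (by omega) (min n (2 * G.numEdges) + 1) (fun j s' =>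
    ∃ par c pos cnt, IsPartialForest par c pos cnt s' ∧ G.IsPrimState par c pos cnt ∧
      ((s'.nat finished 0 = 0 ∧ cnt = j) ∨
        (s'.nat finished 0 ≠ 0 ∧ ∀ v ∈ G.graph.support, pos v < n)))
    ⟨_, _, _, _, hs₁.setNat (by decide), .empty hn id, Or.inl ⟨by simp, rfl⟩⟩ ?_).imp ?_
  · rintro j s' hf ⟨par, c, pos, cnt, hs', hp, hcase⟩ hc
    have hfin : s'.nat finished 0 = 0 := by simpa using hc
    obtain ⟨-, rfl⟩ := hcase.resolve_right fun h => h.1 hfin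
    have hA' : IsLoaded G.laplacian s' := hA₁.of_frame
      ((Frame.of_setNat (by decide)).trans hf) (by decide) (by decide)
    refine ⟨Nat.lt_succ_of_le (le_min hp.cnt_le hp.cnt_le_numEdges), ?_⟩
    rw [← hf₁.nat rowPtr rfl, show s₁.nat rowPtr = s'.nat rowPtr from (hf.nat rowPtr rfl).symm]
    refine (runs_growRound hA' hs' hp hfin).imp fun s'' _ => ?_
    rintro (⟨hfin', par', c', pos', hs'', hp'⟩ | ⟨hfin', hs'', hall⟩)
    · exact ⟨_, _, _, _, hs'', hp', Or.inl ⟨hfin', rfl⟩⟩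
    · exact ⟨_, _, _, _, hs'', hp, Or.inr ⟨hfin', hall⟩⟩
  · rintro s' - ⟨j, -, ⟨par, c, pos, cnt, hs', hp, hcase⟩, hc⟩
    exact ⟨par, c, pos, cnt, hs', hp, (hcase.resolve_left fun h => hc (by simpa using h.1)).2⟩

/-- The program that appends the vertices that are not listed yet. -/
def listIsolated : Cmd :=
  forLoop vertex (natVar order) (.ite (.natEq (.get position (natVar vertex)) (natVar order))
    (.setNat current (.const 0) (natVar vertex);; enlist) .skip)

theorem runs_listIsolated (hn : s.nat order 0 = n) (hs : IsPartialForest par c pos cnt s)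
    (hpo : ParentOrder par c pos cnt) :
    Runs (n + 1) listIsolated s (fun s' => ∃ pos' cnt', IsPartialForest par c pos' cnt' s' ∧
      ParentOrder par c pos' cnt' ∧ ∀ v, pos' v < cnt') := by
  refine (Runs.forLoop (N := n) (fun j s' => ∃ pos' cnt', IsPartialForest par c pos' cnt' s' ∧
    ParentOrder par c pos' cnt' ∧ ∀ v : Fin n, v < j → pos' v < cnt') rfl
    (fun s' hf => by simp [hf.nat order rfl, hn])
    ⟨pos, cnt, hs.setNat (by decide), hpo, by simp⟩ ?_).imp
    fun s' _ ⟨pos', cnt', hs', hpo', h'⟩ => ⟨pos', cnt', hs', hpo', fun v => h' v v.2⟩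
  rintro j s' hj hf hs' ⟨pos', cnt', hg, hp, hall⟩
  have htest : Test.holds s' (.natEq (.get position (natVar vertex)) (natVar order)) ↔
      pos' ⟨j, hj⟩ = n := by
    simpa [hs', hf.nat order rfl, hn] using congrArg (· = n) (hg.positions ⟨j, hj⟩)
  refine ⟨fun hc => ?_, fun hc => ⟨pos', cnt', hg.setNat (by decide), hp, fun v hv => ?_⟩⟩
  · simp only [wp]
    refine (wp_enlist (hg.setNat (by decide)) hp.toIsListing (htest.1 hc) (by simp [hs'])).imp
      fun s'' hs'' => ⟨_, _, hs''.setNat (by decide), hp.append_root (htest.1 hc), fun v hv => ?_⟩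
    rcases eq_or_ne v ⟨j, hj⟩ with rfl | hvj
    · simp
    · rw [Function.update_of_ne hvj]
      exact (hall v (by grind)).trans cnt'.lt_succ_self
  · rcases Nat.lt_succ_iff_lt_or_eq.1 hv with hv | rfl
    · exact hall v hv
    · exact (hp.pos_lt v).resolve_right fun h => hc (htest.2 h)

/-- The program that outputs the edges between vertices and their parents. -/
def listEdges : Cmd :=
  .setNat output (.const 1) (.const 0);;
  forLoop vertex (natVar order) (.ite (.realLt (.const 0) (.get parentWeight (natVar vertex)))
    (.setNat edgeTail (.get output (.const 1)) (.get parent (natVar vertex));;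
      .setNat edgeHead (.get output (.const 1)) (natVar vertex);;
      .setNat output (.const 1) (.add (.get output (.const 1)) (.const 1)))
    .skip)

theorem runs_listEdges (hn : s.nat order 0 = n) (hs : IsPartialForest par c pos cnt s) :
    Runs (n + 1) listEdges s (fun s' => outGraph n s' = parentGraph par c) := by
  refine Runs.setNat_seq (by omega) ((Runs.forLoop (N := n) (fun j s' => ∃ k, s'.nat output 1 = k ∧
    ∀ a b : Fin n, (∃ l < k, s'.nat edgeTail l = a ∧ s'.nat edgeHead l = b) ↔
      b < j ∧ 0 < c b ∧ par b = a) rfl (fun s' hf => by simp [hf.nat order, hn])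
    ⟨0, by simp⟩ ?_).imp ?_)
  · rintro j s' hj hf hs' ⟨k, hk, hinv⟩
    have hparent : s'.nat parent j = par ⟨j, hj⟩ := by
      simpa [hf.nat parent] using hs.parents ⟨j, hj⟩
    have hweight : s'.real parentWeight j = c ⟨j, hj⟩ := by
      simpa [hf.real parentWeight] using hs.parentWeights ⟨j, hj⟩
    refine ⟨fun hc => ⟨k + 1, by simp [hk], fun a b => ?_⟩, fun hc => ⟨k, by simp [hk],
      fun a b => ?_⟩⟩
    · have hc' : 0 < c ⟨j, hj⟩ := by simpa [hs', hweight] using hc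
      suffices (∃ l < k + 1, (if l = k then (par ⟨j, hj⟩ : ℕ) else s'.nat edgeTail l) = a ∧
          (if l = k then j else s'.nat edgeHead l) = b) ↔ b < j + 1 ∧ 0 < c b ∧ par b = a by
        simpa [hs', hk, hparent] using this
      constructor
      · rintro ⟨l, hl, htail, hhead⟩
        rcases eq_or_ne l k with rfl | hlk
        · grind
        · have := (hinv a b).1 ⟨l, by omega, by simpa [hlk] using htail, by simpa [hlk] using hhead⟩
          exact ⟨by omega, this.2⟩
      · rintro ⟨hb, hcb, rfl⟩
        rcases Nat.lt_succ_iff_lt_or_eq.1 hb with hb | rfl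
        · obtain ⟨l, hl, htail, hhead⟩ := (hinv (par b) b).2 ⟨hb, hcb, rfl⟩
          exact ⟨l, by omega, by simpa [hl.ne] using htail, by simpa [hl.ne] using hhead⟩
        · exact ⟨k, by simp⟩
    · have hc' : ¬ 0 < c ⟨j, hj⟩ := by simpa [hs', hweight] using hc
      suffices b < j ∧ 0 < c b ∧ par b = a ↔ b < j + 1 ∧ 0 < c b ∧ par b = a by simpa [hinv]
      grind
  · rintro s' - ⟨k, hk, hinv⟩
    rw [outGraph, hk, parentGraph]
    congr! with a b
    simp [hinv a b]

/-- The memory holds the Laplacian of `G` and a rooted maximum spanning forest of `G`. -/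
structure IsPrepared (G : WeightedGraph n) (par : Fin n → Fin n) (c : Fin n → ℝ) (pos : Fin n → ℕ)
    (cnt : ℕ) (s : State) : Prop where
  loaded : IsLoaded G.laplacian s
  rooted : IsRooted G par c pos cnt s
  ordered : ParentOrder par c pos cnt
  listed : ∀ v, pos v < cnt
  weight_eq : ∀ v, 0 < c v → c v = G.weight s(par v, v)
  forest : G.IsMaxSpanningForest (parentGraph par c)

theorem IsPrepared.of_frame {p : Cmd} (h : IsPrepared G par c pos cnt s) (hf : Frame p s s')
    (hnat : ∀ a ∈ [order, rowPtr, colOf, rowOf, parent, vertexAt, count], p.writesNat a = false)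
    (hreal : ∀ a ∈ [entries, RealArray.vertexWeight, parentWeight], p.writesReal a = false) :
    IsPrepared G par c pos cnt s' :=
  { h with
    loaded := h.loaded.of_frame hf (fun a ha => hnat a (by simp at ha ⊢; tauto))
      (hreal _ (by simp))
    rooted := h.rooted.of_frame hf (fun a ha => hnat a (by simp at ha ⊢; tauto))
      (fun a ha => hreal a (List.mem_cons_of_mem _ ha)) }

/-- The program that computes the vertex weights and a rooted maximum spanning forest. -/
def spanningForest : Cmd :=
  setRowIndices;;
  setVec ones (.const 1);;
  setMulVec RealArray.vertexWeight ones;;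
  growForest;;
  listIsolated;;
  listEdges

theorem runs_spanningForest {b : Fin n → ℝ} {ε : ℝ} (hn : 0 < n)
    (hs : IsInput G.laplacian b ε s) :
    Runs ((min n (2 * G.numEdges) + 2) * (n + s.nat rowPtr n + 1)) spanningForest s (fun s' =>
      ∃ par c pos cnt, IsPrepared G par c pos cnt s' ∧ outGraph n s' = parentGraph par c) := by
  have hB : n + s.nat rowPtr n + 1 ≤ (min n (2 * G.numEdges) + 2) * (n + s.nat rowPtr n + 1) :=
    Nat.le_mul_of_pos_left _ (by omega)
  refine ((runs_setRowIndices hs.order hs.matrix).mono hB).seq fun s₁ hf₁ hA₁ => ?_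
  refine ((runs_setVec hA₁.order (fun _ => 1) (by simp)).mono (by omega)).seq fun s₂ hf₂ h₂ => ?_
  have hA₂ := hA₁.of_frame hf₂ (by simp) (by simp)
  have hnnz₂ : s₂.nat rowPtr n = s.nat rowPtr n := by
    rw [hf₂.nat rowPtr (by simp), hf₁.nat rowPtr rfl]
  refine ((runs_setMulVec hA₂ (by decide) (by decide)).mono (hnnz₂ ▸ hB)).seq fun s₃ hf₃ h₃ => ?_
  have hA₃ := hA₂.of_frame hf₃ (by simp) (by simp)
  have hnnz₃ : s₃.nat rowPtr n = s.nat rowPtr n := by rw [hf₃.nat rowPtr (by simp), hnnz₂]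
  refine (hnnz₃ ▸ runs_growForest hn hA₃).seq fun s₄ hf₄ ⟨par, c, pos, cnt, hg₄, hp, hall⟩ => ?_
  have hA₄ := hA₃.of_frame hf₄ (by decide) (by decide)
  refine ((runs_listIsolated hA₄.order hg₄ hp.toParentOrder).mono (by omega)).seq
    fun s₅ hf₅ ⟨pos', cnt', hg₅, hpo, hall'⟩ => ?_
  have hA₅ := hA₄.of_frame hf₅ (by decide) (by decide)
  refine ((runs_listEdges hA₅.order hg₅).mono (by omega)).imp fun s₆ hf₆ h₆ => ?_
  have hA₆ := hA₅.of_frame hf₆ (by decide) (by decide)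
  have hg₆ := hg₅.of_frame hf₆ (by decide) (by decide)
  refine ⟨par, c, pos', cnt', ⟨hA₆, ⟨hA₆.order, hg₆.parents,
    fun v => hg₆.vertices v ((hall' v).trans_le hpo.cnt_le), hg₆.listed, hg₆.parentWeights,
    fun v => ?_⟩, hpo, hall', fun v hv => (hp.weight v hv).2, hp.isMaxSpanningForest hall⟩, h₆⟩
  rw [hf₆.real _ rfl, hf₅.real _ rfl, hf₄.real _ rfl]
  rw [h₂, laplacian_mulVec_one] at h₃
  exact congrFun h₃ v

end Solver

/-! ### The preconditioned iteration -/

namespace Minres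

open Matrix WithLp ConjugateResidual

variable {n k : ℕ} {A B L P : Matrix (Fin n) (Fin n) ℝ} {b x r z u u' w w' y : Fin n → ℝ}

/-- The vectors from which the conjugate residual method for the preconditioned system is continued
after `k` steps, pulled back to the original coordinates: the iterate `x`, its residual `r`, the
preconditioned residual `z`, the current and the previous search direction `u` and `u'`, and the
image `w'` of `A u'` under the inverse of the preconditioner `B`. -/
structure IsState (A B : Matrix (Fin n) (Fin n) ℝ) (b : Fin n → ℝ) (k : ℕ)
    (x r z u u' w' : Fin n → ℝ) : Prop where
  residual : r = b - A *ᵥ x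
  preconditioned : B *ᵥ z = r
  previous : B *ᵥ w' = A *ᵥ u'
  image : ∀ L P : Matrix (Fin n) (Fin n) ℝ, L * Lᵀ = B → IsPseudoInverse L P →
    toLp 2 (Lᵀ *ᵥ x) = iter (P * A * Pᵀ).toEuclideanLin (toLp 2 (P *ᵥ b)) k ∧
    toLp 2 (Lᵀ *ᵥ u) = dir (P * A * Pᵀ).toEuclideanLin (toLp 2 (P *ᵥ b)) k ∧
    toLp 2 (Lᵀ *ᵥ u') = prevDir (P * A * Pᵀ).toEuclideanLin (toLp 2 (P *ᵥ b)) k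

theorem projCoeff_toLp_transpose_mulVec {v p q : Fin n → ℝ} (hp : (L * Lᵀ) *ᵥ v = p)
    (hq : (L * Lᵀ) *ᵥ w = q) :
    projCoeff (toLp 2 (Lᵀ *ᵥ v)) (toLp 2 (Lᵀ *ᵥ w)) = p ⬝ᵥ w / q ⬝ᵥ w := by
  rw [projCoeff, real_inner_comm, EuclideanSpace.inner_toLp_toLp, EuclideanSpace.inner_toLp_toLp,
    star_trivial, dotProduct_transpose_mulVec hp, dotProduct_transpose_mulVec hq]

namespace IsState

theorem initial (hz : B *ᵥ z = b) : IsState A B b 0 0 b z z 0 0 where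
  residual := by simp
  preconditioned := hz
  previous := by simp
  image L P hL hP := by simp [hP.mulVec_eq (hL ▸ hz)]

variable (h : IsState A (L * Lᵀ) b k x r z u u' w') (hP : IsPseudoInverse L P)
  (hker : ∀ v, (L * Lᵀ) *ᵥ v = 0 → A *ᵥ v = 0)
include h hP hker

theorem residual_eq :
    ConjugateResidual.residual (P * A * Pᵀ).toEuclideanLin (toLp 2 (P *ᵥ b)) k =
      toLp 2 (Lᵀ *ᵥ z) := by
  rw [ConjugateResidual.residual, ← (h.image L P rfl hP).1, toLpLin_toLp, toLin'_apply,
    hP.preconditioned_mulVec hker, ← toLp_sub, ← mulVec_sub, ← h.residual,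
    hP.mulVec_eq h.preconditioned]

theorem norm_residual_sq :
    ‖ConjugateResidual.residual (P * A * Pᵀ).toEuclideanLin (toLp 2 (P *ᵥ b)) k‖ ^ 2 = r ⬝ᵥ z := by
  rw [h.residual_eq hP hker, ← real_inner_self_eq_norm_sq, EuclideanSpace.inner_toLp_toLp,
    star_trivial, dotProduct_transpose_mulVec h.preconditioned]

end IsState

theorem IsState.step (h : IsState A B b k x r z u u' w') (hker : ∀ v, B *ᵥ v = 0 → A *ᵥ v = 0)
    (hw : B *ᵥ w = A *ᵥ u) (hy : B *ᵥ y = A *ᵥ w) :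
    IsState A B b (k + 1) (x + (r ⬝ᵥ w / (A *ᵥ u) ⬝ᵥ w) • u)
      (r - (r ⬝ᵥ w / (A *ᵥ u) ⬝ᵥ w) • (A *ᵥ u)) (z - (r ⬝ᵥ w / (A *ᵥ u) ⬝ᵥ w) • w)
      (w - ((A *ᵥ w) ⬝ᵥ w / (A *ᵥ u) ⬝ᵥ w) • u - ((A *ᵥ w) ⬝ᵥ w' / (A *ᵥ u') ⬝ᵥ w') • u') u w where
  residual := by rw [h.residual, mulVec_add, mulVec_smul, sub_add_eq_sub_sub]
  preconditioned := by rw [mulVec_sub, mulVec_smul, h.preconditioned, hw]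
  previous := hw
  image L P hL hP := by
    subst hL
    obtain ⟨hx, hu, hu'⟩ := h.image L P rfl hP
    have himage {p q : Fin n → ℝ} (hq : (L * Lᵀ) *ᵥ q = A *ᵥ p) :
        (P * A * Pᵀ).toEuclideanLin (toLp 2 (Lᵀ *ᵥ p)) = toLp 2 (Lᵀ *ᵥ q) := by
      rw [toLpLin_toLp, toLin'_apply, hP.preconditioned_mulVec hker, hP.mulVec_eq hq]
    refine ⟨?_, ?_, hu⟩
    · rw [iter_succ, h.residual_eq hP hker, ← hx, ← hu, himage hw,
        projCoeff_toLp_transpose_mulVec h.preconditioned hw, mulVec_add, mulVec_smul, toLp_add,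
        toLp_smul]
    · rw [dir_succ, ← hu, ← hu', himage hw, himage hy, himage h.previous,
        projCoeff_toLp_transpose_mulVec hy hw, projCoeff_toLp_transpose_mulVec hy h.previous,
        mulVec_sub, mulVec_sub, mulVec_smul, mulVec_smul, toLp_sub, toLp_sub, toLp_smul, toLp_smul]

end Minres

namespace Solver

open RealRAM Matrix WithLp WeightedGraph Minres NatArray RealArray

variable {n k : ℕ} {G : WeightedGraph n} {par : Fin n → Fin n} {c : Fin n → ℝ} {pos : Fin n → ℕ}
  {cnt dst src : ℕ} {A B L P : Matrix (Fin n) (Fin n) ℝ} {b : Fin n → ℝ} {ε : ℝ} {s s' : State}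

/-- The preconditioner: the Laplacian of the spanning forest with the given parents. -/
noncomputable abbrev forestLaplacian (hF : G.IsMaxSpanningForest (parentGraph par c)) :
    Matrix (Fin n) (Fin n) ℝ :=
  (G.restrict (parentGraph par c) hF.le).laplacian

theorem IsPrepared.runs_solveForest (h : IsPrepared G par c pos cnt s)
    (hsrc : src ∉ [pivot, eliminated])
    (hdst : dst ∉ [RealArray.vertexWeight, parentWeight, pivot, eliminated])
    (hq : ∃ x, G.laplacian *ᵥ x = vec n s src) :
    Runs (n + 1) (solveForest dst src) s (fun s' =>
      forestLaplacian h.forest *ᵥ vec n s' dst = vec n s src) :=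
  Solver.runs_solveForest h.rooted h.ordered h.listed h.weight_eq h.forest.le hsrc hdst
    (hq.elim fun x hx => hx ▸ h.forest.exists_mulVec_eq x)

/-- The program for the four inner products of one iteration. -/
def setDotProducts : Cmd :=
  setDotProduct imageSq image precImage;;
  setDotProduct residualDot residual precImage;;
  setDotProduct secondDot secondImage precImage;;
  setDotProduct secondPrevDot secondImage prevPrecImage

theorem runs_setDotProducts (hn : s.nat order 0 = n) :
    Runs (n + 1) setDotProducts s (fun s' =>
      s'.real imageSq 0 = vec n s' image ⬝ᵥ vec n s' precImage ∧
      s'.real residualDot 0 = vec n s' residual ⬝ᵥ vec n s' precImage ∧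
      s'.real secondDot 0 = vec n s' secondImage ⬝ᵥ vec n s' precImage ∧
      s'.real secondPrevDot 0 = vec n s' secondImage ⬝ᵥ vec n s' prevPrecImage) := by
  refine (runs_setDotProduct hn (by decide) (by decide)).seq fun s₁ hf₁ h₁ => ?_
  have hn₁ : s₁.nat order 0 = n := by rw [hf₁.nat _ rfl, hn]
  refine (runs_setDotProduct hn₁ (by decide) (by decide)).seq fun s₂ hf₂ h₂ => ?_
  have hn₂ : s₂.nat order 0 = n := by rw [hf₂.nat _ rfl, hn₁]
  refine (runs_setDotProduct hn₂ (by decide) (by decide)).seq fun s₃ hf₃ h₃ => ?_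
  have hn₃ : s₃.nat order 0 = n := by rw [hf₃.nat _ rfl, hn₂]
  refine (runs_setDotProduct hn₃ (by decide) (by decide)).imp fun s₄ hf₄ h₄ => ?_
  simp_all [vec, dotProduct, hf₁.real, hf₂.real, hf₃.real, hf₄.real]

/-- The program that replaces the vectors of one iteration by those of the next. -/
def updateVectors : Cmd :=
  forLoop vertex (natVar order)
    (.setReal solution (natVar vertex) (.add (.get solution (natVar vertex))
      (.mul (.div (realVar residualDot) (realVar imageSq)) (.get direction (natVar vertex))));;
    .setReal residual (natVar vertex) (.sub (.get residual (natVar vertex))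
      (.mul (.div (realVar residualDot) (realVar imageSq)) (.get image (natVar vertex))));;
    .setReal precResidual (natVar vertex) (.sub (.get precResidual (natVar vertex))
      (.mul (.div (realVar residualDot) (realVar imageSq)) (.get precImage (natVar vertex))));;
    .setReal newDirection (.const 0) (.sub (.sub (.get precImage (natVar vertex))
      (.mul (.div (realVar secondDot) (realVar imageSq)) (.get direction (natVar vertex))))
      (.mul (.div (realVar secondPrevDot) (realVar prevImageSq))
        (.get prevDirection (natVar vertex))));;
    .setReal prevDirection (natVar vertex) (.get direction (natVar vertex));;
    .setReal direction (natVar vertex) (realVar newDirection);;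
    .setReal prevPrecImage (natVar vertex) (.get precImage (natVar vertex)))

theorem runs_updateVectors (hn : s.nat order 0 = n) :
    Runs (n + 1) updateVectors s (fun s' =>
      vec n s' solution = vec n s solution +
        (s.real residualDot 0 / s.real imageSq 0) • vec n s direction ∧
      vec n s' residual = vec n s residual -
        (s.real residualDot 0 / s.real imageSq 0) • vec n s image ∧
      vec n s' precResidual = vec n s precResidual -
        (s.real residualDot 0 / s.real imageSq 0) • vec n s precImage ∧
      vec n s' direction = vec n s precImage -
        (s.real secondDot 0 / s.real imageSq 0) • vec n s direction -
        (s.real secondPrevDot 0 / s.real prevImageSq 0) • vec n s prevDirection ∧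
      vec n s' prevDirection = vec n s direction ∧
      vec n s' prevPrecImage = vec n s precImage) := by
  let pending (s' : State) (i : ℕ) : Prop :=
    s'.real solution i = s.real solution i ∧ s'.real residual i = s.real residual i ∧
    s'.real precResidual i = s.real precResidual i ∧ s'.real direction i = s.real direction i ∧
    s'.real prevDirection i = s.real prevDirection i
  let done (s' : State) (i : ℕ) : Prop :=
    s'.real solution i = s.real solution i +
      s.real residualDot 0 / s.real imageSq 0 * s.real direction i ∧
    s'.real residual i = s.real residual i -
      s.real residualDot 0 / s.real imageSq 0 * s.real image i ∧
    s'.real precResidual i = s.real precResidual i -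
      s.real residualDot 0 / s.real imageSq 0 * s.real precImage i ∧
    s'.real direction i = s.real precImage i -
      s.real secondDot 0 / s.real imageSq 0 * s.real direction i -
      s.real secondPrevDot 0 / s.real prevImageSq 0 * s.real prevDirection i ∧
    s'.real prevDirection i = s.real direction i ∧ s'.real prevPrecImage i = s.real precImage i
  refine (Runs.forLoop (N := n) (fun j s' => (∀ i < j, done s' i) ∧ ∀ i ≥ j, pending s' i) rfl
    (fun s' hf => ?_) (by simp [pending]) ?_).imp fun s' _ ⟨hs', _⟩ => ?_
  · simp [hf.nat order, hn]
  · rintro j s' - hf hs' ⟨hdone, hpending⟩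
    refine ⟨fun i hi => ?_, fun i hi => ?_⟩
    · rcases Nat.lt_succ_iff_lt_or_eq.1 hi with hi | rfl
      · simpa [done, hs', hi.ne] using hdone i hi
      · have hp := hpending i le_rfl
        simp only [pending] at hp
        simp [done, hs', hp, hf.real image, hf.real precImage, hf.real residualDot,
          hf.real imageSq, hf.real secondDot, hf.real secondPrevDot, hf.real prevImageSq]
    · simpa [pending, hs', (Nat.lt_of_succ_le hi).ne'] using hpending i (Nat.le_of_succ_le hi)
  · simp only [done] at hs'
    refine ⟨?_, ?_, ?_, ?_, ?_, ?_⟩ <;> ext i <;> simp [vec, hs']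

/-- The memory holds the state of the method after `k` iterations, together with the inner products
and the threshold that the next iteration and the stopping test refer to. -/
structure IsIterating (A B : Matrix (Fin n) (Fin n) ℝ) (b : Fin n → ℝ) (ε : ℝ) (k : ℕ)
    (s : State) : Prop where
  state : IsState A B b k (vec n s solution) (vec n s residual) (vec n s precResidual)
    (vec n s direction) (vec n s prevDirection) (vec n s prevPrecImage)
  residualSq : s.real residualSq 0 = vec n s residual ⬝ᵥ vec n s precResidual
  prevImageSq : s.real prevImageSq 0 = (A *ᵥ vec n s prevDirection) ⬝ᵥ vec n s prevPrecImage
  threshold : ∀ L P : Matrix (Fin n) (Fin n) ℝ, L * Lᵀ = B → IsPseudoInverse L P →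
    s.real threshold 0 = (ε * ‖toLp 2 (P *ᵥ b)‖) ^ 2
  iteration : s.nat iteration 0 = k

theorem IsIterating.of_frame {p : Cmd} (h : IsIterating A B b ε k s) (hf : Frame p s s')
    (hnat : p.writesNat NatArray.iteration = false)
    (hreal : ∀ a ∈ [solution, residual, precResidual, direction, prevDirection, prevPrecImage,
      RealArray.threshold, RealArray.residualSq, RealArray.prevImageSq], p.writesReal a = false) :
    IsIterating A B b ε k s' := by
  simp only [List.forall_mem_cons] at hreal
  obtain ⟨hx, hr, hz, hu, hu', hw', hthreshold, hresidualSq, hprevImageSq, -⟩ := hreal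
  constructor
  · simpa only [vec_congr (hf.real _ hx), vec_congr (hf.real _ hr), vec_congr (hf.real _ hz),
      vec_congr (hf.real _ hu), vec_congr (hf.real _ hu'), vec_congr (hf.real _ hw')] using h.state
  · rw [hf.real _ hresidualSq, vec_congr (hf.real _ hr), vec_congr (hf.real _ hz), h.residualSq]
  · rw [hf.real _ hprevImageSq, vec_congr (hf.real _ hu'), vec_congr (hf.real _ hw'),
      h.prevImageSq]
  · rw [hf.real _ hthreshold]
    exact h.threshold
  · rw [hf.nat _ hnat, h.iteration]

/-- After `r` steps of the preconditioned method, the residual exceeds the tolerance. -/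
def ResidualExceeds (A B : Matrix (Fin n) (Fin n) ℝ) (b : Fin n → ℝ) (ε : ℝ) (r : ℕ) : Prop :=
  ∀ L P : Matrix (Fin n) (Fin n) ℝ, L * Lᵀ = B → IsPseudoInverse L P →
    ε * ‖toLp 2 (P *ᵥ b)‖ <
      ‖ConjugateResidual.residual (P * A * Pᵀ).toEuclideanLin (toLp 2 (P *ᵥ b)) r‖

namespace IsIterating

theorem threshold_lt_iff (h : IsIterating A (L * Lᵀ) b ε k s) (hε : 0 ≤ ε)
    (hP : IsPseudoInverse L P) (hker : ∀ v, (L * Lᵀ) *ᵥ v = 0 → A *ᵥ v = 0) :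
    s.real RealArray.threshold 0 < s.real RealArray.residualSq 0 ↔ ε * ‖toLp 2 (P *ᵥ b)‖ <
      ‖ConjugateResidual.residual (P * A * Pᵀ).toEuclideanLin (toLp 2 (P *ᵥ b)) k‖ := by
  rw [h.threshold L P rfl hP, h.residualSq, ← h.state.norm_residual_sq hP hker,
    sq_lt_sq₀ (by positivity) (norm_nonneg _)]

theorem residualExceeds (h : IsIterating A B b ε k s) (hε : 0 ≤ ε)
    (hker : ∀ v, B *ᵥ v = 0 → A *ᵥ v = 0)
    (hlt : s.real RealArray.threshold 0 < s.real RealArray.residualSq 0) :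
    ResidualExceeds A B b ε k := by
  rintro L P rfl hP
  exact (h.threshold_lt_iff hε hP hker).1 hlt

theorem isPreconditionedResult (h : IsIterating A B b ε k s) (hA : A.IsHermitian) (hε : 0 ≤ ε)
    (hker : ∀ v, B *ᵥ v = 0 → A *ᵥ v = 0)
    (hle : s.real RealArray.residualSq 0 ≤ s.real RealArray.threshold 0)
    (hfirst : ∀ r < k, ResidualExceeds A B b ε r) :
    IsPreconditionedResult A B b ε k (vec n s solution) := by
  rintro L P rfl hP
  exact isResult_of_toLp_eq_iter (isHermitian_preconditioned hA) (h.state.image L P rfl hP).1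
    (not_lt.1 (mt (h.threshold_lt_iff hε hP hker).2 hle.not_gt))
    fun r hr => hfirst r hr L P rfl hP

end IsIterating

theorem ResidualExceeds.lt_min {F : SimpleGraph (Fin n)} (hF : G.IsSpanningForest F)
    (h : ResidualExceeds G.laplacian (G.restrict F hF.le).laplacian b ε k) (hε : 0 ≤ ε)
    (hb : ∃ x, G.laplacian *ᵥ x = b) : k < min n (2 * G.numEdges + 1) := by
  obtain ⟨L, P, hL, hP⟩ := exists_factor_of_posSemidef (posSemidef_laplacian (G.restrict F hF.le))
  obtain ⟨x, rfl⟩ := hb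
  have hpos := (mul_nonneg hε (norm_nonneg _)).trans_lt (h L P hL hP)
  exact lt_min_iff.2 (hF.lt_of_residual_ne_zero hL hP (norm_pos_iff.1 hpos))

/-- The program for the images of the search direction in one iteration. -/
def setImages : Cmd :=
  setMulVec image direction;;
  solveForest precImage image;;
  setMulVec secondImage precImage

theorem runs_setImages (h : IsPrepared G par c pos cnt s) :
    Runs (n + s.nat rowPtr n + 1) setImages s (fun s' =>
      vec n s' image = G.laplacian *ᵥ vec n s' direction ∧
      forestLaplacian h.forest *ᵥ vec n s' precImage = vec n s' image ∧
      vec n s' secondImage = G.laplacian *ᵥ vec n s' precImage) := by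
  refine (runs_setMulVec h.loaded (by decide) (by decide)).seq fun s₁ hf₁ h₁ => ?_
  have hp₁ := h.of_frame hf₁ (by decide) (by decide)
  refine ((hp₁.runs_solveForest (by decide) (by decide) ⟨_, h₁.symm⟩).mono (by omega)).seq
    fun s₂ hf₂ h₂ => ?_
  have hp₂ := hp₁.of_frame hf₂ (by decide) (by decide)
  have hnnz : s₂.nat rowPtr n = s.nat rowPtr n := by rw [hf₂.nat rowPtr rfl, hf₁.nat rowPtr rfl]
  refine (hnnz ▸ runs_setMulVec hp₂.loaded (by decide) (by decide)).imp fun s₃ hf₃ h₃ => ?_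
  rw [vec_congr (hf₃.real image rfl), vec_congr (hf₃.real direction rfl),
    vec_congr (hf₃.real precImage rfl), vec_congr (hf₂.real image rfl),
    vec_congr (hf₂.real direction rfl), vec_congr (hf₁.real direction rfl)]
  exact ⟨h₁, h₂, h₃⟩

/-- The program that passes from one iteration to the next. -/
def updateState : Cmd :=
  updateVectors;;
  setDotProduct residualSq residual precResidual;;
  .setReal prevImageSq (.const 0) (realVar imageSq);;
  .setNat iteration (.const 0) (.add (natVar iteration) (.const 1))

theorem runs_updateState (hn : s.nat order 0 = n) (hs : IsIterating A B b ε k s)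
    (hker : ∀ v, B *ᵥ v = 0 → A *ᵥ v = 0) (hB : ∃ y, B *ᵥ y = A *ᵥ vec n s precImage)
    (himage : vec n s image = A *ᵥ vec n s direction)
    (hprec : B *ᵥ vec n s precImage = vec n s image)
    (hsecond : vec n s secondImage = A *ᵥ vec n s precImage)
    (himageSq : s.real imageSq 0 = vec n s image ⬝ᵥ vec n s precImage)
    (hresidualDot : s.real residualDot 0 = vec n s residual ⬝ᵥ vec n s precImage)
    (hsecondDot : s.real secondDot 0 = vec n s secondImage ⬝ᵥ vec n s precImage)
    (hsecondPrevDot : s.real secondPrevDot 0 = vec n s secondImage ⬝ᵥ vec n s prevPrecImage) :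
    Runs (n + 1) updateState s (IsIterating A B b ε (k + 1)) := by
  obtain ⟨y, hy⟩ := hB
  have hstep := hs.state.step hker (hprec.trans himage) hy
  rw [← himage, ← hsecond, ← himageSq, ← hresidualDot, ← hsecondDot, ← hsecondPrevDot,
    ← hs.prevImageSq] at hstep
  refine (runs_updateVectors hn).seq fun s₁ hf₁ ⟨hx, hr, hz, hu, hu', hw'⟩ => ?_
  rw [← hx, ← hr, ← hz, ← hu, ← hu', ← hw'] at hstep
  rw [himage, ← hu', ← hw', ← hf₁.real imageSq rfl] at himageSq
  have hn₁ : s₁.nat order 0 = n := by rw [hf₁.nat order rfl, hn]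
  refine (runs_setDotProduct hn₁ (by decide) (by decide)).seq
    fun s₂ hf₂ hresidualSq => ?_
  refine (Runs.of_wp (by omega) (Q := fun s₃ =>
    s₃.real RealArray.prevImageSq 0 = s₂.real imageSq 0 ∧
    s₃.nat NatArray.iteration 0 = s₂.nat NatArray.iteration 0 + 1) (by simp)).imp
    fun s₃ hf₃ ⟨hprevImageSq, hiteration⟩ => ?_
  have hvec (a : ℕ) (ha : a ≠ RealArray.residualSq ∧ a ≠ RealArray.prevImageSq) :
      vec n s₃ a = vec n s₁ a := by
    rw [vec_congr (hf₃.real a (by simp [ha])), vec_congr (hf₂.real a (by simp [ha]))]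
  constructor
  · simpa [hvec] using hstep
  · simpa [hvec, hf₃.real RealArray.residualSq] using hresidualSq
  · simpa [hvec, hprevImageSq, hf₂.real imageSq] using himageSq
  · rw [hf₃.real _ rfl, hf₂.real _ rfl, hf₁.real _ rfl]
    exact hs.threshold
  · rw [hiteration, hf₂.nat _ rfl, hf₁.nat _ rfl, hs.iteration]

/-- The program for one iteration of the method. -/
def minresStep : Cmd := setImages;; setDotProducts;; updateState

theorem runs_minresStep (h : IsPrepared G par c pos cnt s)
    (hs : IsIterating G.laplacian (forestLaplacian h.forest) b ε k s) :
    Runs (n + s.nat rowPtr n + 1) minresStep s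
      (IsIterating G.laplacian (forestLaplacian h.forest) b ε (k + 1)) := by
  refine (runs_setImages h).seq fun s₁ hf₁ ⟨himage, hprec, hsecond⟩ => ?_
  have hn₁ := (h.of_frame hf₁ (by decide) (by decide)).loaded.order
  refine ((runs_setDotProducts hn₁).mono (by omega)).seq
    fun s₂ hf₂ ⟨himageSq, hresidualDot, hsecondDot, hsecondPrevDot⟩ => ?_
  have hn₂ : s₂.nat order 0 = n := by rw [hf₂.nat order rfl, hn₁]
  have hs₂ := (hs.of_frame hf₁ (by decide) (by decide)).of_frame hf₂ (by decide) (by decide)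
  rw [← vec_congr (hf₂.real image rfl), ← vec_congr (hf₂.real direction rfl)] at himage
  rw [← vec_congr (hf₂.real image rfl), ← vec_congr (hf₂.real precImage rfl)] at hprec
  rw [← vec_congr (hf₂.real secondImage rfl), ← vec_congr (hf₂.real precImage rfl)] at hsecond
  exact (runs_updateState hn₂ hs₂ (fun v => h.forest.laplacian_mulVec_eq_zero)
    (h.forest.exists_mulVec_eq _) himage hprec hsecond himageSq hresidualDot hsecondDot
    hsecondPrevDot).mono (by omega)

/-- The program for the vectors of the initial state. -/
def setInitialVectors : Cmd :=
  setVec solution (.const 0);;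
  setVec prevDirection (.const 0);;
  setVec prevPrecImage (.const 0);;
  setVec residual (.get rhs (natVar vertex));;
  solveForest precResidual residual;;
  setVec direction (.get precResidual (natVar vertex))

theorem runs_setInitialVectors (h : IsPrepared G par c pos cnt s)
    (hcons : ∃ x, G.laplacian *ᵥ x = vec n s rhs) :
    Runs (n + 1) setInitialVectors s (fun s' =>
      IsState G.laplacian (forestLaplacian h.forest) (vec n s rhs) 0 (vec n s' solution)
        (vec n s' residual) (vec n s' precResidual) (vec n s' direction) (vec n s' prevDirection)
        (vec n s' prevPrecImage) ∧
      vec n s' prevDirection = 0) := by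
  refine (runs_setVec h.loaded.order 0 (by simp)).seq fun s₁ hf₁ hx => ?_
  have hp₁ := h.of_frame hf₁ (by simp) (by simp)
  refine (runs_setVec hp₁.loaded.order 0 (by simp)).seq fun s₂ hf₂ hu' => ?_
  have hp₂ := hp₁.of_frame hf₂ (by simp) (by simp)
  refine (runs_setVec hp₂.loaded.order 0 (by simp)).seq fun s₃ hf₃ hw' => ?_
  have hp₃ := hp₂.of_frame hf₃ (by simp) (by simp)
  refine (runs_setVec hp₃.loaded.order (vec n s rhs) fun i s' hf hi _ => ?_).seq
    fun s₄ hf₄ hr => ?_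
  · simp [vec, hi, hf.real rhs, hf₃.real rhs, hf₂.real rhs, hf₁.real rhs]
  have hp₄ := hp₃.of_frame hf₄ (by simp) (by simp)
  refine (hp₄.runs_solveForest (by decide) (by decide) (hr ▸ hcons)).seq fun s₅ hf₅ hz => ?_
  have hp₅ := hp₄.of_frame hf₅ (by decide) (by decide)
  refine (runs_setVec hp₅.loaded.order (vec n s₅ precResidual) fun i s' hf hi _ => ?_).imp
    fun s₆ hf₆ hu => ?_
  · simp [vec, hi, hf.real precResidual]
  rw [vec_congr (hf₆.real solution rfl), vec_congr (hf₅.real solution rfl),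
    vec_congr (hf₄.real solution rfl), vec_congr (hf₃.real solution rfl),
    vec_congr (hf₂.real solution rfl), hx, vec_congr (hf₆.real residual rfl),
    vec_congr (hf₅.real residual rfl), hr, hu, vec_congr (hf₆.real precResidual rfl),
    vec_congr (hf₆.real prevDirection rfl), vec_congr (hf₅.real prevDirection rfl),
    vec_congr (hf₄.real prevDirection rfl), vec_congr (hf₃.real prevDirection rfl), hu',
    vec_congr (hf₆.real prevPrecImage rfl), vec_congr (hf₅.real prevPrecImage rfl),
    vec_congr (hf₄.real prevPrecImage rfl), hw']
  exact ⟨.initial (hz.trans hr), rfl⟩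

/-- The program that initializes the method. -/
def minresSetup : Cmd :=
  setInitialVectors;;
  setDotProduct residualSq residual precResidual;;
  .setReal threshold (.const 0)
    (.mul (.mul (realVar tolerance) (realVar tolerance)) (realVar residualSq));;
  .setReal prevImageSq (.const 0) (.const 0);;
  .setNat iteration (.const 0) (.const 0)

theorem runs_minresSetup (h : IsPrepared G par c pos cnt s)
    (hcons : ∃ x, G.laplacian *ᵥ x = vec n s rhs) :
    Runs (n + 1) minresSetup s (IsIterating G.laplacian (forestLaplacian h.forest) (vec n s rhs)
      (s.real tolerance 0) 0) := by
  refine (runs_setInitialVectors h hcons).seq fun s₁ hf₁ ⟨hstate, hu'⟩ => ?_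
  have hn₁ := (h.of_frame hf₁ (by decide) (by decide)).loaded.order
  refine (runs_setDotProduct hn₁ (by decide) (by decide)).seq fun s₂ hf₂ hresidualSq => ?_
  refine (Runs.of_wp (by omega) (Q := fun s₃ =>
    s₃.real RealArray.threshold 0 =
      s₂.real tolerance 0 * s₂.real tolerance 0 * s₂.real RealArray.residualSq 0 ∧
    s₃.real RealArray.prevImageSq 0 = 0 ∧ s₃.nat NatArray.iteration 0 = 0) (by simp)).imp
    fun s₃ hf₃ ⟨hthreshold, hprevImageSq, hiteration⟩ => ?_
  have hvec (a : ℕ) (ha : a ∉ [RealArray.residualSq, RealArray.threshold, RealArray.prevImageSq]) :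
      vec n s₃ a = vec n s₁ a := by
    simp only [List.mem_cons, not_or, List.not_mem_nil] at ha
    rw [vec_congr (hf₃.real a (by simp [ha])), vec_congr (hf₂.real a (by simp [ha]))]
  constructor
  · simpa [hvec] using hstate
  · simpa [hvec, hf₃.real RealArray.residualSq] using hresidualSq
  · simp [hvec, hprevImageSq, hu']
  · intro L P hL hP
    have hker : ∀ v, (L * Lᵀ) *ᵥ v = 0 → G.laplacian *ᵥ v = 0 :=
      fun v hv => h.forest.laplacian_mulVec_eq_zero (by rwa [hL] at hv)
    have hnorm := (hL ▸ hstate).norm_residual_sq hP hker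
    rw [ConjugateResidual.residual_zero] at hnorm
    rw [hthreshold, hresidualSq, ← hnorm, hf₂.real _ rfl, hf₁.real _ rfl]
    ring
  · exact hiteration

/-- The program for the preconditioned minimal-residual method. -/
def minres : Cmd :=
  minresSetup;;
  .while (.realLt (realVar threshold) (realVar residualSq)) minresStep;;
  .setNat output (.const 0) (natVar iteration)

theorem runs_minres (h : IsPrepared G par c pos cnt s)
    (hcons : ∃ x, G.laplacian *ᵥ x = vec n s rhs) (hε : 0 ≤ s.real tolerance 0) :
    Runs ((min n (2 * G.numEdges + 1) + 1) * (n + s.nat rowPtr n + 1)) minres s (fun s' =>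
      outGraph n s' = outGraph n s ∧
      IsPreconditionedResult G.laplacian (forestLaplacian h.forest) (vec n s rhs)
        (s.real tolerance 0) (outIterations s') (outVector n s')) := by
  set b := vec n s rhs
  set ε := s.real tolerance 0
  have hker (v : Fin n → ℝ) (hv : forestLaplacian h.forest *ᵥ v = 0) : G.laplacian *ᵥ v = 0 :=
    h.forest.laplacian_mulVec_eq_zero hv
  have hbound : n + s.nat rowPtr n + 1 ≤
      (min n (2 * G.numEdges + 1) + 1) * (n + s.nat rowPtr n + 1) :=
    Nat.le_mul_of_pos_left _ (Nat.succ_pos _)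
  refine ((runs_minresSetup h hcons).mono (by omega)).seq fun s₁ hf₁ h₁ => ?_
  have hp₁ := h.of_frame hf₁ (by decide) (by decide)
  refine (Runs.whileLoop (by omega) (min n (2 * G.numEdges + 1)) (fun k s' =>
    IsIterating G.laplacian (forestLaplacian h.forest) b ε k s' ∧
    ∀ r < k, ResidualExceeds G.laplacian (forestLaplacian h.forest) b ε r)
    ⟨h₁, by simp⟩ fun k s' hf ⟨hs', hfirst⟩ hc => ?_).seq fun s₂ hf₂ ⟨k, _, ⟨h₂, hfirst⟩, hc⟩ => ?_
  · have hp := hp₁.of_frame hf (by decide) (by decide)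
    have hnnz : s'.nat rowPtr n = s.nat rowPtr n := by rw [hf.nat _ rfl, hf₁.nat _ rfl]
    have hexceeds := hs'.residualExceeds hε hker hc
    exact ⟨hexceeds.lt_min h.forest.toIsSpanningForest hε hcons, hnnz ▸
      (runs_minresStep hp hs').imp fun s'' _ hs'' => ⟨hs'', Nat.forall_lt_succ_right.2
        ⟨hfirst, hexceeds⟩⟩⟩
  · refine (Runs.of_wp (by omega) (Q := fun s₃ => s₃.nat output 0 = s₂.nat iteration 0 ∧
      s₃.nat output 1 = s₂.nat output 1) (by simp)).imp fun s₃ hf₃ ⟨hcount, hedges⟩ => ?_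
    have hresult := h₂.isPreconditionedResult G.isHermitian_laplacian hε hker (not_lt.1 hc) hfirst
    refine ⟨?_, ?_⟩
    · have htail : s₃.nat edgeTail = s.nat edgeTail := by
        rw [hf₃.nat _ rfl, hf₂.nat _ rfl, hf₁.nat _ rfl]
      have hhead : s₃.nat edgeHead = s.nat edgeHead := by
        rw [hf₃.nat _ rfl, hf₂.nat _ rfl, hf₁.nat _ rfl]
      have hlength : s₃.nat output 1 = s.nat output 1 := by
        rw [hedges, hf₂.nat _ rfl, hf₁.nat _ rfl]
      rw [outGraph, outGraph, htail, hhead, hlength]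
    · rw [show outIterations s₃ = k from hcount.trans h₂.iteration,
        show outVector n s₃ = vec n s₂ solution from vec_congr (hf₃.real solution rfl)]
      exact hresult

end Solver

namespace Solver

open RealRAM Matrix WeightedGraph Minres NatArray RealArray

variable {n m size k : ℕ} {G : WeightedGraph n} {s : State}

theorem operations_le {nnz : ℕ} (hn : 1 ≤ n) (hm : 1 ≤ m) (hnnz : nnz ≤ n + 2 * m)
    (hk : k ≤ size * ((min n (2 * m + 1) + 2) * (n + nnz + 1))) :
    (k : ℝ) ≤ 18 * size * ((n + m) * √(n * m)) := by
  have hn' : (1 : ℝ) ≤ n := by exact_mod_cast hn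
  have hm' : (1 : ℝ) ≤ m := by exact_mod_cast hm
  have hmin : (min n (2 * m + 1) + 2 : ℝ) ≤ 6 * √(n * m) := by
    have hone : 1 ≤ ((min n (2 * m + 1) : ℕ) : ℝ) := by exact_mod_cast le_min hn (by omega)
    have hsq : (min n (2 * m + 1) * min n (2 * m + 1) : ℝ) ≤ n * (2 * m + 1) := by
      exact_mod_cast Nat.mul_le_mul (min_le_left _ _) (min_le_right _ _)
    have hsqrt : (min n (2 * m + 1) / 2 : ℝ) ≤ √(n * m) := Real.le_sqrt_of_sq_le (by nlinarith)
    linarith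
  have hnnz' : (n + nnz + 1 : ℝ) ≤ 3 * (n + m) := by
    have : (nnz : ℝ) ≤ n + 2 * m := by exact_mod_cast hnnz
    linarith
  calc (k : ℝ) ≤ size * ((min n (2 * m + 1) + 2) * (n + nnz + 1)) := by exact_mod_cast hk
    _ ≤ size * (6 * √(n * m) * (3 * (n + m))) := by gcongr
    _ = _ := by ring

/-- The program that grows a maximum spanning forest and then runs the preconditioned method. -/
def solver : Cmd := spanningForest;; minres

theorem runs_solver {b : Fin n → ℝ} {ε : ℝ} (hn : 1 ≤ n) (hs : IsInput G.laplacian b ε s)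
    (hb : ∃ x, G.laplacian *ᵥ x = b) (hε : 0 ≤ ε) :
    Runs ((min n (2 * G.numEdges + 1) + 2) * (n + s.nat rowPtr n + 1)) solver s (fun s' =>
      s.nat rowPtr n ≤ n + 2 * G.numEdges ∧ ∃ hF : G.IsMaxSpanningForest (outGraph n s'),
        IsPreconditionedResult G.laplacian (G.restrict (outGraph n s') hF.le).laplacian b ε
          (outIterations s') (outVector n s')) := by
  refine ((runs_spanningForest hn hs).mono (Nat.mul_le_mul_right _ (by omega))).seq
    fun s₁ hf₁ ⟨par, c, pos, cnt, h₁, hforest⟩ => ?_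
  have hrhs : vec n s₁ rhs = b := (vec_congr (hf₁.real rhs rfl)).trans (funext hs.rhs)
  have htolerance : s₁.real tolerance 0 = ε := by rw [hf₁.real _ rfl, hs.tolerance]
  subst hrhs htolerance
  have hnnz : s₁.nat rowPtr n = s.nat rowPtr n := by rw [hf₁.nat _ rfl]
  refine (hnnz ▸ (runs_minres h₁ hb hε).mono (Nat.mul_le_mul_right _ (by omega))).imp
    fun s₂ _ ⟨hgraph, hresult⟩ => ?_
  rw [hgraph, hforest]
  exact ⟨hnnz ▸ h₁.loaded.coordinates.nnz_le.trans G.ncard_laplacian_ne_zero_le, h₁.forest, hresult⟩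

end Solver

theorem mainTheorem12 :
    ∃ (prog : RealRAM.Cmd) (C : ℝ),
      ∀ (n : ℕ) (G : WeightedGraph n) (b : Fin n → ℝ) (ε : ℝ) (s : RealRAM.State),
        1 ≤ G.numEdges →
        (∃ x, G.laplacian.mulVec x = b) →
        0 ≤ ε →
        Solver.IsInput G.laplacian b ε s →
        ∃ (s' : RealRAM.State) (k : ℕ),
          RealRAM.Exec prog s s' k ∧
          (k : ℝ) ≤ C * (((n : ℝ) + G.numEdges) * √((n : ℝ) * G.numEdges)) ∧
          ∃ hF : G.IsMaxSpanningForest (Solver.outGraph n s'),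
            Minres.IsPreconditionedResult G.laplacian
              (G.restrict (Solver.outGraph n s') hF.le).laplacian b ε
              (Solver.outIterations s') (Solver.outVector n s') ∧
            (ε = 0 → G.laplacian.mulVec (Solver.outVector n s') = b) := by
  refine ⟨Solver.solver, 18 * Solver.solver.size, fun n G b ε s hm hb hε hs => ?_⟩
  have hn : 1 ≤ n := Nat.one_le_iff_ne_zero.2 <| by
    rintro rfl
    simp [WeightedGraph.numEdges, Set.eq_empty_of_isEmpty] at hm
  obtain ⟨s', k, hexec, hk, hnnz, hF, hresult⟩ := Solver.runs_solver hn hs hb hε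
  refine ⟨s', k, hexec, Solver.operations_le hn hm hnnz hk, hF, hresult, ?_⟩
  rintro rfl
  obtain ⟨L, P, hL, hP⟩ := Minres.exists_factor_of_posSemidef
    (G.restrict (Solver.outGraph n s') hF.le).posSemidef_laplacian
  rw [← hL] at hresult
  exact hresult.mulVec_eq hP G.isHermitian_laplacian
    (fun v hv => hF.laplacian_mulVec_eq_zero (hL ▸ hv)) hb
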